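/- Let $p$ be a prime, $\mathbb F=\mathbb F_p$, $n\ge 1$, $\epsilon\in(0,1)$ and $s\ge 0$. All registers consist of qubits: an index in $[n]$ is stored in $\lceil\log_2 n\rceil$ qubits, an element of $\mathbb F$ in $\lceil\log_2 p\rceil$ qubits (binary expansion), and a vector of $\mathbb F^n$ entrywise in $n\lceil\log_2 p\rceil$ qubits. A matrix oracle for $M\in\mathbb F^{n\times n}$ is a unitary $U_M$ with $$U_M|j,k,z\rangle=|j,k,z+M_{jk}\rangle\qquad(j,k\in[n],\ z\in\mathbb F).$$ A noisy algorithm for $M$ with $s$ workspace qubits is a unitary $\mathsf{ALG}$ such that for every $v\in\mathbb F^n$ $$\mathsf{ALG}|v\rangle|0\rangle=\beta^v_{\rm succ}|v\rangle|Mv\rangle|{\rm w}_0(v)\rangle+\beta^v_{\rm fail}|v\rangle\sum_{z\ne Mv}\gamma^v_z|z\rangle|{\rm w}(v,z)\rangle,$$ where $|\beta^v_{\rm succ}|^2+|\beta^v_{\rm fail}|^2=1$, $\sum_{z\neq Mv}|\gamma^v_z|^2=1$, and all workspace states are normalised. There are absolute constants $C$ and $d$ such that for all $p,n,\epsilon,s$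 as above there is a quantum circuit $\mathsf{ALG}_{\rm verified}$ with black-box access to $U_M$, $\mathsf{ALG}$ and their adjoints, not depending on $M$, $U_M$ or $\mathsf{ALG}$, that acts on the registers of $\mathsf{ALG}$ and on ancillary qubits, one of which is called the flag (value $0$: "correct", value $1$: "incorrect"). It uses * at most $C\,n^{3/2}\log\frac2\epsilon$ queries to $U_M$ and $U_M^\dagger$, * at most $C$ queries to $\mathsf{ALG}$ and $\mathsf{ALG}^\dagger$, * at most $C\,n^{3/2}\log\frac2\epsilon\cdot\log(n+1)\cdot(\log p)^d$ additional one-qubit and two-qubit gates, * at most $C\,n\log p$ ancillary qubits (the registers of $\mathsf{ALG}$ not counted). For every $M$, every matrix oracle $U_M$ for $M$, every noisy algorithm $\mathsf{ALG}$ for $M$ and every $v\in\mathbb F^n$, there are normalised ancilla states $|\chi_z\rangle$, $z\in\mathbb F^n$, such that $$\mathsf{ALG}_{\rm verified}|v\rangle|0\rangle|0\rangle^{\rm anc}=\beta^v_{\rm succ}|v\rangle|Mv\rangle|{\rm w}_0(v)\rangle|\chi_{Mv}\rangle+\beta^v_{\rm fail}\sum_{z\ne Mv}\gamma^v_z|v\rangle|z\rangle|{\rm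 w}(v,z)\rangle|\chi_z\rangle,$$ measuring the flag of $|\chi_{Mv}\rangle$ gives $0$ with certainty, and for each $z\neq Mv$ measuring the flag of $|\chi_z\rangle$ gives $1$ with probability at least $1-\epsilon$. In particular, measuring the output register and the flag after $\mathsf{ALG}_{\rm verified}$ gives $(Mv,0)$ with probability exactly $|\beta^v_{\rm succ}|^2$, and gives $(z,1)$ for some $z\ne Mv$ with probability at least $(1-\epsilon)|\beta^v_{\rm fail}|^2$. -/

import Mathlib

open scoped Matrix

noncomputable section

namespace MvVerify

/-! ### Qubit registers -/

/-- Vectors of `(ℂ²)^{⊗ W}`, written in the computational basis, for a register whose qubits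
are labelled by `W`. -/
abbrev QState (W : Type) : Type := (W → Bool) → ℂ

/-- Linear operators on `(ℂ²)^{⊗ W}`, as matrices in the computational basis. -/
abbrev QOp (W : Type) : Type := Matrix (W → Bool) (W → Bool) ℂ

/-- The computational basis state `|x⟩`. -/
def ket {W : Type} [Fintype W] [DecidableEq W] (x : W → Bool) : QState W := Pi.single x 1

/-- The tensor product of a state of register `A` and a state of register `B`. -/
def tensor {A B : Type} (ψ : QState A) (φ : QState B) : QState (A ⊕ B) :=
  fun x => ψ (x ∘ Sum.inl) * φ (x ∘ Sum.inr)

/-- The probability that measuring all qubits of `ψ` in the computational basis gives an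
outcome in the event `S`. -/
def prob {W : Type} [Fintype W] [DecidableEq W] (ψ : QState W) (S : Set (W → Bool)) : ℝ :=
  ∑ x, S.indicator (fun y => ‖ψ y‖ ^ 2) x

/-- `ψ` is a normalised state. -/
def IsNormalised {W : Type} [Fintype W] [DecidableEq W] (ψ : QState W) : Prop :=
  ∑ x, ‖ψ x‖ ^ 2 = 1

/-- The operator `G`, acting on qubits labelled by `K`, applied to the qubits `e k` of a larger
register `W`, tensored with the identity on all other qubits of `W`. -/
def onWires {K W : Type} [Fintype K] [Fintype W] [DecidableEq W] (e : K ↪ W) (G : QOp K) :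
    QOp W :=
  Matrix.of fun x y =>
    if ∀ w, (∀ k, e k ≠ w) → x w = y w then G (x ∘ e) (y ∘ e) else 0

/-! ### Circuits with two black boxes -/

/-- One step of a circuit on the qubits `W` with access to two black-box unitaries: an input
oracle acting on qubits labelled by `K₁`, and an algorithm acting on qubits labelled by `K₂`.
The Boolean of `query` and `call` says whether the adjoint of the black box is applied. -/
inductive Instr (W K₁ K₂ : Type) : Type
  | gate1 (e : Fin 1 ↪ W) (G : Matrix.unitaryGroup (Fin 1 → Bool) ℂ)
  | gate2 (e : Fin 2 ↪ W) (G : Matrix.unitaryGroup (Fin 2 → Bool) ℂ)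
  | query (adj : Bool) (e : K₁ ↪ W)
  | call (adj : Bool) (e : K₂ ↪ W)

/-- A circuit is a finite sequence of steps; the head of the list is applied first. It contains
placeholders for the two black boxes, so it does not depend on them. -/
abbrev Circuit (W K₁ K₂ : Type) : Type := List (Instr W K₁ K₂)

section Semantics

variable {W K₁ K₂ : Type} [Fintype W] [DecidableEq W] [Fintype K₁] [Fintype K₂]

/-- The operator performed by one step, when the black boxes are `U` and `A`. -/
def Instr.op (U : QOp K₁) (A : QOp K₂) : Instr W K₁ K₂ → QOp W
  | .gate1 e G => onWires e G.1
  | .gate2 e G => onWires e G.1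
  | .query adj e => onWires e (if adj then Uᴴ else U)
  | .call adj e => onWires e (if adj then Aᴴ else A)

/-- The operator performed by a circuit, when the black boxes are `U` and `A`. -/
def Circuit.eval (U : QOp K₁) (A : QOp K₂) : Circuit W K₁ K₂ → QOp W
  | [] => 1
  | i :: c => Circuit.eval U A c * i.op U A

end Semantics

/-- Does the step apply a one-qubit or two-qubit gate? -/
def Instr.isGate {W K₁ K₂ : Type} : Instr W K₁ K₂ → Bool
  | .gate1 _ _ => true
  | .gate2 _ _ => true
  | _ => false

/-- Does the step apply the input oracle or its adjoint? -/
def Instr.isQuery {W K₁ K₂ : Type} : Instr W K₁ K₂ → Bool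
  | .query _ _ => true
  | _ => false

/-- Does the step apply the black-box algorithm or its adjoint? -/
def Instr.isCall {W K₁ K₂ : Type} : Instr W K₁ K₂ → Bool
  | .call _ _ => true
  | _ => false

/-- Number of one-qubit and two-qubit gates. -/
def Circuit.gates {W K₁ K₂ : Type} (c : Circuit W K₁ K₂) : ℕ := List.countP Instr.isGate c

/-- Number of uses of the input oracle and of its adjoint. -/
def Circuit.queries {W K₁ K₂ : Type} (c : Circuit W K₁ K₂) : ℕ := List.countP Instr.isQuery c

/-- Number of uses of the black-box algorithm and of its adjoint. -/
def Circuit.calls {W K₁ K₂ : Type} (c : Circuit W K₁ K₂) : ℕ := List.countP Instr.isCall c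

/-! ### Binary encoding of indices, field elements and vectors -/

/-- `⌈log₂ n⌉` qubits, holding an index in `[n]`. -/
abbrev IdxReg (n : ℕ) : Type := Fin (Nat.clog 2 n)

/-- `⌈log₂ p⌉` qubits, holding an element of `𝔽_p`. -/
abbrev FieldReg (p : ℕ) : Type := Fin (Nat.clog 2 p)

/-- `n⌈log₂ p⌉` qubits, holding a vector in `𝔽_p^n`. -/
abbrev VecReg (n p : ℕ) : Type := Fin n × FieldReg p

/-- Binary expansion of an index. -/
def encIdx {n : ℕ} (j : Fin n) : IdxReg n → Bool := fun b => Nat.testBit j.val b.val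

/-- Binary expansion of the representative in `{0, …, p - 1}` of a field element. -/
def encField {p : ℕ} (z : ZMod p) : FieldReg p → Bool := fun b => Nat.testBit z.val b.val

/-- Entrywise binary encoding of a vector. -/
def encVec {n p : ℕ} (v : Fin n → ZMod p) : VecReg n p → Bool := fun q => encField (v q.1) q.2

/-- The all-zeros bit string. -/
def zeros {W : Type} : W → Bool := fun _ => false

/-! ### The matrix oracle -/

/-- Qubits of the matrix oracle: row index, column index, target. -/
abbrev OracleReg (n p : ℕ) : Type := IdxReg n ⊕ (IdxReg n ⊕ FieldReg p)

/-- `|j, k, z⟩`. -/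
def oracleKet {n p : ℕ} (j k : Fin n) (z : ZMod p) : QState (OracleReg n p) :=
  tensor (ket (encIdx j)) (tensor (ket (encIdx k)) (ket (encField z)))

/-- `U` is a unitary oracle for `M`: it maps `|j, k, z⟩` to `|j, k, z + M_{jk}⟩`. Nothing is
required of its action on bit strings that do not encode a triple `(j, k, z)`. -/
def IsMatrixOracle {n p : ℕ} (M : Matrix (Fin n) (Fin n) (ZMod p)) (U : QOp (OracleReg n p)) :
    Prop :=
  U ∈ Matrix.unitaryGroup (OracleReg n p → Bool) ℂ ∧
    ∀ (j k : Fin n) (z : ZMod p), U *ᵥ oracleKet j k z = oracleKet j k (z + M j k)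

/-! ### Noisy algorithms -/

/-- Qubits of an algorithm for matrix-vector products: input vector, output vector, and `s`
qubits of workspace. -/
abbrev AlgReg (n p s : ℕ) : Type := VecReg n p ⊕ (VecReg n p ⊕ Fin s)

/-- `|v⟩|z⟩|w⟩`, with an arbitrary state `w` of the workspace. -/
def algState {n p s : ℕ} (v z : Fin n → ZMod p) (w : QState (Fin s)) : QState (AlgReg n p s) :=
  tensor (ket (encVec v)) (tensor (ket (encVec z)) w)

/-- The input state `|v⟩|0⟩`: output and workspace qubits are all zero. -/
def algInput {n p s : ℕ} (v : Fin n → ZMod p) : QState (AlgReg n p s) :=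
  tensor (ket (encVec v)) (ket zeros)

/-- On input `v` the algorithm `A` produces
`βs |v⟩|Mv⟩|w₀⟩ + βf |v⟩ ∑_{z ≠ Mv} γ_z |z⟩|w_z⟩`, where `w₀`, the `w_z` and the superposition
of wrong answers are normalised and `|βs|² + |βf|² = 1`. -/
structure IsNoisyOutput {n p s : ℕ} [NeZero p] (M : Matrix (Fin n) (Fin n) (ZMod p))
    (A : QOp (AlgReg n p s)) (v : Fin n → ZMod p) (βs βf : ℂ) (w₀ : QState (Fin s))
    (γ : (Fin n → ZMod p) → ℂ) (w : (Fin n → ZMod p) → QState (Fin s)) : Prop where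
  amplitudes : ‖βs‖ ^ 2 + ‖βf‖ ^ 2 = 1
  right_normalised : IsNormalised w₀
  wrong_normalised : ∀ z, z ≠ M *ᵥ v → IsNormalised (w z)
  wrong_weights : ∑ z with z ≠ M *ᵥ v, ‖γ z‖ ^ 2 = 1
  output : A *ᵥ algInput v = βs • algState v (M *ᵥ v) w₀ +
    βf • ∑ z with z ≠ M *ᵥ v, γ z • algState v z (w z)

/-! ### The verified algorithm -/

/-- Qubits of the verified algorithm: those of the given algorithm and `a` ancillas. -/
abbrev VerReg (n p s a : ℕ) : Type := AlgReg n p s ⊕ Fin a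

/-- The event that the output register holds `z` and the flag qubit `f` has the value `b`. -/
def outputFlag {n p s a : ℕ} (z : Fin n → ZMod p) (f : Fin a) (b : Bool) :
    Set (VerReg n p s a → Bool) :=
  {x | (fun q => x (Sum.inl (Sum.inr (Sum.inl q)))) = encVec z ∧ x (Sum.inr f) = b}

end MvVerify

end

set_option linter.unusedSectionVars false

noncomputable section

namespace MvVerify

/-! ### Operators on some wires of a larger register -/

section OnWires

variable {K W : Type} [Fintype K] [DecidableEq K] [Fintype W] [DecidableEq W]

/-! `ALG` is called once. A second circuit then tests, on fresh ancillas, whether `z = Mv` for each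
basis pair |v⟩|z⟩ in its output. It keeps |v⟩|z⟩ and does not touch the workspace, so by linearity
the superposition survives and each `z` merely acquires its own ancilla state. It remains to study
one fixed pair.

Row test. Let u be the integer ∑ₖ Mⱼₖvₖ − zⱼ, with entries represented in {0, …, p − 1}
(`rowError`). Put an L-qubit register, L = ⌈log₂ p⌉, into the uniform superposition of all a < 2^L,
multiply by exp(2πi a u/p), and undo the Hadamard gates. The amplitude of returning to 0 is 2^(−L)
∑ₐ exp(2πi a u/p), which factors over the bits of a; its modulus is ∏ |cos(2^b πu/p)|
(`norm_overlap`). It is 1 if p ∣ u. Otherwise the identity 2^k sin t ∏ cos(2^i t) = sin(2^k t),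
together with |sin(πu/p)| ≥ 2/p and 2^L ≥ p, bounds it by 1/2 (`norm_overlap_le_half`). No uniform
superposition over a range of non-dyadic length p is needed.

Search. Apply the row test to a uniform superposition of rows. A correct output leaves a = 0 with
certainty; a single wrong row already gives a ≠ 0 probability 1 − cos²θ ≥ 3/(4n). After the
preparation, and again after 1, 2, 4, …, 2^(m−1) Grover steps, the event a ≠ 0 is recorded in a new
flag. The never flagged branch is always a multiple of the same vector, and r Grover steps multiply
it by cos(2rθ), so the miss probability is cos²θ ∏ cos²(2^l · 2θ) (`normSq_flagZero_search`). The
same product identity, now with argument 2θ, bounds it by 1/(4^m · 4 sin²θ) ≤ 1/3 once 4^m ≥ n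
(`missProb_wrong`). Neither the number of wrong rows nor a random number of steps enters. For a
correct output θ = 0 and the miss probability is exactly 1.

Amplification. Fixed-point amplitude amplification with phases ±π/3 turns a miss probability e into
e³ (`normSq_indicator_fixedPoint`). It triples the cost, keeps e = 1, and needs no further ancillas.
With 3^k ≥ ln(1/ε) levels, (1/3)^(3^k) ≤ ε. One search costs O(√n) row tests of O(n) queries each,
whence n^(3/2) log(2/ε) in total.

The circuit identities hold only where the scratch qubits are clean. They are therefore stated on
the span of a set of bit strings (`supported`), and each piece is shown to preserve that span
(`Preserves`). -/

theorem extend_comp_self (e : K ↪ W) (y : K → Bool) (x : W → Bool) :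
    Function.extend e y x ∘ e = y := by
  funext k
  exact e.injective.extend_apply _ _ _

theorem extend_eq_of_agree (e : K ↪ W) (x y : W → Bool) (h : ∀ w, (∀ k, e k ≠ w) → x w = y w) :
    Function.extend e (y ∘ e) x = y := by
  funext w
  by_cases hw : ∃ k, e k = w
  · obtain ⟨k, rfl⟩ := hw
    exact e.injective.extend_apply _ _ _
  · rw [Function.extend_apply' _ _ _ hw]
    exact h w fun k hk => hw ⟨k, hk⟩

theorem extend_comp_eq_self (e : K ↪ W) (x : W → Bool) : Function.extend e (x ∘ e) x = x :=
  extend_eq_of_agree e x x fun _ _ => rfl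

/-- The strings agreeing with `x` off the image of `e` are exactly the overwritings `Function.extend
e y x`, one for each `y`. This turns the entrywise definition of `onWires` into sums over the small
register. -/
theorem sum_agree (e : K ↪ W) (x : W → Bool) (f : (W → Bool) → ℂ) :
    (∑ y, if ∀ w, (∀ k, e k ≠ w) → x w = y w then f y else 0) =
      ∑ y : K → Bool, f (Function.extend e y x) := by
  classical
  rw [← Finset.sum_filter]
  symm
  refine Finset.sum_bij (fun y _ => Function.extend e y x) ?_ ?_ ?_ ?_
  · intro y _
    simp only [Finset.mem_filter, Finset.mem_univ, true_and]
    intro w hw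
    rw [Function.extend_apply' _ _ _ (by rintro ⟨k, hk⟩; exact hw k hk)]
  · intro y _ y' _ h
    have := congrArg (fun g => g ∘ e) h
    simpa [extend_comp_self] using this
  · intro y hy
    simp only [Finset.mem_filter, Finset.mem_univ, true_and] at hy
    exact ⟨y ∘ e, Finset.mem_univ _, extend_eq_of_agree e x y hy⟩
  · intro y _
    rfl

theorem sum_eq_sum_extend (e : K ↪ W) (x : W → Bool) (f g : (W → Bool) → ℂ)
    (h : ∀ y, (∀ w, (∀ k, e k ≠ w) → x w = y w) → g y = f y)
    (h' : ∀ y, ¬ (∀ w, (∀ k, e k ≠ w) → x w = y w) → g y = 0) :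
    ∑ y, g y = ∑ y : K → Bool, f (Function.extend e y x) := by
  rw [← sum_agree]
  refine Finset.sum_congr rfl fun y _ => ?_
  split_ifs with hy
  exacts [h y hy, h' y hy]

theorem onWires_mulVec (e : K ↪ W) (G : QOp K) (ψ : QState W) (x : W → Bool) :
    (onWires e G *ᵥ ψ) x = ∑ y, G (x ∘ e) y * ψ (Function.extend e y x) := by
  have h := sum_agree e x fun y => G (x ∘ e) (y ∘ e) * ψ y
  simp only [extend_comp_self] at h
  rw [← h]
  simp only [Matrix.mulVec, dotProduct, onWires, Matrix.of_apply, ite_mul, zero_mul]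

theorem ket_apply {W : Type} [Fintype W] [DecidableEq W] (x y : W → Bool) :
    ket x y = if y = x then 1 else 0 := by
  simp [ket, Pi.single_apply]

theorem mulVec_ket (T : QOp W) (x y : W → Bool) : (T *ᵥ ket x) y = T y x := by
  simp [ket]

theorem eq_sum_ket (ψ : QState W) : ψ = ∑ x, ψ x • ket x := by
  funext y
  simp [Finset.sum_apply, ket_apply]

theorem qop_ext {S T : QOp W} (h : ∀ ψ, S *ᵥ ψ = T *ᵥ ψ) : S = T := by
  ext y x
  rw [← mulVec_ket S x y, ← mulVec_ket T x y, h]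

theorem onWires_mul (e : K ↪ W) (G H : QOp K) :
    onWires e (G * H) = onWires e G * onWires e H := by
  refine qop_ext fun ψ => ?_
  funext x
  rw [← Matrix.mulVec_mulVec, onWires_mulVec, onWires_mulVec]
  simp only [onWires_mulVec, extend_comp_self, Matrix.mul_apply, Finset.sum_mul, Finset.mul_sum]
  rw [Finset.sum_comm]
  refine Finset.sum_congr rfl fun z _ => Finset.sum_congr rfl fun y _ => ?_
  have : Function.extend e y (Function.extend e z x) = Function.extend e y x := by
    funext w
    by_cases hw : ∃ k, e k = w
    · obtain ⟨k, rfl⟩ := hw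
      simp [e.injective.extend_apply]
    · simp [Function.extend_apply' _ _ _ hw]
  rw [this, mul_assoc]

theorem onWires_one (e : K ↪ W) : onWires e (1 : QOp K) = 1 := by
  refine qop_ext fun ψ => ?_
  funext x
  rw [onWires_mulVec]
  simp [Matrix.one_apply, extend_comp_eq_self]

theorem onWires_conjTranspose (e : K ↪ W) (G : QOp K) : (onWires e G)ᴴ = onWires e Gᴴ := by
  ext x y
  simp only [Matrix.conjTranspose_apply, onWires, Matrix.of_apply]
  rw [apply_ite star, star_zero]
  refine if_congr ?_ rfl rfl
  exact forall₂_congr fun _ _ => eq_comm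

theorem onWires_mem_unitary (e : K ↪ W) {G : QOp K}
    (hG : G ∈ Matrix.unitaryGroup (K → Bool) ℂ) :
    onWires e G ∈ Matrix.unitaryGroup (W → Bool) ℂ := by
  rw [Matrix.mem_unitaryGroup_iff] at hG ⊢
  rw [Matrix.star_eq_conjTranspose] at hG ⊢
  rw [onWires_conjTranspose, ← onWires_mul, hG, onWires_one]

/-- Overwriting `x ∘ e` along `e'` and writing the result back along `e` is the same as overwriting
`x` along the composite. This makes evaluation compatible with relabelling of circuits. -/
theorem onWires_trans {K' : Type} [Fintype K'] [DecidableEq K'] (e' : K' ↪ K) (e : K ↪ W)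
    (G : QOp K') : onWires e (onWires e' G) = onWires (e'.trans e) G := by
  refine qop_ext fun ψ => ?_
  funext x
  rw [onWires_mulVec, onWires_mulVec]
  have h := onWires_mulVec e' G (fun y => ψ (Function.extend e y x)) (x ∘ e)
  simp only [Matrix.mulVec, dotProduct] at h
  rw [h]
  refine Finset.sum_congr rfl fun y _ => ?_
  congr 2
  funext w
  by_cases hw : ∃ k, e k = w
  · obtain ⟨k, rfl⟩ := hw
    rw [e.injective.extend_apply]
    by_cases hk : ∃ k', e' k' = k
    · obtain ⟨k', rfl⟩ := hk
      rw [e'.injective.extend_apply]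
      exact ((e'.trans e).injective.extend_apply y x k').symm
    · rw [Function.extend_apply' _ _ _ hk, Function.extend_apply']
      · rfl
      · rintro ⟨k', hk'⟩
        exact hk ⟨k', e.injective hk'⟩
  · rw [Function.extend_apply' _ _ _ hw, Function.extend_apply']
    rintro ⟨k', hk'⟩
    exact hw ⟨e' k', hk'⟩

theorem onWires_mulVec_ket (e : K ↪ W) (G : QOp K) (x : W → Bool) :
    onWires e G *ᵥ ket x = ∑ y, G y (x ∘ e) • ket (Function.extend e y x) := by
  funext z
  simp only [onWires_mulVec, Finset.sum_apply, Pi.smul_apply, smul_eq_mul, ket_apply]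
  by_cases h : ∀ w, (∀ k, e k ≠ w) → z w = x w
  · rw [Finset.sum_eq_single (x ∘ e), Finset.sum_eq_single (z ∘ e)]
    · rw [if_pos (extend_eq_of_agree e z x h), if_pos]
      exact (extend_eq_of_agree e x z fun w hw => (h w hw).symm).symm
    · intro y _ hy
      rw [if_neg, mul_zero]
      rintro rfl
      exact hy (extend_comp_self e y x).symm
    · simp
    · intro y _ hy
      rw [if_neg, mul_zero]
      rintro rfl
      exact hy (extend_comp_self e y z).symm
    · simp
  · push Not at h
    obtain ⟨w, hw, hne⟩ := h
    have hw' : ¬ ∃ k, e k = w := fun ⟨k, hk⟩ => hw k hk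
    rw [Finset.sum_eq_zero, Finset.sum_eq_zero]
    · intro y _
      rw [if_neg, mul_zero]
      intro h
      rw [h, Function.extend_apply' _ _ _ hw'] at hne
      exact hne rfl
    · intro y _
      rw [if_neg, mul_zero]
      intro h
      rw [← h, Function.extend_apply' _ _ _ hw'] at hne
      exact hne rfl

theorem onWires_mulVec_ket_of_eq (e : K ↪ W) {G : QOp K} {x : W → Bool}
    {y : K → Bool} (h : G *ᵥ ket (x ∘ e) = ket y) :
    onWires e G *ᵥ ket x = ket (Function.extend e y x) := by
  have h' : ∀ y', G y' (x ∘ e) = if y' = y then 1 else 0 := fun y' => by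
    rw [← mulVec_ket G (x ∘ e) y', h, ket_apply]
  rw [onWires_mulVec_ket]
  simp [h']

end OnWires

/-! ### The action of a circuit, and its inverse -/

section Action

variable {W K₁ K₂ : Type} [Fintype W] [DecidableEq W] [Fintype K₁] [DecidableEq K₁] [Fintype K₂]
  [DecidableEq K₂]

/-- The action of a circuit on states, as a linear map. -/
def act (U : QOp K₁) (A : QOp K₂) (c : Circuit W K₁ K₂) : QState W →ₗ[ℂ] QState W :=
  (c.eval U A).mulVecLin

/-- The step undoing the given step. -/
def Instr.inv : Instr W K₁ K₂ → Instr W K₁ K₂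
  | .gate1 e G => .gate1 e G⁻¹
  | .gate2 e G => .gate2 e G⁻¹
  | .query adj e => .query (!adj) e
  | .call adj e => .call (!adj) e

/-- The inverse circuit. -/
def Circuit.inv (c : Circuit W K₁ K₂) : Circuit W K₁ K₂ := (c.map Instr.inv).reverse

variable {U : QOp K₁} {A : QOp K₂}

theorem eval_append (c d : Circuit W K₁ K₂) :
    Circuit.eval U A (c ++ d) = Circuit.eval U A d * Circuit.eval U A c := by
  induction c with
  | nil => simp [Circuit.eval]
  | cons i c ih => simp only [List.cons_append, Circuit.eval, ih, Matrix.mul_assoc]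

theorem act_apply (c : Circuit W K₁ K₂) (ψ : QState W) : act U A c ψ = c.eval U A *ᵥ ψ := rfl

@[simp] theorem act_nil (ψ : QState W) : act U A ([] : Circuit W K₁ K₂) ψ = ψ := by
  simp [act_apply, Circuit.eval]

theorem act_append (c d : Circuit W K₁ K₂) (ψ : QState W) :
    act U A (c ++ d) ψ = act U A d (act U A c ψ) := by
  simp [act_apply, eval_append]

theorem act_single (i : Instr W K₁ K₂) (ψ : QState W) : act U A [i] ψ = i.op U A *ᵥ ψ := by
  simp [act_apply, Circuit.eval]

theorem op_inv (i : Instr W K₁ K₂) : i.inv.op U A = (i.op U A)ᴴ := by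
  cases i with
  | gate1 e G => rw [Instr.inv, Instr.op, Instr.op, onWires_conjTranspose]; rfl
  | gate2 e G => rw [Instr.inv, Instr.op, Instr.op, onWires_conjTranspose]; rfl
  | query adj e => cases adj <;> simp [Instr.inv, Instr.op, onWires_conjTranspose]
  | call adj e => cases adj <;> simp [Instr.inv, Instr.op, onWires_conjTranspose]

theorem eval_inv (c : Circuit W K₁ K₂) : c.inv.eval U A = (c.eval U A)ᴴ := by
  induction c with
  | nil => simp [Circuit.inv, Circuit.eval]
  | cons i c ih =>
    rw [Circuit.inv] at ih ⊢
    rw [List.map_cons, List.reverse_cons, eval_append, ih]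
    simp [Circuit.eval, op_inv, Matrix.conjTranspose_mul]

theorem op_mem_unitary (hU : U ∈ Matrix.unitaryGroup (K₁ → Bool) ℂ)
    (hA : A ∈ Matrix.unitaryGroup (K₂ → Bool) ℂ) (i : Instr W K₁ K₂) :
    i.op U A ∈ Matrix.unitaryGroup (W → Bool) ℂ := by
  have hU' : Uᴴ ∈ Matrix.unitaryGroup (K₁ → Bool) ℂ := Unitary.star_mem hU
  have hA' : Aᴴ ∈ Matrix.unitaryGroup (K₂ → Bool) ℂ := Unitary.star_mem hA
  cases i with
  | gate1 e G => exact onWires_mem_unitary e G.2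
  | gate2 e G => exact onWires_mem_unitary e G.2
  | query adj e => cases adj <;> exact onWires_mem_unitary e (by simpa)
  | call adj e => cases adj <;> exact onWires_mem_unitary e (by simpa)

theorem eval_mem_unitary (hU : U ∈ Matrix.unitaryGroup (K₁ → Bool) ℂ)
    (hA : A ∈ Matrix.unitaryGroup (K₂ → Bool) ℂ) (c : Circuit W K₁ K₂) :
    c.eval U A ∈ Matrix.unitaryGroup (W → Bool) ℂ := by
  induction c with
  | nil => exact one_mem _
  | cons i c ih => exact mul_mem ih (op_mem_unitary hU hA i)

theorem act_inv_act (hU : U ∈ Matrix.unitaryGroup (K₁ → Bool) ℂ)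
    (hA : A ∈ Matrix.unitaryGroup (K₂ → Bool) ℂ) (c : Circuit W K₁ K₂) (ψ : QState W) :
    act U A c.inv (act U A c ψ) = ψ := by
  have h := Matrix.mem_unitaryGroup_iff'.1 (eval_mem_unitary hU hA c)
  rw [Matrix.star_eq_conjTranspose] at h
  rw [act_apply, act_apply, eval_inv, Matrix.mulVec_mulVec, h, Matrix.one_mulVec]

theorem act_act_inv (hU : U ∈ Matrix.unitaryGroup (K₁ → Bool) ℂ)
    (hA : A ∈ Matrix.unitaryGroup (K₂ → Bool) ℂ) (c : Circuit W K₁ K₂) (ψ : QState W) :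
    act U A c (act U A c.inv ψ) = ψ := by
  have h := Matrix.mem_unitaryGroup_iff.1 (eval_mem_unitary hU hA c)
  rw [Matrix.star_eq_conjTranspose] at h
  rw [act_apply, act_apply, eval_inv, Matrix.mulVec_mulVec, h, Matrix.one_mulVec]

theorem star_act_dotProduct (c : Circuit W K₁ K₂) (φ ψ : QState W) :
    star (act U A c φ) ⬝ᵥ ψ = star φ ⬝ᵥ act U A c.inv ψ := by
  rw [act_apply, act_apply, eval_inv, Matrix.star_mulVec, Matrix.dotProduct_mulVec]

theorem star_act_dotProduct_act (hU : U ∈ Matrix.unitaryGroup (K₁ → Bool) ℂ)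
    (hA : A ∈ Matrix.unitaryGroup (K₂ → Bool) ℂ) (c : Circuit W K₁ K₂) (φ ψ : QState W) :
    star (act U A c φ) ⬝ᵥ act U A c ψ = star φ ⬝ᵥ ψ := by
  rw [star_act_dotProduct, act_inv_act hU hA]

/-- `d` conjugated by `c`: first `c`, then `d`, then the inverse of `c`. -/
def Circuit.conj (c d : Circuit W K₁ K₂) : Circuit W K₁ K₂ := c ++ d ++ c.inv

/-- Compute, apply a phase, uncompute: only the eigenvalue at the intermediate state `ψ` matters, so
`ψ` may contain arbitrary scratch data. All scratch qubits are cleaned in this way. -/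
theorem act_conj (hU : U ∈ Matrix.unitaryGroup (K₁ → Bool) ℂ)
    (hA : A ∈ Matrix.unitaryGroup (K₂ → Bool) ℂ) (c d : Circuit W K₁ K₂) {φ ψ : QState W} {μ : ℂ}
    (hc : act U A c φ = ψ) (hd : act U A d ψ = μ • ψ) :
    act U A (c.conj d) φ = μ • φ := by
  rw [Circuit.conj, act_append, act_append, hc, hd, map_smul, ← hc, act_inv_act hU hA]

end Action

/-! ### Resources -/

section Resources

variable {W K₁ K₂ : Type}

@[simp] theorem gates_nil : Circuit.gates ([] : Circuit W K₁ K₂) = 0 := rfl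

@[simp] theorem queries_nil : Circuit.queries ([] : Circuit W K₁ K₂) = 0 := rfl

@[simp] theorem calls_nil : Circuit.calls ([] : Circuit W K₁ K₂) = 0 := rfl

@[simp] theorem gates_append (c d : Circuit W K₁ K₂) :
    Circuit.gates (c ++ d) = c.gates + d.gates := List.countP_append

@[simp] theorem queries_append (c d : Circuit W K₁ K₂) :
    Circuit.queries (c ++ d) = c.queries + d.queries := List.countP_append

@[simp] theorem calls_append (c d : Circuit W K₁ K₂) :
    Circuit.calls (c ++ d) = c.calls + d.calls := List.countP_append

theorem countP_inv (P : Instr W K₁ K₂ → Bool) (hP : ∀ i : Instr W K₁ K₂, P i.inv = P i)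
    (c : Circuit W K₁ K₂) : List.countP P c.inv = List.countP P c := by
  rw [Circuit.inv, List.countP_reverse, List.countP_map]
  exact List.countP_congr fun i _ => by simp [hP]

@[simp] theorem gates_inv (c : Circuit W K₁ K₂) : c.inv.gates = c.gates :=
  countP_inv _ (by rintro (_ | _ | _ | _) <;> rfl) c

@[simp] theorem queries_inv (c : Circuit W K₁ K₂) : c.inv.queries = c.queries :=
  countP_inv _ (by rintro (_ | _ | _ | _) <;> rfl) c

@[simp] theorem calls_inv (c : Circuit W K₁ K₂) : c.inv.calls = c.calls :=
  countP_inv _ (by rintro (_ | _ | _ | _) <;> rfl) c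

/-- The circuits `c i`, one after the other, in some order. -/
def forAll {ι : Type} [Fintype ι] (c : ι → Circuit W K₁ K₂) : Circuit W K₁ K₂ :=
  (Finset.univ : Finset ι).toList.flatMap c

theorem countP_forAll {ι : Type} [Fintype ι] (P : Instr W K₁ K₂ → Bool)
    (c : ι → Circuit W K₁ K₂) : List.countP P (forAll c) = ∑ i, List.countP P (c i) := by
  rw [forAll, List.countP_flatMap, ← Finset.sum_map_toList]
  rfl

theorem gates_forAll_le {ι : Type} [Fintype ι] (c : ι → Circuit W K₁ K₂) (k : ℕ)
    (h : ∀ i, (c i).gates ≤ k) : (forAll c).gates ≤ Fintype.card ι * k := by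
  rw [Circuit.gates, countP_forAll]
  exact (Finset.sum_le_card_nsmul _ _ k fun i _ => h i).trans (by simp)

theorem queries_forAll_le {ι : Type} [Fintype ι] (c : ι → Circuit W K₁ K₂) (k : ℕ)
    (h : ∀ i, (c i).queries ≤ k) : (forAll c).queries ≤ Fintype.card ι * k := by
  rw [Circuit.queries, countP_forAll]
  exact (Finset.sum_le_card_nsmul _ _ k fun i _ => h i).trans (by simp)

theorem calls_forAll {ι : Type} [Fintype ι] (c : ι → Circuit W K₁ K₂)
    (h : ∀ i, (c i).calls = 0) : (forAll c).calls = 0 := by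
  rw [Circuit.calls, countP_forAll]
  exact Finset.sum_eq_zero fun i _ => h i

end Resources

/-! ### Elementary gates -/

section Gates

variable {W K₁ K₂ : Type} [Fintype W] [DecidableEq W] [Fintype K₁] [DecidableEq K₁] [Fintype K₂]
  [DecidableEq K₂]

/-- The one-qubit operator with matrix entries `g`. -/
def opOne (g : Bool → Bool → ℂ) : QOp (Fin 1) := Matrix.of fun x y => g (x 0) (y 0)

/-- The two-qubit operator with matrix entries `g`. -/
def opTwo (g : Bool × Bool → Bool × Bool → ℂ) : QOp (Fin 2) :=
  Matrix.of fun x y => g (x 0, x 1) (y 0, y 1)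

theorem sum_fin_one (f : (Fin 1 → Bool) → ℂ) : ∑ y, f y = ∑ b, f (fun _ => b) := by
  rw [← (Equiv.funUnique (Fin 1) Bool).symm.sum_comp]
  rfl

theorem sum_fin_two (f : (Fin 2 → Bool) → ℂ) : ∑ y, f y = ∑ q : Bool × Bool, f ![q.1, q.2] := by
  rw [← (finTwoArrowEquiv Bool).symm.sum_comp]
  rfl

theorem opOne_mem_unitary {g : Bool → Bool → ℂ}
    (hg : ∀ b b', ∑ c, g b c * star (g b' c) = if b = b' then 1 else 0) :
    opOne g ∈ Matrix.unitaryGroup (Fin 1 → Bool) ℂ := by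
  rw [Matrix.mem_unitaryGroup_iff]
  ext x y
  rw [Matrix.star_eq_conjTranspose, Matrix.mul_apply, sum_fin_one]
  simp only [Matrix.conjTranspose_apply, opOne, Matrix.of_apply, hg, Matrix.one_apply]
  refine if_congr ⟨fun h => funext fun i => ?_, fun h => by rw [h]⟩ rfl rfl
  rw [Subsingleton.elim i 0, h]

theorem opTwo_mem_unitary {g : Bool × Bool → Bool × Bool → ℂ}
    (hg : ∀ b b', ∑ c, g b c * star (g b' c) = if b = b' then 1 else 0) :
    opTwo g ∈ Matrix.unitaryGroup (Fin 2 → Bool) ℂ := by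
  rw [Matrix.mem_unitaryGroup_iff]
  ext x y
  rw [Matrix.star_eq_conjTranspose, Matrix.mul_apply, sum_fin_two]
  simp only [Matrix.conjTranspose_apply, opTwo, Matrix.of_apply, Matrix.cons_val_zero,
    Matrix.cons_val_one, hg, Matrix.one_apply]
  refine if_congr ⟨fun h => funext fun i => ?_, fun h => by rw [h]⟩ rfl rfl
  rw [Prod.mk.injEq] at h
  fin_cases i
  exacts [h.1, h.2]

/-- The embedding of one qubit as the wire `w`. -/
def wire (w : W) : Fin 1 ↪ W := ⟨fun _ => w, fun _ _ _ => Subsingleton.elim _ _⟩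

/-- The embedding of two qubits as the wires `w₁` and `w₂`. -/
def wirePair (w₁ w₂ : W) (h : w₁ ≠ w₂) : Fin 2 ↪ W :=
  ⟨![w₁, w₂], by
    intro i j hij
    fin_cases i <;> fin_cases j <;> simp_all [eq_comm]⟩

theorem extend_wire (w : W) (x : W → Bool) (b : Bool) :
    Function.extend (wire w) (fun _ => b) x = Function.update x w b := by
  funext w'
  by_cases h : w' = w
  · subst h
    rw [Function.update_self]
    exact (wire w').injective.extend_apply _ _ 0
  · rw [Function.update_of_ne h, Function.extend_apply']
    rintro ⟨_, rfl⟩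
    exact h rfl

theorem extend_wirePair (w₁ w₂ : W) (h : w₁ ≠ w₂) (x : W → Bool) (b b' : Bool) :
    Function.extend (wirePair w₁ w₂ h) ![b, b'] x =
      Function.update (Function.update x w₁ b) w₂ b' := by
  funext w'
  by_cases h₂ : w' = w₂
  · subst h₂
    rw [Function.update_self]
    exact (wirePair w₁ w' h).injective.extend_apply _ _ 1
  · rw [Function.update_of_ne h₂]
    by_cases h₁ : w' = w₁
    · subst h₁
      rw [Function.update_self]
      exact (wirePair w' w₂ h).injective.extend_apply _ _ 0
    · rw [Function.update_of_ne h₁, Function.extend_apply']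
      rintro ⟨i, hi⟩
      fin_cases i
      · exact h₁ hi.symm
      · exact h₂ hi.symm

open Classical in
/-- The one-qubit gate with matrix entries `g` on the wire `w`. -/
def gateOne (g : Bool → Bool → ℂ) (w : W) : Circuit W K₁ K₂ :=
  if h : opOne g ∈ Matrix.unitaryGroup (Fin 1 → Bool) ℂ then [.gate1 (wire w) ⟨opOne g, h⟩] else []

open Classical in
/-- The two-qubit gate with matrix entries `g` on the wires `w₁` and `w₂`. -/
def gateTwo (g : Bool × Bool → Bool × Bool → ℂ) (w₁ w₂ : W) : Circuit W K₁ K₂ :=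
  if h : w₁ ≠ w₂ ∧ opTwo g ∈ Matrix.unitaryGroup (Fin 2 → Bool) ℂ then
    [.gate2 (wirePair w₁ w₂ h.1) ⟨opTwo g, h.2⟩] else []

/-- Holds for every `g`, because a non-unitary matrix yields the empty circuit; unitarity has to be
checked only where the action is computed. -/
theorem gates_gateOne_le (g : Bool → Bool → ℂ) (w : W) :
    (gateOne g w : Circuit W K₁ K₂).gates ≤ 1 := by
  unfold gateOne; split <;> simp [Circuit.gates, Instr.isGate]

theorem gates_gateTwo_le (g : Bool × Bool → Bool × Bool → ℂ) (w₁ w₂ : W) :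
    (gateTwo g w₁ w₂ : Circuit W K₁ K₂).gates ≤ 1 := by
  unfold gateTwo; split <;> simp [Circuit.gates, Instr.isGate]

@[simp] theorem queries_gateOne (g : Bool → Bool → ℂ) (w : W) :
    (gateOne g w : Circuit W K₁ K₂).queries = 0 := by
  unfold gateOne; split <;> simp [Circuit.queries, Instr.isQuery]

@[simp] theorem queries_gateTwo (g : Bool × Bool → Bool × Bool → ℂ) (w₁ w₂ : W) :
    (gateTwo g w₁ w₂ : Circuit W K₁ K₂).queries = 0 := by
  unfold gateTwo; split <;> simp [Circuit.queries, Instr.isQuery]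

@[simp] theorem calls_gateOne (g : Bool → Bool → ℂ) (w : W) :
    (gateOne g w : Circuit W K₁ K₂).calls = 0 := by
  unfold gateOne; split <;> simp [Circuit.calls, Instr.isCall]

@[simp] theorem calls_gateTwo (g : Bool × Bool → Bool × Bool → ℂ) (w₁ w₂ : W) :
    (gateTwo g w₁ w₂ : Circuit W K₁ K₂).calls = 0 := by
  unfold gateTwo; split <;> simp [Circuit.calls, Instr.isCall]

variable {U : QOp K₁} {A : QOp K₂}

theorem act_gateOne {g : Bool → Bool → ℂ}
    (hg : ∀ b b', ∑ c, g b c * star (g b' c) = if b = b' then 1 else 0) (w : W) (x : W → Bool) :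
    act U A (gateOne g w) (ket x) = ∑ b, g b (x w) • ket (Function.update x w b) := by
  rw [gateOne, dif_pos (opOne_mem_unitary hg), act_single, Instr.op, onWires_mulVec_ket]
  funext z
  simp only [Finset.sum_apply, Pi.smul_apply, smul_eq_mul]
  rw [sum_fin_one]
  simp only [extend_wire]
  rfl

theorem act_gateTwo {g : Bool × Bool → Bool × Bool → ℂ}
    (hg : ∀ b b', ∑ c, g b c * star (g b' c) = if b = b' then 1 else 0) {w₁ w₂ : W}
    (h : w₁ ≠ w₂) (x : W → Bool) :
    act U A (gateTwo g w₁ w₂) (ket x) = ∑ b : Bool × Bool, g b (x w₁, x w₂) •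
      ket (Function.update (Function.update x w₁ b.1) w₂ b.2) := by
  rw [gateTwo, dif_pos ⟨h, opTwo_mem_unitary hg⟩, act_single, Instr.op, onWires_mulVec_ket]
  funext z
  simp only [Finset.sum_apply, Pi.smul_apply, smul_eq_mul]
  rw [sum_fin_two]
  simp only [extend_wirePair]
  rfl

/-- The NOT gate. -/
def xGate (w : W) : Circuit W K₁ K₂ := gateOne (fun b c => if b = !c then 1 else 0) w

/-- The Hadamard gate. -/
def had (w : W) : Circuit W K₁ K₂ :=
  gateOne (fun b c => ((√2)⁻¹ : ℝ) * if b && c then -1 else 1) w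

/-- The phase gate. -/
def phaseGate (θ : ℝ) (w : W) : Circuit W K₁ K₂ :=
  gateOne (fun b c => if b = c then (if b then Complex.exp (θ * Complex.I) else 1) else 0) w

/-- The controlled NOT gate. -/
def cx (c t : W) : Circuit W K₁ K₂ :=
  gateTwo (fun q r => if q = (r.1, xor r.2 r.1) then 1 else 0) c t

/-- The controlled phase gate. -/
def cp (θ : ℝ) (c t : W) : Circuit W K₁ K₂ :=
  gateTwo (fun q r => if q = r then (if q.1 && q.2 then Complex.exp (θ * Complex.I) else 1) else 0)
    c t

/-- The rotation of the plane spanned by `|10⟩` and `|01⟩` that maps `|10⟩` to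
`a|10⟩ + s|01⟩`. -/
def givens (a s : ℝ) (w₁ w₂ : W) : Circuit W K₁ K₂ :=
  gateTwo (fun q r =>
    if q.1 = q.2 ∨ r.1 = r.2 then (if q = r then 1 else 0)
    else if q = r then (a : ℂ) else if r.1 then (s : ℂ) else (-s : ℂ)) w₁ w₂

theorem norm_exp_mul_star (θ : ℝ) :
    Complex.exp (θ * Complex.I) * (starRingEnd ℂ) (Complex.exp (θ * Complex.I)) = 1 := by
  rw [Complex.mul_conj, Complex.normSq_eq_norm_sq, Complex.norm_exp_ofReal_mul_I]
  simp

theorem act_xGate (w : W) (x : W → Bool) :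
    act U A (xGate w) (ket x) = ket (Function.update x w (!x w)) := by
  rw [xGate, act_gateOne]
  · cases x w <;> simp
  · intro b b'
    cases b <;> cases b' <;> simp

theorem act_had (w : W) (x : W → Bool) :
    act U A (had w) (ket x) = (((√2)⁻¹ : ℝ) : ℂ) •
      (ket (Function.update x w false) +
        (if x w then -1 else 1 : ℂ) • ket (Function.update x w true)) := by
  have h : (((√2)⁻¹ : ℝ) : ℂ) * (((√2)⁻¹ : ℝ) : ℂ) = 1 / 2 := by
    rw [← Complex.ofReal_mul, ← mul_inv, Real.mul_self_sqrt (by norm_num)]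
    norm_num
  rw [had, act_gateOne]
  · cases x w <;> simp [add_comm]
  · intro b b'
    cases b <;> cases b' <;> simp [-Complex.ofReal_inv, Complex.conj_ofReal, h] <;> norm_num

theorem act_phaseGate (θ : ℝ) (w : W) (x : W → Bool) :
    act U A (phaseGate θ w) (ket x) =
      (if x w then Complex.exp (θ * Complex.I) else 1 : ℂ) • ket x := by
  rw [phaseGate, act_gateOne]
  · conv_rhs => rw [← Function.update_eq_self w x]
    cases x w <;> simp
  · intro b b'
    cases b <;> cases b' <;> simp [-Complex.exp_conj, norm_exp_mul_star]

theorem act_cx {c t : W} (h : c ≠ t) (x : W → Bool) :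
    act U A (cx c t) (ket x) = ket (Function.update x t (xor (x t) (x c))) := by
  rw [cx, act_gateTwo _ h]
  · simp
  · rintro ⟨b, b'⟩ ⟨c, c'⟩
    cases b <;> cases b' <;> cases c <;> cases c' <;> simp [Fintype.sum_prod_type]

theorem act_cp (θ : ℝ) {c t : W} (h : c ≠ t) (x : W → Bool) :
    act U A (cp θ c t) (ket x) =
      (if x c && x t then Complex.exp (θ * Complex.I) else 1 : ℂ) • ket x := by
  rw [cp, act_gateTwo _ h]
  · simp
  · rintro ⟨b, b'⟩ ⟨c, c'⟩
    cases b <;> cases b' <;> cases c <;> cases c' <;>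
      simp [-Complex.exp_conj, norm_exp_mul_star]

theorem act_givens {a s : ℝ} (has : a ^ 2 + s ^ 2 = 1) {w₁ w₂ : W} (h : w₁ ≠ w₂) (x : W → Bool) :
    act U A (givens a s w₁ w₂) (ket x) =
      if x w₁ = x w₂ then ket x
      else (a : ℂ) • ket x + (if x w₁ then (s : ℂ) else -s) •
        ket (Function.update (Function.update x w₁ (x w₂)) w₂ (x w₁)) := by
  have has' : (a : ℂ) ^ 2 + (s : ℂ) ^ 2 = 1 := by exact_mod_cast has
  have hx : Function.update (Function.update x w₁ (x w₁)) w₂ (x w₂) = x := by simp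
  rw [givens, act_gateTwo _ h]
  · revert hx
    cases x w₁ <;> cases x w₂ <;> intro hx <;> simp [Fintype.sum_prod_type, hx, add_comm]
  · rintro ⟨b, b'⟩ ⟨c, c'⟩
    cases b <;> cases b' <;> cases c <;> cases c' <;>
      simp [Fintype.sum_prod_type] <;>
      first | linear_combination has' | ring

/-! ### Phases controlled by several qubits -/

theorem update_not_not (x : W → Bool) (w : W) :
    Function.update (Function.update x w (!x w)) w (!Function.update x w (!x w) w) = x := by
  simp

/-- The doubly controlled phase gate. -/
def ccp (θ : ℝ) (u v w : W) : Circuit W K₁ K₂ :=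
  cp (θ / 2) v w ++ cx u v ++ cp (-(θ / 2)) v w ++ cx u v ++ cp (θ / 2) u w

/-- For bits, u + v − (u ⊕ v) = 2uv. The three controlled phases contribute θ/2 times v, −(u ⊕ v)
and u, each multiplied by w. -/
theorem act_ccp (θ : ℝ) {u v w : W} (huv : u ≠ v) (huw : u ≠ w) (hvw : v ≠ w) (x : W → Bool) :
    act U A (ccp θ u v w) (ket x) =
      (if x u && x v && x w then Complex.exp (θ * Complex.I) else 1 : ℂ) • ket x := by
  have h : Complex.exp ((θ / 2 : ℝ) * Complex.I) * Complex.exp ((θ / 2 : ℝ) * Complex.I) =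
      Complex.exp (θ * Complex.I) := by
    rw [← Complex.exp_add]; push_cast; ring_nf
  have h' : Complex.exp ((-(θ / 2) : ℝ) * Complex.I) * Complex.exp ((θ / 2 : ℝ) * Complex.I) =
      1 := by
    rw [← Complex.exp_add]; push_cast; ring_nf; simp
  simp only [ccp, act_append, act_cp _ hvw, act_cp _ huw, act_cx huv, map_smul]
  generalize Complex.exp ((θ / 2 : ℝ) * Complex.I) = a at *
  generalize Complex.exp ((-(θ / 2) : ℝ) * Complex.I) = b at *
  have h'' : a * b = 1 := by rw [mul_comm, h']
  have hx : Function.update x v (x v) = x := by simp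
  simp only [Function.update_self, Function.update_of_ne huv, Function.update_of_ne hvw.symm,
    Function.update_idem]
  revert hx
  cases x u <;> cases x v <;> cases x w <;> intro hx <;> simp [hx, smul_smul, h, h', h'']

/-- A sign flip of `t` conjugated by Hadamard gates is a NOT. The bit `q` records whether `d`
applies the sign, a decision that must not depend on `t`, hence the hypothesis for both values `b`.
-/
theorem act_had_conj {d : Circuit W K₁ K₂} (t : W) (x : W → Bool) (q : Bool)
    (hd : ∀ b, act U A d (ket (Function.update x t b)) =
      (if b && q then -1 else 1 : ℂ) • ket (Function.update x t b)) :
    act U A (had t ++ d ++ had t) (ket x) = ket (Function.update x t (xor (x t) q)) := by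
  have h : (((√2)⁻¹ : ℝ) : ℂ) * (((√2)⁻¹ : ℝ) : ℂ) = 1 / 2 := by
    rw [← Complex.ofReal_mul, ← mul_inv, Real.mul_self_sqrt (by norm_num)]
    norm_num
  simp only [act_append, act_had, map_smul, map_add, hd]
  funext z
  simp only [Pi.smul_apply, Pi.add_apply, smul_eq_mul, Function.update_idem, Function.update_self]
  generalize (((√2)⁻¹ : ℝ) : ℂ) = r at h
  cases x t <;> cases q <;> simp
  · linear_combination (2 * ket (Function.update x t false) z) * h
  · linear_combination (2 * ket (Function.update x t true) z) * h
  · linear_combination (2 * ket (Function.update x t true) z) * h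
  · linear_combination (2 * ket (Function.update x t false) z) * h

/-- The Toffoli gate. -/
def ccx (u v t : W) : Circuit W K₁ K₂ := had t ++ ccp Real.pi u v t ++ had t

theorem act_ccx {u v t : W} (huv : u ≠ v) (hut : u ≠ t) (hvt : v ≠ t) (x : W → Bool) :
    act U A (ccx u v t) (ket x) = ket (Function.update x t (xor (x t) (x u && x v))) := by
  refine act_had_conj t x _ fun b => ?_
  rw [act_ccp _ huv hut hvt]
  congr 1
  cases b <;> simp [hut, hvt]

/-- Writes into `cw (k + ws.length)` whether `cw k` is one and all of `ws` are zero, provided that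
`cw (k + 1), …` are zero. -/
def zeroChain (cw : ℕ → W) : List W → ℕ → Circuit W K₁ K₂
  | [], _ => []
  | w :: ws, k => xGate w ++ ccx (cw k) w (cw (k + 1)) ++ xGate w ++ zeroChain cw ws (k + 1)

/-- Each Toffoli gate writes the conjunction so far into the next link. Only the last link is
described: the others are uncomputed when the chain is used inside a conjugation. -/
theorem act_zeroChain (cw : ℕ → W) (ws : List W) (k : ℕ) (x : W → Bool)
    (hws : ∀ w ∈ ws, ∀ i ≤ k + ws.length, w ≠ cw i)
    (hcw : Set.InjOn cw (Set.Iic (k + ws.length)))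
    (hx : ∀ i ≤ k + ws.length, k < i → x (cw i) = false) :
    ∃ y, act U A (zeroChain cw ws k) (ket x) = ket y ∧
      y (cw (k + ws.length)) = (x (cw k) && decide (∀ w ∈ ws, x w = false)) := by
  induction ws generalizing k x with
  | nil => exact ⟨x, by simp [zeroChain]⟩
  | cons w ws ih =>
    have hlen : k + (w :: ws).length = k + 1 + ws.length := by simp; ring
    rw [hlen] at hws hcw hx ⊢
    have hne : ∀ i ≤ k + 1 + ws.length, w ≠ cw i := hws w (by simp)
    have hkk : cw k ≠ cw (k + 1) := fun h => by
      have := hcw (by simp only [Set.mem_Iic]; omega) (by simp only [Set.mem_Iic]; omega) h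
      omega
    set x' := Function.update x (cw (k + 1)) (x (cw k) && !x w) with hx'
    obtain ⟨y, hy, hy'⟩ := ih (k + 1) x' (fun w' hw' => hws w' (by simp [hw'])) hcw
      (by
        intro i hi hki
        rw [hx', Function.update_of_ne, hx i hi (by omega)]
        intro h
        have := hcw (Set.mem_Iic.2 hi) (by simp only [Set.mem_Iic]; omega) h
        omega)
    refine ⟨y, ?_, ?_⟩
    · rw [← hy]
      simp only [zeroChain, act_append, act_xGate]
      rw [act_ccx (hne k (by omega)).symm hkk (hne (k + 1) (by omega)), act_xGate]
      congr 2
      funext w'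
      have h1 := hne k (by omega)
      have h2 := hne (k + 1) (by omega)
      have h3 := hx (k + 1) (by omega) (by omega)
      by_cases e1 : w' = w
      · subst e1
        simp [hx', h2]
      · by_cases e2 : w' = cw (k + 1)
        · subst e2
          simp [hx', h1.symm, h2.symm, h3]
        · simp [hx', e1, e2]
    · rw [hy']
      have h4 : ∀ w' ∈ ws, x' w' = x w' := fun w' hw' => by
        rw [hx', Function.update_of_ne (hws w' (by simp [hw']) _ (by omega))]
      have h5 : x' (cw (k + 1)) = (x (cw k) && !x w) := by rw [hx', Function.update_self]
      rw [h5, Bool.eq_iff_iff]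
      simp only [Bool.and_eq_true, Bool.not_eq_true', decide_eq_true_eq, List.forall_mem_cons]
      rw [and_assoc]
      refine and_congr_right fun _ => and_congr_right fun _ => ?_
      exact forall₂_congr fun w' hw' => by rw [h4 w' hw']

/-- Multiplies by the phase `exp(iθ)` if all of `ws` are zero. -/
def zeroPhase (cw : ℕ → W) (θ : ℝ) (ws : List W) : Circuit W K₁ K₂ :=
  Circuit.conj (xGate (cw 0) ++ zeroChain cw ws 0) (phaseGate θ (cw ws.length))

theorem act_zeroPhase (hU : U ∈ Matrix.unitaryGroup (K₁ → Bool) ℂ)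
    (hA : A ∈ Matrix.unitaryGroup (K₂ → Bool) ℂ) (cw : ℕ → W) (θ : ℝ) (ws : List W) (x : W → Bool)
    (hws : ∀ w ∈ ws, ∀ i ≤ ws.length, w ≠ cw i) (hcw : Set.InjOn cw (Set.Iic ws.length))
    (hx : ∀ i ≤ ws.length, x (cw i) = false) :
    act U A (zeroPhase cw θ ws) (ket x) =
      (if ∀ w ∈ ws, x w = false then Complex.exp (θ * Complex.I) else 1 : ℂ) • ket x := by
  obtain ⟨y, hy, hy'⟩ := act_zeroChain (U := U) (A := A) cw ws 0
    (Function.update x (cw 0) (!x (cw 0))) (by simpa using hws) (by simpa using hcw) (by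
      intro i hi hi0
      rw [zero_add] at hi
      rw [Function.update_of_ne, hx i hi]
      intro h
      have := hcw (Set.mem_Iic.2 hi) (Set.mem_Iic.2 (Nat.zero_le _)) h
      omega)
  rw [zero_add] at hy'
  refine act_conj hU hA _ _ (ψ := ket y) (by rw [act_append, act_xGate, hy]) ?_
  rw [act_phaseGate, hy']
  congr 1
  simp only [Function.update_self, hx 0 (Nat.zero_le _), Bool.not_false, Bool.true_and,
    decide_eq_true_eq]
  refine if_congr (forall₂_congr fun w hw => ?_) rfl rfl
  rw [Function.update_of_ne (hws w hw 0 (Nat.zero_le _))]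

/-- Multiplies by the phase `exp(iθ)` if `c` is one and all of `ws` are zero. -/
def ctrlPhase (cw : ℕ → W) (θ : ℝ) (c : W) (ws : List W) : Circuit W K₁ K₂ :=
  xGate c ++ zeroPhase cw θ (c :: ws) ++ xGate c

/-- The NOT gates around the phase turn the condition that `c` is one into one more zero test, so
the chain is one link longer than `ws.length`. -/
theorem act_ctrlPhase (hU : U ∈ Matrix.unitaryGroup (K₁ → Bool) ℂ)
    (hA : A ∈ Matrix.unitaryGroup (K₂ → Bool) ℂ) (cw : ℕ → W) (θ : ℝ) (c : W) (ws : List W)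
    (x : W → Bool) (hc : c ∉ ws) (hcc : ∀ i ≤ ws.length + 1, c ≠ cw i)
    (hws : ∀ w ∈ ws, ∀ i ≤ ws.length + 1, w ≠ cw i)
    (hcw : Set.InjOn cw (Set.Iic (ws.length + 1)))
    (hx : ∀ i ≤ ws.length + 1, x (cw i) = false) :
    act U A (ctrlPhase cw θ c ws) (ket x) =
      (if x c = true ∧ ∀ w ∈ ws, x w = false then Complex.exp (θ * Complex.I) else 1 : ℂ) •
        ket x := by
  rw [ctrlPhase, act_append, act_append, act_xGate, act_zeroPhase hU hA cw θ (c :: ws), map_smul,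
    act_xGate, update_not_not]
  · congr 1
    simp only [List.forall_mem_cons, Function.update_self, Bool.not_eq_false']
    refine if_congr (and_congr_right fun _ => forall₂_congr fun w hw => ?_) rfl rfl
    rw [Function.update_of_ne]
    rintro rfl
    exact hc hw
  · intro w hw i hi
    rcases List.mem_cons.1 hw with rfl | hw
    exacts [hcc i hi, hws w hw i hi]
  · exact hcw
  · intro i hi
    rw [Function.update_of_ne (hcc i hi).symm, hx i hi]

/-- Flips `t` if not all of `ws` are zero. -/
def flagIf (cw : ℕ → W) (ws : List W) (t : W) : Circuit W K₁ K₂ :=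
  xGate t ++ (had t ++ ctrlPhase cw Real.pi t ws ++ had t)

/-- Conjugating the phase −1, controlled by `t` and by the zero test, gives a NOT on `t` when all of
`ws` vanish; the extra `xGate` reverses the condition. -/
theorem act_flagIf (hU : U ∈ Matrix.unitaryGroup (K₁ → Bool) ℂ)
    (hA : A ∈ Matrix.unitaryGroup (K₂ → Bool) ℂ) (cw : ℕ → W) (t : W) (ws : List W)
    (x : W → Bool) (ht : t ∉ ws) (htc : ∀ i ≤ ws.length + 1, t ≠ cw i)
    (hws : ∀ w ∈ ws, ∀ i ≤ ws.length + 1, w ≠ cw i)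
    (hcw : Set.InjOn cw (Set.Iic (ws.length + 1)))
    (hx : ∀ i ≤ ws.length + 1, x (cw i) = false) :
    act U A (flagIf cw ws t) (ket x) =
      ket (Function.update x t (xor (x t) !decide (∀ w ∈ ws, x w = false))) := by
  rw [flagIf, act_append, act_xGate, act_had_conj (q := decide (∀ w ∈ ws, x w = false))]
  · congr 1
    rw [Function.update_idem, Function.update_self]
    cases x t <;> simp
  · intro b
    rw [Function.update_idem, act_ctrlPhase hU hA cw _ t ws _ ht htc hws hcw]
    · congr 1
      simp only [Function.update_self, Bool.and_eq_true, decide_eq_true_eq, Complex.exp_pi_mul_I]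
      refine if_congr (and_congr_right fun _ => forall₂_congr fun w hw => ?_) rfl rfl
      rw [Function.update_of_ne]
      rintro rfl
      exact ht hw
    · intro i hi
      rw [Function.update_of_ne (htc i hi).symm, hx i hi]

/-! ### Resources of the composite gates -/

theorem gates_xGate_le (w : W) : (xGate w : Circuit W K₁ K₂).gates ≤ 1 := gates_gateOne_le _ _

theorem gates_had_le (w : W) : (had w : Circuit W K₁ K₂).gates ≤ 1 := gates_gateOne_le _ _

theorem gates_ccp_le (θ : ℝ) (u v w : W) : (ccp θ u v w : Circuit W K₁ K₂).gates ≤ 5 := by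
  have h₁ (θ : ℝ) (a b : W) : (cp θ a b : Circuit W K₁ K₂).gates ≤ 1 := gates_gateTwo_le _ _ _
  have h₂ : (cx u v : Circuit W K₁ K₂).gates ≤ 1 := gates_gateTwo_le _ _ _
  have := h₁ (θ / 2) v w
  have := h₁ (-(θ / 2)) v w
  have := h₁ (θ / 2) u w
  simp only [ccp, gates_append]
  omega

theorem gates_zeroChain_le (cw : ℕ → W) (ws : List W) (k : ℕ) :
    (zeroChain cw ws k : Circuit W K₁ K₂).gates ≤ 9 * ws.length := by
  induction ws generalizing k with
  | nil => simp [zeroChain]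
  | cons w ws ih =>
    have := ih (k + 1)
    have := gates_xGate_le (K₁ := K₁) (K₂ := K₂) w
    have := gates_had_le (K₁ := K₁) (K₂ := K₂) (cw (k + 1))
    have := gates_ccp_le (K₁ := K₁) (K₂ := K₂) Real.pi (cw k) w (cw (k + 1))
    simp only [zeroChain, ccx, gates_append, List.length_cons]
    omega

theorem gates_zeroPhase_le (cw : ℕ → W) (θ : ℝ) (ws : List W) :
    (zeroPhase cw θ ws : Circuit W K₁ K₂).gates ≤ 18 * ws.length + 3 := by
  have := gates_zeroChain_le (K₁ := K₁) (K₂ := K₂) cw ws 0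
  have := gates_xGate_le (K₁ := K₁) (K₂ := K₂) (cw 0)
  have : (phaseGate θ (cw ws.length) : Circuit W K₁ K₂).gates ≤ 1 := gates_gateOne_le _ _
  simp only [zeroPhase, Circuit.conj, gates_append, gates_inv]
  omega

theorem gates_ctrlPhase_le (cw : ℕ → W) (θ : ℝ) (c : W) (ws : List W) :
    (ctrlPhase cw θ c ws : Circuit W K₁ K₂).gates ≤ 18 * ws.length + 23 := by
  have h := gates_zeroPhase_le (K₁ := K₁) (K₂ := K₂) cw θ (c :: ws)
  have := gates_xGate_le (K₁ := K₁) (K₂ := K₂) c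
  rw [List.length_cons] at h
  simp only [ctrlPhase, gates_append]
  omega

theorem gates_flagIf_le (cw : ℕ → W) (ws : List W) (t : W) :
    (flagIf cw ws t : Circuit W K₁ K₂).gates ≤ 18 * ws.length + 26 := by
  have := gates_ctrlPhase_le (K₁ := K₁) (K₂ := K₂) cw Real.pi t ws
  have := gates_xGate_le (K₁ := K₁) (K₂ := K₂) t
  have := gates_had_le (K₁ := K₁) (K₂ := K₂) t
  simp only [flagIf, gates_append]
  omega

@[simp] theorem queries_xGate (w : W) : (xGate w : Circuit W K₁ K₂).queries = 0 :=
  queries_gateOne _ _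

@[simp] theorem queries_had (w : W) : (had w : Circuit W K₁ K₂).queries = 0 := queries_gateOne _ _

@[simp] theorem queries_ccp (θ : ℝ) (u v w : W) : (ccp θ u v w : Circuit W K₁ K₂).queries = 0 := by
  simp [ccp, cp, cx]

@[simp] theorem queries_zeroChain (cw : ℕ → W) (ws : List W) (k : ℕ) :
    (zeroChain cw ws k : Circuit W K₁ K₂).queries = 0 := by
  induction ws generalizing k with
  | nil => rfl
  | cons w ws ih => simp [zeroChain, ccx, ih]

@[simp] theorem queries_zeroPhase (cw : ℕ → W) (θ : ℝ) (ws : List W) :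
    (zeroPhase cw θ ws : Circuit W K₁ K₂).queries = 0 := by
  simp [zeroPhase, Circuit.conj, phaseGate]

@[simp] theorem queries_ctrlPhase (cw : ℕ → W) (θ : ℝ) (c : W) (ws : List W) :
    (ctrlPhase cw θ c ws : Circuit W K₁ K₂).queries = 0 := by simp [ctrlPhase]

@[simp] theorem queries_flagIf (cw : ℕ → W) (ws : List W) (t : W) :
    (flagIf cw ws t : Circuit W K₁ K₂).queries = 0 := by simp [flagIf]

@[simp] theorem calls_xGate (w : W) : (xGate w : Circuit W K₁ K₂).calls = 0 := calls_gateOne _ _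

@[simp] theorem calls_had (w : W) : (had w : Circuit W K₁ K₂).calls = 0 := calls_gateOne _ _

@[simp] theorem calls_ccp (θ : ℝ) (u v w : W) : (ccp θ u v w : Circuit W K₁ K₂).calls = 0 := by
  simp [ccp, cp, cx]

@[simp] theorem calls_zeroChain (cw : ℕ → W) (ws : List W) (k : ℕ) :
    (zeroChain cw ws k : Circuit W K₁ K₂).calls = 0 := by
  induction ws generalizing k with
  | nil => rfl
  | cons w ws ih => simp [zeroChain, ccx, ih]

@[simp] theorem calls_zeroPhase (cw : ℕ → W) (θ : ℝ) (ws : List W) :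
    (zeroPhase cw θ ws : Circuit W K₁ K₂).calls = 0 := by
  simp [zeroPhase, Circuit.conj, phaseGate]

@[simp] theorem calls_ctrlPhase (cw : ℕ → W) (θ : ℝ) (c : W) (ws : List W) :
    (ctrlPhase cw θ c ws : Circuit W K₁ K₂).calls = 0 := by simp [ctrlPhase]

@[simp] theorem calls_flagIf (cw : ℕ → W) (ws : List W) (t : W) :
    (flagIf cw ws t : Circuit W K₁ K₂).calls = 0 := by simp [flagIf]

end Gates

/-! ### States supported on a set of bit strings -/

section Support

variable {W K₁ K₂ : Type} [Fintype W] [DecidableEq W] [Fintype K₁] [DecidableEq K₁] [Fintype K₂]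
  [DecidableEq K₂] {U : QOp K₁} {A : QOp K₂}

/-- The states that are superpositions of the basis states in `S`. -/
def supported (S : Set (W → Bool)) : Submodule ℂ (QState W) where
  carrier := {ψ | ∀ x, x ∉ S → ψ x = 0}
  add_mem' := fun hψ hφ x hx => by rw [Pi.add_apply, hψ x hx, hφ x hx, add_zero]
  zero_mem' := fun _ _ => rfl
  smul_mem' := fun a ψ hψ x hx => by rw [Pi.smul_apply, hψ x hx, smul_zero]

theorem supported_mono {S T : Set (W → Bool)} (h : S ⊆ T) : supported S ≤ supported T :=
  fun _ hψ x hx => hψ x fun hS => hx (h hS)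

theorem ket_mem_supported {S : Set (W → Bool)} {x : W → Bool} (hx : x ∈ S) :
    ket x ∈ supported S := fun y hy => by
  rw [ket_apply, if_neg]
  rintro rfl
  exact hy hx

theorem indicator_mem_supported {S : Set (W → Bool)} (T : Set (W → Bool)) {ψ : QState W}
    (hψ : ψ ∈ supported S) : T.indicator ψ ∈ supported (S ∩ T) := fun x hx => by
  by_cases hT : x ∈ T
  · rw [Set.indicator_of_mem hT]
    exact hψ x fun hS => hx ⟨hS, hT⟩
  · rw [Set.indicator_of_notMem hT]

/-- A linear map that sends the basis states in `S` to states in a subspace sends every state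
supported on `S` there. -/
theorem map_mem_of_supported {S : Set (W → Bool)} {P : Submodule ℂ (QState W)}
    (T : QState W →ₗ[ℂ] QState W) (hT : ∀ x ∈ S, T (ket x) ∈ P) {ψ : QState W}
    (hψ : ψ ∈ supported S) : T ψ ∈ P := by
  rw [eq_sum_ket ψ, map_sum]
  refine P.sum_mem fun x _ => ?_
  rw [map_smul]
  by_cases hx : x ∈ S
  · exact P.smul_mem _ (hT x hx)
  · rw [hψ x hx, zero_smul]
    exact P.zero_mem

/-- The circuit maps the states supported on `S` to such states. -/
def Preserves (U : QOp K₁) (A : QOp K₂) (S : Set (W → Bool)) (c : Circuit W K₁ K₂) : Prop :=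
  ∀ x ∈ S, act U A c (ket x) ∈ supported S

theorem Preserves.act_mem {S : Set (W → Bool)} {c : Circuit W K₁ K₂} (h : Preserves U A S c)
    {ψ : QState W} (hψ : ψ ∈ supported S) : act U A c ψ ∈ supported S :=
  map_mem_of_supported _ h hψ

theorem preserves_nil (S : Set (W → Bool)) : Preserves U A S ([] : Circuit W K₁ K₂) :=
  fun x hx => by rw [act_nil]; exact ket_mem_supported hx

theorem Preserves.append {S : Set (W → Bool)} {c d : Circuit W K₁ K₂} (hc : Preserves U A S c)
    (hd : Preserves U A S d) : Preserves U A S (c ++ d) := fun x hx => by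
  rw [act_append]
  exact hd.act_mem (hc x hx)

theorem preserves_flatMap {ι : Type} {S : Set (W → Bool)} (l : List ι)
    {c : ι → Circuit W K₁ K₂} (hc : ∀ i ∈ l, Preserves U A S (c i)) :
    Preserves U A S (l.flatMap c) := by
  induction l with
  | nil => exact preserves_nil S
  | cons i l ih =>
    rw [List.flatMap_cons]
    exact (hc i (by simp)).append (ih fun j hj => hc j (by simp [hj]))

theorem preserves_of_smul {S : Set (W → Bool)} {c : Circuit W K₁ K₂}
    (h : ∀ x ∈ S, ∃ μ : ℂ, act U A c (ket x) = μ • ket x) : Preserves U A S c := fun x hx => by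
  obtain ⟨μ, hμ⟩ := h x hx
  rw [hμ]
  exact (supported S).smul_mem _ (ket_mem_supported hx)

/-- A unitary is injective, and an injective linear map of a finite-dimensional space into itself is
onto; so the inverse maps `supported S` to itself as well. -/
theorem Preserves.inv (hU : U ∈ Matrix.unitaryGroup (K₁ → Bool) ℂ)
    (hA : A ∈ Matrix.unitaryGroup (K₂ → Bool) ℂ) {S : Set (W → Bool)} {c : Circuit W K₁ K₂}
    (hc : Preserves U A S c) : Preserves U A S c.inv := by
  have hinj : Function.Injective (act U A c) :=
    Function.LeftInverse.injective (act_inv_act hU hA c)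
  have hle : (supported S).map (act U A c) ≤ supported S := by
    rintro _ ⟨ψ, hψ, rfl⟩
    exact hc.act_mem hψ
  have heq : (supported S).map (act U A c) = supported S :=
    Submodule.eq_of_le_of_finrank_eq hle
      (LinearEquiv.finrank_eq (Submodule.equivMapOfInjective _ hinj _)).symm
  intro x hx
  have hx' := ket_mem_supported hx
  rw [← heq] at hx'
  obtain ⟨ψ, hψ, h⟩ := hx'
  rw [← h, act_inv_act hU hA]
  exact hψ

theorem act_diag {S : Set (W → Bool)} {c : Circuit W K₁ K₂} {μ : (W → Bool) → ℂ}
    (h : ∀ x ∈ S, act U A c (ket x) = μ x • ket x) {ψ : QState W} (hψ : ψ ∈ supported S) :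
    act U A c ψ = fun x => μ x * ψ x := by
  conv_lhs => rw [eq_sum_ket ψ]
  rw [map_sum]
  have : ∀ x, act U A c (ψ x • ket x) = (μ x * ψ x) • ket x := fun x => by
    rw [map_smul]
    by_cases hx : x ∈ S
    · rw [h x hx, smul_smul, mul_comm]
    · rw [hψ x hx, zero_smul, mul_zero, zero_smul]
  rw [Finset.sum_congr rfl fun x _ => this x]
  exact (eq_sum_ket fun x => μ x * ψ x).symm

/-! ### Squared norms -/

/-- The squared norm of a state. -/
def normSq (ψ : QState W) : ℝ := ∑ x, ‖ψ x‖ ^ 2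

theorem normSq_nonneg (ψ : QState W) : 0 ≤ normSq ψ :=
  Finset.sum_nonneg fun _ _ => by positivity

theorem star_dotProduct_self (ψ : QState W) : star ψ ⬝ᵥ ψ = (normSq ψ : ℂ) := by
  simp only [dotProduct, normSq, Pi.star_apply, Complex.ofReal_sum]
  refine Finset.sum_congr rfl fun x _ => ?_
  rw [Complex.star_def, mul_comm, Complex.mul_conj, Complex.normSq_eq_norm_sq]

theorem normSq_act (hU : U ∈ Matrix.unitaryGroup (K₁ → Bool) ℂ)
    (hA : A ∈ Matrix.unitaryGroup (K₂ → Bool) ℂ) (c : Circuit W K₁ K₂) (ψ : QState W) :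
    normSq (act U A c ψ) = normSq ψ := by
  have h := star_act_dotProduct_act hU hA c ψ ψ
  rw [star_dotProduct_self, star_dotProduct_self] at h
  exact_mod_cast h

theorem normSq_ket (x : W → Bool) : normSq (ket x) = 1 := by
  simp [normSq, ket_apply, apply_ite]

theorem normSq_smul (a : ℂ) (ψ : QState W) : normSq (a • ψ) = ‖a‖ ^ 2 * normSq ψ := by
  simp [normSq, mul_pow, Finset.mul_sum]

theorem star_dotProduct_indicator (S : Set (W → Bool)) (ψ : QState W) :
    star ψ ⬝ᵥ S.indicator ψ = (normSq (S.indicator ψ) : ℂ) := by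
  classical
  rw [← star_dotProduct_self]
  refine Finset.sum_congr rfl fun x _ => ?_
  by_cases hx : x ∈ S <;> simp [hx]

theorem normSq_indicator_compl (S : Set (W → Bool)) (ψ : QState W) :
    normSq (Sᶜ.indicator ψ) = normSq ψ - normSq (S.indicator ψ) := by
  classical
  rw [normSq, normSq, normSq, ← Finset.sum_sub_distrib]
  refine Finset.sum_congr rfl fun x _ => ?_
  by_cases hx : x ∈ S <;> simp [hx]

end Support

/-! ### Amplitude amplification -/

section Amplification

variable {W K₁ K₂ : Type} [Fintype W] [DecidableEq W] [Fintype K₁] [DecidableEq K₁] [Fintype K₂]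
  [DecidableEq K₂] {U : QOp K₁} {A : QOp K₂}

theorem star_ket_dotProduct (b : W → Bool) (ψ : QState W) : star (ket b) ⬝ᵥ ψ = ψ b := by
  simp [dotProduct, ket_apply, apply_ite]

/-- Conjugating a phase on `ket b` by `c` gives a phase on the image of `ket b`. -/
theorem act_reflection (hU : U ∈ Matrix.unitaryGroup (K₁ → Bool) ℂ)
    (hA : A ∈ Matrix.unitaryGroup (K₂ → Bool) ℂ) {S : Set (W → Bool)} {c R : Circuit W K₁ K₂}
    {b : W → Bool} {μ : ℂ} (hc : Preserves U A S c)
    (hR : ∀ x ∈ S, act U A R (ket x) = (if x = b then μ else 1) • ket x) {ψ : QState W}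
    (hψ : ψ ∈ supported S) :
    act U A (c.inv ++ R ++ c) ψ =
      ψ + ((μ - 1) * (star (act U A c (ket b)) ⬝ᵥ ψ)) • act U A c (ket b) := by
  -- `R` is known only on `S`, so the state must still be supported there after the inverse of `c`.
  rw [act_append, act_append, act_diag hR ((hc.inv hU hA).act_mem hψ), star_act_dotProduct,
    star_ket_dotProduct]
  set φ := act U A c.inv ψ with hφ
  have : (fun x => (if x = b then μ else 1) * φ x) = φ + ((μ - 1) * φ b) • ket b := by
    funext x
    by_cases hx : x = b <;> simp [hx, ket_apply]
    ring
  rw [this, map_add, map_smul, hφ, act_act_inv hU hA]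

/-- A circuit repeated `r` times. -/
def rep (c : Circuit W K₁ K₂) : ℕ → Circuit W K₁ K₂
  | 0 => []
  | r + 1 => rep c r ++ c

theorem Preserves.rep {S : Set (W → Bool)} {c : Circuit W K₁ K₂} (hc : Preserves U A S c) (r : ℕ) :
    Preserves U A S (rep c r) := by
  induction r with
  | zero => exact preserves_nil S
  | succ r ih => exact ih.append hc

/-- Repeated reflections about the good part and about the state prepared by `V`: the amplitude of
the bad part changes as in Grover's algorithm. -/
theorem act_rep_grover (hU : U ∈ Matrix.unitaryGroup (K₁ → Bool) ℂ)
    (hA : A ∈ Matrix.unitaryGroup (K₂ → Bool) ℂ) {S Bad : Set (W → Bool)}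
    {V Z R : Circuit W K₁ K₂} {b : W → Bool} (hb : b ∈ S) (hV : Preserves U A S V)
    (hR : ∀ x ∈ S, act U A R (ket x) = (if x = b then -1 else 1 : ℂ) • ket x)
    (hZ : ∀ x ∈ S ∩ Bad, act U A Z (ket x) = (-1 : ℂ) • ket x)
    (hZ' : ∀ x ∈ S ∩ Badᶜ, act U A Z (ket x) = (1 : ℂ) • ket x)
    {θ : ℝ} (hθ : Real.cos θ ^ 2 = normSq (Bad.indicator (act U A V (ket b)))) (r : ℕ) :
    ∃ y : ℂ, act U A (rep (Z ++ (V.inv ++ R ++ V)) r) (Bad.indicator (act U A V (ket b))) =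
      (Real.cos (2 * r * θ) : ℂ) • Bad.indicator (act U A V (ket b)) +
        y • Badᶜ.indicator (act U A V (ket b)) := by
  set Φ := act U A V (ket b) with hΦ
  set B := Bad.indicator Φ with hB
  set G := Badᶜ.indicator Φ with hG
  have hΦS : Φ ∈ supported S := hV b hb
  have hBS : B ∈ supported (S ∩ Bad) := indicator_mem_supported _ hΦS
  have hGS : G ∈ supported (S ∩ Badᶜ) := indicator_mem_supported _ hΦS
  have hBG : Φ = B + G := (Set.indicator_self_add_compl Bad Φ).symm
  have hnorm : normSq G = Real.sin θ ^ 2 := by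
    rw [hG, normSq_indicator_compl, hΦ, normSq_act hU hA, normSq_ket, ← hΦ, ← hB, ← hθ,
      Real.sin_sq]
  have hΦB : star Φ ⬝ᵥ B = (Real.cos θ ^ 2 : ℂ) := by
    rw [hB, star_dotProduct_indicator, ← hB, ← hθ, Complex.ofReal_pow]
  have hΦG : star Φ ⬝ᵥ G = (Real.sin θ ^ 2 : ℂ) := by
    rw [hG, star_dotProduct_indicator, ← hG, hnorm, Complex.ofReal_pow]
  have hs : (Real.sin θ : ℂ) ^ 2 + (Real.cos θ : ℂ) ^ 2 = 1 := by
    exact_mod_cast Real.sin_sq_add_cos_sq θ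
  -- In the plane of `B` and `G` the step is the rotation by 2θ. The vectors are left unnormalised
  -- (norms cos θ and |sin θ|), so that either may vanish.
  have hQB : act U A (Z ++ (V.inv ++ R ++ V)) B =
      (Real.cos (2 * θ) : ℂ) • B + (2 * (Real.cos θ : ℂ) ^ 2) • G := by
    have hZB : act U A Z B = (-1 : ℂ) • B := by
      rw [act_diag (μ := fun _ => -1) hZ hBS]; rfl
    rw [act_append, hZB, map_smul,
      act_reflection hU hA hV hR (supported_mono Set.inter_subset_left hBS), ← hΦ, hΦB, hBG]
    rw [Real.cos_two_mul]
    push_cast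
    module
  have hQG : act U A (Z ++ (V.inv ++ R ++ V)) G =
      (-2 * (Real.sin θ : ℂ) ^ 2) • B + (Real.cos (2 * θ) : ℂ) • G := by
    have hZG : act U A Z G = (1 : ℂ) • G := by
      rw [act_diag (μ := fun _ => 1) hZ' hGS]
      funext x
      simp
    rw [act_append, hZG, map_smul,
      act_reflection hU hA hV hR (supported_mono Set.inter_subset_left hGS), ← hΦ, hΦG, hBG,
      Real.cos_two_mul]
    have : (2 * (Real.cos θ : ℂ) ^ 2 - 1) = 1 - 2 * (Real.sin θ : ℂ) ^ 2 := by
      linear_combination 2 * hs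
    push_cast at this ⊢
    rw [this]
    module
  -- The coefficient would be cot θ · sin(2rθ). The relation is multiplied by sin θ so that it also
  -- covers sin θ = 0, that is `G = 0`.
  suffices h : ∃ y : ℂ, act U A (rep (Z ++ (V.inv ++ R ++ V)) r) B =
      (Real.cos (2 * r * θ) : ℂ) • B + y • G ∧
        (Real.sin θ : ℂ) * y = Real.cos θ * Real.sin (2 * r * θ) by
    obtain ⟨y, hy, -⟩ := h
    exact ⟨y, hy⟩
  induction r with
  | zero => exact ⟨0, by simp [rep]⟩
  | succ r ih =>
    obtain ⟨y, hy, hsy⟩ := ih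
    refine ⟨2 * (Real.cos θ : ℂ) ^ 2 * Real.cos (2 * r * θ) + Real.cos (2 * θ) * y, ?_, ?_⟩
    · rw [rep, act_append, hy, map_add, map_smul, map_smul, hQB, hQG]
      have : (Real.cos (2 * ((r + 1 : ℕ) : ℝ) * θ) : ℂ) =
          Real.cos (2 * r * θ) * Real.cos (2 * θ) - 2 * Real.sin θ ^ 2 * y := by
        have h1 : 2 * ((r + 1 : ℕ) : ℝ) * θ = 2 * r * θ + 2 * θ := by push_cast; ring
        rw [h1, Real.cos_add, Real.sin_two_mul]
        push_cast at hsy ⊢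
        linear_combination (2 * Complex.sin θ) * hsy
      rw [this]
      module
    · have h1 : 2 * ((r + 1 : ℕ) : ℝ) * θ = 2 * r * θ + 2 * θ := by push_cast; ring
      rw [h1, Real.sin_add, Real.sin_two_mul]
      push_cast at hsy ⊢
      linear_combination Complex.cos (2 * θ) * hsy

/-- One round of a search: `r` Grover steps starting from the bad part, after which the good part
is moved to `T'`. -/
theorem act_round {S T T' Bad : Set (W → Bool)} {Q F : Circuit W K₁ K₂} {B G ρ : QState W}
    {r : ℕ} {a y κ : ℂ} (hB : B ∈ supported (S ∩ Bad)) (hG : G ∈ supported (S ∩ Badᶜ))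
    (hQ : Preserves U A T Q) (hQB : act U A (rep Q r) B = a • B + y • G)
    (hF : ∀ x ∈ S ∩ Bad, act U A F (ket x) = (1 : ℂ) • ket x)
    (hF' : ∀ x ∈ S ∩ Badᶜ, act U A F (ket x) ∈ supported T')
    (hFT : ∀ x ∈ T, act U A F (ket x) ∈ supported T') (hρ : ρ ∈ supported T) :
    ∃ ρ' ∈ supported T', act U A (rep Q r ++ F) (κ • B + ρ) = (κ * a) • B + ρ' := by
  have hFB : act U A F B = B := by
    rw [act_diag (μ := fun _ => 1) hF hB]
    funext x
    simp
  -- The newly flagged good part joins the evolved old remainder; of the latter nothing is needed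
  -- except its support.
  refine ⟨(κ * y) • act U A F G + act U A F (act U A (rep Q r) ρ), ?_, ?_⟩
  · exact (supported T').add_mem ((supported T').smul_mem _ (map_mem_of_supported _ hF' hG))
      (map_mem_of_supported _ hFT ((hQ.rep r).act_mem hρ))
  · rw [act_append, map_add, map_smul, hQB, map_add, map_smul, map_add, map_smul, map_smul, hFB]
    module

/-- One step of fixed-point amplitude amplification cubes the probability of the bad part. -/
theorem normSq_indicator_fixedPoint (hU : U ∈ Matrix.unitaryGroup (K₁ → Bool) ℂ)
    (hA : A ∈ Matrix.unitaryGroup (K₂ → Bool) ℂ) {S Bad : Set (W → Bool)}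
    {V Z R : Circuit W K₁ K₂} {b : W → Bool} (hb : b ∈ S) (hV : Preserves U A S V)
    (hR : ∀ x ∈ S, act U A R (ket x) =
      (if x = b then Complex.exp ((Real.pi / 3 : ℝ) * Complex.I) else 1 : ℂ) • ket x)
    (hZ : ∀ x ∈ S ∩ Bad, act U A Z (ket x) =
      Complex.exp ((-(Real.pi / 3) : ℝ) * Complex.I) • ket x)
    (hZ' : ∀ x ∈ S ∩ Badᶜ, act U A Z (ket x) = (1 : ℂ) • ket x) :
    normSq (Bad.indicator (act U A (V ++ Z ++ (V.inv ++ R ++ V)) (ket b))) =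
      normSq (Bad.indicator (act U A V (ket b))) ^ 3 := by
  set Φ := act U A V (ket b) with hΦ
  set B := Bad.indicator Φ with hB
  set G := Badᶜ.indicator Φ with hG
  have hΦS : Φ ∈ supported S := hV b hb
  have hBS : B ∈ supported (S ∩ Bad) := indicator_mem_supported _ hΦS
  have hGS : G ∈ supported (S ∩ Badᶜ) := indicator_mem_supported _ hΦS
  have hBG : Φ = B + G := (Set.indicator_self_add_compl Bad Φ).symm
  set ω := Complex.exp ((Real.pi / 3 : ℝ) * Complex.I) with hω
  set ω' := Complex.exp ((-(Real.pi / 3) : ℝ) * Complex.I) with hω'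
  -- This relation and `ω + ω' = 1` are all that is used about the two phases; the second is the
  -- reason for the angle π/3.
  have h1 : ω * ω' = 1 := by
    rw [hω, hω', ← Complex.exp_add]
    simp
  have h2 : ω + ω' = 1 := by
    have h : Complex.cos ((Real.pi / 3 : ℝ) : ℂ) = 1 / 2 := by
      rw [← Complex.ofReal_cos, Real.cos_pi_div_three]
      norm_num
    rw [Complex.cos] at h
    rw [hω, hω']
    push_cast at h ⊢
    linear_combination 2 * h
  set e := normSq B with he
  have hΦB : star Φ ⬝ᵥ B = (e : ℂ) := by
    rw [hB, star_dotProduct_indicator]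
  have hΦG : star Φ ⬝ᵥ G = 1 - (e : ℂ) := by
    rw [hG, star_dotProduct_indicator, normSq_indicator_compl, hΦ, normSq_act hU hA, normSq_ket,
      ← hΦ, ← hB, ← he]
    push_cast
    rfl
  have hZB : act U A Z B = ω' • B := by
    rw [act_diag (μ := fun _ => ω') hZ hBS]; rfl
  have hZG : act U A Z G = G := by
    rw [act_diag (μ := fun _ => 1) hZ' hGS]
    funext x
    simp
  have hmem : ω' • B + G ∈ supported S :=
    (supported S).add_mem
      ((supported S).smul_mem _ (supported_mono Set.inter_subset_left hBS))
      (supported_mono Set.inter_subset_left hGS)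
  have hfin : act U A (V ++ Z ++ (V.inv ++ R ++ V)) (ket b) =
      (e : ℂ) • B + (1 + (ω - 1) * (ω' * e + (1 - e))) • G := by
    rw [act_append (V ++ Z), act_append V, ← hΦ]
    conv_lhs => rw [hBG]
    rw [map_add, hZB, hZG, act_reflection hU hA hV hR hmem, ← hΦ, dotProduct_add, dotProduct_smul,
      hΦB, hΦG, smul_eq_mul, hBG]
    -- The coefficient of the bad part collapses to its own probability `e`. The new probability is
    -- therefore e² · e.
    have : (e : ℂ) = ω' + (ω - 1) * (ω' * e + (1 - e)) := by
      linear_combination ((e : ℂ) - 1) * h2 - (e : ℂ) * h1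
    rw [congrArg (fun a : ℂ => a • B) this]
    module
  have hind : ∀ a : ℂ, Bad.indicator ((e : ℂ) • B + a • G) = (e : ℂ) • B := fun a => by
    funext x
    by_cases hx : x ∈ Bad <;> simp [hB, hG, hx]
  rw [hfin, hind, normSq_smul, ← he, Complex.norm_real, Real.norm_eq_abs, sq_abs]
  ring

end Amplification

/-! ### Circuits made of commuting pieces -/

section Lists

variable {W K₁ K₂ : Type} [Fintype W] [DecidableEq W] [Fintype K₁] [DecidableEq K₁] [Fintype K₂]
  [DecidableEq K₂] {U : QOp K₁} {A : QOp K₂}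

/-- Injectivity of the targets is asked only for pieces that really flip. In `rowLoad` several
pieces share a target, but only those of the current one-hot index act. The invariant `C` keeps the
controls fixed between pieces. -/
theorem act_flatMap_flips {ι : Type} (c : ι → Circuit W K₁ K₂) (C : (W → Bool) → Prop)
    (f : ι → Prop) (t : ι → W)
    (hc : ∀ i x, C x → f i → act U A (c i) (ket x) = ket (Function.update x (t i) (!x (t i))))
    (hc' : ∀ i x, C x → ¬ f i → act U A (c i) (ket x) = ket x)
    (hC : ∀ i x, C x → C (Function.update x (t i) (!x (t i))))
    (ht : ∀ i j, f i → f j → t i = t j → i = j) (l : List ι) (hl : l.Nodup) (x : W → Bool)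
    (hx : C x) :
    ∃ y, act U A (l.flatMap c) (ket x) = ket y ∧ (∀ i ∈ l, f i → y (t i) = !x (t i)) ∧
      ∀ w, (∀ i ∈ l, f i → t i ≠ w) → y w = x w := by
  induction l generalizing x with
  | nil => exact ⟨x, by simp⟩
  | cons i l ih =>
    rw [List.nodup_cons] at hl
    by_cases hi : f i
    · obtain ⟨y, hy, h1, h2⟩ := ih hl.2 _ (hC i x hx)
      refine ⟨y, ?_, ?_, ?_⟩
      · rw [List.flatMap_cons, act_append, hc i x hx hi, hy]
      · intro j hj hfj
        rcases List.mem_cons.1 hj with rfl | hj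
        · rw [h2, Function.update_self]
          intro k hk hfk h
          exact hl.1 (ht k j hfk hfj h ▸ hk)
        · rw [h1 j hj hfj, Function.update_of_ne]
          intro h
          exact hl.1 (ht j i hfj hi h ▸ hj)
      · intro w hw
        rw [h2 w fun j hj => hw j (by simp [hj]), Function.update_of_ne]
        exact (hw i (by simp) hi).symm
    · obtain ⟨y, hy, h1, h2⟩ := ih hl.2 x hx
      refine ⟨y, ?_, ?_, ?_⟩
      · rw [List.flatMap_cons, act_append, hc' i x hx hi, hy]
      · intro j hj hfj
        rcases List.mem_cons.1 hj with rfl | hj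
        · exact absurd hfj hi
        · exact h1 j hj hfj
      · intro w hw
        exact h2 w fun j hj => hw j (by simp [hj])

theorem act_forAll_flips {ι : Type} [Fintype ι] (c : ι → Circuit W K₁ K₂) (C : (W → Bool) → Prop)
    (f : ι → Prop) (t : ι → W)
    (hc : ∀ i x, C x → f i → act U A (c i) (ket x) = ket (Function.update x (t i) (!x (t i))))
    (hc' : ∀ i x, C x → ¬ f i → act U A (c i) (ket x) = ket x)
    (hC : ∀ i x, C x → C (Function.update x (t i) (!x (t i))))
    (ht : ∀ i j, f i → f j → t i = t j → i = j) (x : W → Bool) (hx : C x) :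
    ∃ y, act U A (forAll c) (ket x) = ket y ∧ (∀ i, f i → y (t i) = !x (t i)) ∧
      ∀ w, (∀ i, f i → t i ≠ w) → y w = x w := by
  simpa [forAll] using act_flatMap_flips c C f t hc hc' hC ht _ (Finset.nodup_toList Finset.univ) x hx

theorem act_forAll_smul {ι : Type} [Fintype ι] {c : ι → Circuit W K₁ K₂} {ψ : QState W}
    {μ : ι → ℂ} (h : ∀ i, act U A (c i) ψ = μ i • ψ) :
    act U A (forAll c) ψ = (∏ i, μ i) • ψ := by
  rw [← Finset.prod_map_toList, forAll]
  induction (Finset.univ : Finset ι).toList with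
  | nil => simp
  | cons i l ih => rw [List.flatMap_cons, act_append, h, map_smul, ih, smul_smul, List.map_cons,
      List.prod_cons]

end Lists

/-! ### The registers of the verification circuit -/

/-- The ancillas: a one-hot index, a row index, a column index, the target of the oracle, the
argument of the phases, the flags, qubits for computing conjunctions, and the final flag. -/
abbrev Anc (n p m : ℕ) : Type :=
  Fin n ⊕ IdxReg n ⊕ IdxReg n ⊕ FieldReg p ⊕ FieldReg p ⊕ Fin (m + 1) ⊕
    Fin (Nat.clog 2 p + m + 3) ⊕ Unit

/-- The qubits of the verification circuit: input, claimed output, and ancillas. -/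
abbrev SubReg (n p m : ℕ) : Type := VecReg n p ⊕ (VecReg n p ⊕ Anc n p m)

section Layout

variable {n p m : ℕ}

/-- The input qubits. -/
abbrev vIn (q : VecReg n p) : SubReg n p m := .inl q
/-- The qubits of the claimed output. -/
abbrev vOut (q : VecReg n p) : SubReg n p m := .inr (.inl q)
/-- The one-hot index qubits. -/
abbrev hot (j : Fin n) : SubReg n p m := .inr (.inr (.inl j))
/-- The row index qubits. -/
abbrev row (b : IdxReg n) : SubReg n p m := .inr (.inr (.inr (.inl b)))
/-- The column index qubits. -/
abbrev col (b : IdxReg n) : SubReg n p m := .inr (.inr (.inr (.inr (.inl b))))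
/-- The oracle target qubits. -/
abbrev tgt (b : FieldReg p) : SubReg n p m := .inr (.inr (.inr (.inr (.inr (.inl b)))))
/-- The phase argument qubits. -/
abbrev arg (b : FieldReg p) : SubReg n p m := .inr (.inr (.inr (.inr (.inr (.inr (.inl b))))))
/-- The flag qubits. -/
abbrev flg (i : Fin (m + 1)) : SubReg n p m :=
  .inr (.inr (.inr (.inr (.inr (.inr (.inr (.inl i)))))))
/-- The conjunction qubits. -/
abbrev chn (i : Fin (Nat.clog 2 p + m + 3)) : SubReg n p m :=
  .inr (.inr (.inr (.inr (.inr (.inr (.inr (.inr (.inl i))))))))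
/-- The final flag. -/
abbrev fin : SubReg n p m := .inr (.inr (.inr (.inr (.inr (.inr (.inr (.inr (.inr ()))))))))

/-- The conjunction qubits as a sequence. -/
def chain (i : ℕ) : SubReg n p m := chn (Fin.ofNat _ i)

theorem chain_injOn {k : ℕ} (hk : k ≤ Nat.clog 2 p + m + 2) :
    Set.InjOn (chain : ℕ → SubReg n p m) (Set.Iic k) := by
  intro i hi j hj h
  simp only [Set.mem_Iic] at hi hj
  simp only [chain, Sum.inr.injEq, Sum.inl.injEq, Fin.ext_iff, Fin.val_ofNat] at h
  rwa [Nat.mod_eq_of_lt (by omega), Nat.mod_eq_of_lt (by omega)] at h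

/-- The argument qubits as a list. -/
def args : List (SubReg n p m) := (List.finRange (Nat.clog 2 p)).map arg

/-- The flag qubits as a list. -/
def flags : List (SubReg n p m) := (List.finRange (m + 1)).map flg

theorem length_args : (args : List (SubReg n p m)).length = Nat.clog 2 p := by simp [args]

theorem length_flags : (flags : List (SubReg n p m)).length = m + 1 := by simp [flags]

theorem forall_mem_args {P : SubReg n p m → Prop} : (∀ w ∈ args, P w) ↔ ∀ b, P (arg b) := by
  simp [args]

theorem forall_mem_flags {P : SubReg n p m → Prop} : (∀ w ∈ flags, P w) ↔ ∀ i, P (flg i) := by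
  simp [flags]

/-- The bit string `x` holds the vectors `v` and `z` and the one-hot index `j`; only the argument
and the flag qubits of the other ancillas may be nonzero. -/
structure IsClean (v z : Fin n → ZMod p) (j : Fin n) (x : SubReg n p m → Bool) : Prop where
  vIn : ∀ q, x (vIn q) = encVec v q
  vOut : ∀ q, x (vOut q) = encVec z q
  hot : ∀ i, x (hot i) = decide (i = j)
  row : ∀ b, x (row b) = false
  col : ∀ b, x (col b) = false
  tgt : ∀ b, x (tgt b) = false
  chn : ∀ i, x (chn i) = false
  fin : x fin = false

theorem IsClean.chain {v z : Fin n → ZMod p} {j : Fin n} {x : SubReg n p m → Bool}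
    (h : IsClean v z j x) (i : ℕ) : x (chain i) = false := h.chn _

theorem IsClean.update_arg {v z : Fin n → ZMod p} {j : Fin n} {x : SubReg n p m → Bool}
    (h : IsClean v z j x) (b : FieldReg p) (c : Bool) :
    IsClean v z j (Function.update x (arg b) c) := by
  constructor <;> intros <;>
    simp [h.vIn, h.vOut, h.hot, h.row, h.col, h.tgt, h.chn, h.fin]

theorem IsClean.update_flg {v z : Fin n → ZMod p} {j : Fin n} {x : SubReg n p m → Bool}
    (h : IsClean v z j x) (b : Fin (m + 1)) (c : Bool) :
    IsClean v z j (Function.update x (flg b) c) := by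
  constructor <;> intros <;>
    simp [h.vIn, h.vOut, h.hot, h.row, h.col, h.tgt, h.chn, h.fin]

/-- The bit string with given vectors, one-hot index, argument and flags. -/
def cfg (v z : Fin n → ZMod p) (j : Fin n) (a : FieldReg p → Bool) (fl : Fin (m + 1) → Bool) :
    SubReg n p m → Bool :=
  Sum.elim (encVec v) (Sum.elim (encVec z) (Sum.elim (fun i => decide (i = j))
    (Sum.elim zeros (Sum.elim zeros (Sum.elim zeros (Sum.elim a (Sum.elim fl
      (Sum.elim zeros zeros))))))))

theorem isClean_cfg (v z : Fin n → ZMod p) (j : Fin n) (a : FieldReg p → Bool)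
    (fl : Fin (m + 1) → Bool) : IsClean v z j (cfg v z j a fl) := by
  constructor <;> intros <;> rfl

theorem IsClean.eq_cfg {v z : Fin n → ZMod p} {j : Fin n} {x : SubReg n p m → Bool}
    (h : IsClean v z j x) : x = cfg v z j (fun b => x (arg b)) (fun i => x (flg i)) := by
  funext w
  rcases w with q | q | i | b | b | b | b | i | i | ⟨⟩
  exacts [h.vIn q, h.vOut q, h.hot i, h.row b, h.col b, h.tgt b, rfl, rfl, h.chn i, h.fin]

theorem cfg_injective_index {v z : Fin n → ZMod p} {j j' : Fin n} {a a' : FieldReg p → Bool}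
    {fl fl' : Fin (m + 1) → Bool} (h : cfg v z j a fl = cfg v z j' a' fl') : j = j' := by
  have := congrFun h (MvVerify.hot j)
  simpa [cfg] using this

end Layout

/-! ### Binary expansions -/

theorem sum_testBit (L k : ℕ) (hk : k < 2 ^ L) :
    ∑ b : Fin L, (if Nat.testBit k b then 2 ^ (b : ℕ) else 0) = k := by
  induction L generalizing k with
  | zero => simp at hk ⊢; omega
  | succ L ih =>
    have h := ih (k / 2) (by rw [pow_succ] at hk; omega)
    rw [Fin.sum_univ_succ]
    have h2 : ∀ b : Fin L, (if Nat.testBit k (b.succ : Fin (L + 1)) then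
        2 ^ ((b.succ : Fin (L + 1)) : ℕ) else 0) =
        2 * if Nat.testBit (k / 2) b then 2 ^ (b : ℕ) else 0 := fun b => by
      rw [Fin.val_succ, Nat.testBit_succ, pow_succ]
      split_ifs <;> ring
    rw [Finset.sum_congr rfl fun b _ => h2 b, ← Finset.mul_sum, h]
    rcases Nat.mod_two_eq_zero_or_one k with h0 | h0 <;> simp [Nat.testBit_zero, h0] <;> omega

/-- The number with given binary digits. -/
def bitVal {L : ℕ} (x : Fin L → Bool) : ℝ := ∑ b, if x b then 2 ^ (b : ℕ) else 0

theorem bitVal_encField {p : ℕ} [NeZero p] (t : ZMod p) : bitVal (encField t) = (t.val : ℝ) := by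
  have h := sum_testBit (Nat.clog 2 p) t.val
    ((ZMod.val_lt t).trans_le (Nat.le_pow_clog one_lt_two p))
  rw [← h, bitVal]
  push_cast
  rfl

theorem encField_injective {p : ℕ} [NeZero p] :
    Function.Injective (encField : ZMod p → FieldReg p → Bool) := fun s t h => by
  have h' := bitVal_encField s
  rw [h, bitVal_encField] at h'
  exact ZMod.val_injective p (by exact_mod_cast h'.symm)

theorem encVec_injective {n p : ℕ} [NeZero p] :
    Function.Injective (encVec : (Fin n → ZMod p) → VecReg n p → Bool) := fun v w h => by
  funext i
  exact encField_injective (funext fun b => congrFun h (i, b))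

theorem encField_zero {p : ℕ} : encField (0 : ZMod p) = zeros := by
  funext b
  simp [encField, zeros]

theorem prod_ite_exp {ι : Type} [Fintype ι] (P : ι → Prop) [DecidablePred P] (θ : ι → ℝ) :
    (∏ i, if P i then Complex.exp (θ i * Complex.I) else 1) =
      Complex.exp ((∑ i, if P i then θ i else 0 : ℝ) * Complex.I) := by
  rw [Complex.ofReal_sum, Finset.sum_mul, Complex.exp_sum]
  refine Finset.prod_congr rfl fun i _ => ?_
  split_ifs <;> simp

/-- Multiplying out three binary expansions leaves one weighted phase per triple of bits. Hence
doubly controlled phases suffice, and no arithmetic circuit modulo p is needed. -/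
theorem sum_triple {L : ℕ} (x y z : Fin L → Bool) (c : ℝ) :
    (∑ q : Fin L × Fin L × Fin L, if (x q.1 && y q.2.1 && z q.2.2) = true then
      c * 2 ^ (q.1 + q.2.1 + q.2.2 : ℕ) else 0) = c * (bitVal x * bitVal y * bitVal z) := by
  rw [mul_assoc, bitVal, bitVal, bitVal, Finset.sum_mul_sum, Finset.sum_mul_sum]
  simp only [Finset.mul_sum, Fintype.sum_prod_type]
  refine Finset.sum_congr rfl fun i _ => Finset.sum_congr rfl fun j _ =>
    Finset.sum_congr rfl fun k _ => ?_
  cases x i <;> cases y j <;> cases z k <;> simp [pow_add, mul_assoc]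

theorem sum_pair {L : ℕ} (x y : Fin L → Bool) (c : ℝ) :
    (∑ q : Fin L × Fin L, if (x q.1 && y q.2) = true then c * 2 ^ (q.1 + q.2 : ℕ) else 0) =
      c * (bitVal x * bitVal y) := by
  rw [bitVal, bitVal, Finset.sum_mul_sum]
  simp only [Finset.mul_sum, Fintype.sum_prod_type]
  refine Finset.sum_congr rfl fun i _ => Finset.sum_congr rfl fun j _ => ?_
  cases x i <;> cases y j <;> simp [pow_add]

/-! ### The phase of a row -/

section Rows

variable {n p m : ℕ} {K : Type} [Fintype K] [DecidableEq K]

/-- Copies the one-hot index, in binary, to the row register. -/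
def rowLoad : Circuit (SubReg n p m) (OracleReg n p) K :=
  forAll fun q : Fin n × IdxReg n =>
    if Nat.testBit q.1 q.2 then cx (hot q.1) (row q.2) else []

/-- Writes `k` to the column register. -/
def colLoad (k : Fin n) : Circuit (SubReg n p m) (OracleReg n p) K :=
  forAll fun b : IdxReg n => if Nat.testBit k b then xGate (col b) else []

/-- The qubits to which the oracle is applied. -/
def oracleWires : OracleReg n p ↪ SubReg n p m :=
  ⟨Sum.elim row (Sum.elim col tgt), by
    rintro (a | a | a) (b | b | b) h <;> simp_all⟩

/-- Loads the entry of the matrix in column `k`. -/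
def entryLoad (k : Fin n) : Circuit (SubReg n p m) (OracleReg n p) K :=
  colLoad k ++ [.query false oracleWires]

/-- The phases that multiply the loaded entry with `v k`. -/
def entryPhases (k : Fin n) : Circuit (SubReg n p m) (OracleReg n p) K :=
  forAll fun q : FieldReg p × FieldReg p × FieldReg p =>
    ccp (2 * Real.pi / p * 2 ^ (q.1 + q.2.1 + q.2.2 : ℕ)) (arg q.1) (tgt q.2.1) (vIn (k, q.2.2))

/-- The phases that subtract the claimed output. -/
def outPhases : Circuit (SubReg n p m) (OracleReg n p) K :=
  forAll fun i : Fin n => forAll fun q : FieldReg p × FieldReg p =>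
    ccp (-(2 * Real.pi / p) * 2 ^ (q.1 + q.2 : ℕ)) (hot i) (arg q.1) (vOut (i, q.2))

/-- Multiplies by the phase `exp(2πi a u / p)`, where `a` is the content of the argument register
and `u` is the error of the claimed output in the row given by the one-hot index. -/
def rowPhase : Circuit (SubReg n p m) (OracleReg n p) K :=
  Circuit.conj rowLoad (forAll fun k => Circuit.conj (entryLoad k) (entryPhases k)) ++ outPhases

/-- The error of the claimed output `z` in row `j`, as an integer. -/
def rowError (M : Matrix (Fin n) (Fin n) (ZMod p)) (v z : Fin n → ZMod p) (j : Fin n) : ℤ :=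
  (∑ k, ((M j k).val : ℤ) * (v k).val) - (z j).val

variable {M : Matrix (Fin n) (Fin n) (ZMod p)} {U : QOp (OracleReg n p)} {A : QOp K}

theorem tensor_ket {R T : Type} [Fintype R] [DecidableEq R] [Fintype T] [DecidableEq T]
    (x : R → Bool) (y : T → Bool) : tensor (ket x) (ket y) = ket (Sum.elim x y) := by
  funext w
  rw [tensor, ket_apply, ket_apply, ket_apply, ite_mul, one_mul, zero_mul, ← ite_and]
  refine if_congr ⟨fun h => ?_, fun h => ?_⟩ rfl rfl
  · rw [← h.1, ← h.2, Sum.elim_comp_inl_inr]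
  · rw [h, Sum.elim_comp_inl, Sum.elim_comp_inr]
    exact ⟨rfl, rfl⟩

theorem act_rowLoad {j : Fin n} {x : SubReg n p m → Bool}
    (hx : ∀ i, x (hot i) = decide (i = j)) (hr : ∀ b, x (row b) = false) :
    ∃ y, act U A (rowLoad : Circuit _ _ K) (ket x) = ket y ∧ (∀ b, y (row b) = encIdx j b) ∧
      ∀ w, (∀ b, row b ≠ w) → y w = x w := by
  obtain ⟨y, hy, h1, h2⟩ := act_forAll_flips (U := U) (A := A)
    (fun q : Fin n × IdxReg n => if Nat.testBit q.1 q.2 then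
      (cx (hot q.1) (row q.2) : Circuit (SubReg n p m) (OracleReg n p) K) else [])
    (fun x => ∀ i, x (hot i) = decide (i = j)) (fun q => q.1 = j ∧ Nat.testBit q.1 q.2 = true)
    (fun q => row q.2) (by
      rintro ⟨i, b⟩ x hx ⟨rfl, hb⟩
      dsimp only at hb ⊢
      rw [if_pos hb, act_cx (by simp), hx]
      simp)
    (by
      rintro ⟨i, b⟩ x hx hi
      dsimp only at hi ⊢
      split_ifs with hb
      · rw [act_cx (by simp), hx]
        have : i ≠ j := fun h => hi ⟨h, hb⟩
        simp [this]
      · rw [act_nil])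
    (by
      intro q x hx i
      rw [Function.update_of_ne (by simp), hx])
    (by
      rintro ⟨i, b⟩ ⟨i', b'⟩ ⟨rfl, -⟩ ⟨h, -⟩ hb
      simp_all)
    x hx
  refine ⟨y, hy, fun b => ?_, fun w hw => h2 w fun q _ => hw q.2⟩
  cases hb : encIdx j b
  · rw [h2, hr]
    rintro ⟨i, b'⟩ ⟨rfl, hb'⟩ h
    dsimp only at hb' h
    simp only [Sum.inr.injEq, Sum.inl.injEq] at h
    rw [encIdx, ← h, hb'] at hb
    cases hb
  · rw [h1 (j, b) ⟨rfl, hb⟩, hr]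
    rfl

theorem act_colLoad (k : Fin n) {x : SubReg n p m → Bool} (hr : ∀ b, x (col b) = false) :
    ∃ y, act U A (colLoad k : Circuit _ _ K) (ket x) = ket y ∧ (∀ b, y (col b) = encIdx k b) ∧
      ∀ w, (∀ b, col b ≠ w) → y w = x w := by
  obtain ⟨y, hy, h1, h2⟩ := act_forAll_flips (U := U) (A := A)
    (fun b : IdxReg n => if Nat.testBit k b then
      (xGate (col b) : Circuit (SubReg n p m) (OracleReg n p) K) else [])
    (fun _ => True) (fun b => Nat.testBit k b = true) col
    (by
      intro b x _ hb
      rw [if_pos hb, act_xGate])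
    (by
      intro b x _ hb
      rw [if_neg hb, act_nil])
    (fun _ _ _ => trivial) (by
      intro b b' _ _ h
      simpa using h) x trivial
  refine ⟨y, hy, fun b => ?_, fun w hw => h2 w fun q _ => hw q⟩
  cases hb : encIdx k b
  · rw [h2, hr]
    intro b' hb' h
    simp only [Sum.inr.injEq, Sum.inl.injEq] at h
    rw [encIdx, ← h, hb'] at hb
    cases hb
  · rw [h1 b hb, hr]
    rfl

/-- With the target initially zero the oracle writes `M j k` itself, and a basis state goes to a
basis state. Only valid encodings occur, so the unspecified part of the oracle is irrelevant. -/
theorem act_query (hM : IsMatrixOracle M U) {j k : Fin n} {x : SubReg n p m → Bool}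
    (hr : ∀ b, x (row b) = encIdx j b) (hc : ∀ b, x (col b) = encIdx k b)
    (ht : ∀ b, x (tgt b) = false) :
    ∃ y, act U A [(Instr.query false oracleWires : Instr _ _ K)] (ket x) = ket y ∧
      (∀ b, y (tgt b) = encField (M j k) b) ∧ ∀ w, (∀ b, tgt b ≠ w) → y w = x w := by
  have h := hM.2 j k 0
  rw [zero_add] at h
  simp only [oracleKet, tensor_ket] at h
  have hx : x ∘ (oracleWires : OracleReg n p ↪ SubReg n p m) =
      Sum.elim (encIdx j) (Sum.elim (encIdx k) (encField 0)) := by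
    funext w
    rcases w with b | b | b
    · exact hr b
    · exact hc b
    · rw [encField_zero]
      exact ht b
  rw [← hx] at h
  refine ⟨_, by rw [act_single, Instr.op]; exact onWires_mulVec_ket_of_eq _ h, ?_, ?_⟩
  · intro b
    exact oracleWires.injective.extend_apply _ _ (Sum.inr (Sum.inr b))
  · intro w hw
    by_cases hw' : ∃ q, oracleWires q = w
    · obtain ⟨q | q | q, rfl⟩ := hw'
      · rw [oracleWires.injective.extend_apply]
        exact (hr q).symm
      · rw [oracleWires.injective.extend_apply]
        exact (hc q).symm
      · exact absurd rfl (hw q)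
    · rw [Function.extend_apply' _ _ _ hw']

theorem act_entryPhases (k : Fin n) (x : SubReg n p m → Bool) :
    act U A (entryPhases k : Circuit _ _ K) (ket x) =
      Complex.exp ((2 * Real.pi / p * (bitVal (fun b => x (arg b)) * bitVal (fun b => x (tgt b)) *
        bitVal (fun b => x (vIn (k, b)))) : ℝ) * Complex.I) • ket x := by
  rw [entryPhases, act_forAll_smul fun q => act_ccp _ (by simp) (by simp) (by simp) x,
    prod_ite_exp, sum_triple (fun b => x (arg b)) (fun b => x (tgt b)) fun b => x (vIn (k, b))]

/-- Only the factor of the current one-hot index differs from 1; the one-hot form makes selecting `z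
j` cost a single control qubit. -/
theorem act_outPhases {v z : Fin n → ZMod p} [NeZero p] {j : Fin n} {x : SubReg n p m → Bool}
    (hx : IsClean v z j x) :
    act U A (outPhases : Circuit _ _ K) (ket x) =
      Complex.exp ((-(2 * Real.pi / p) * (bitVal (fun b => x (arg b)) * (z j).val) : ℝ) *
        Complex.I) • ket x := by
  have h : ∀ i : Fin n, act U A (forAll fun q : FieldReg p × FieldReg p =>
      (ccp (-(2 * Real.pi / p) * 2 ^ (q.1 + q.2 : ℕ)) (hot i) (arg q.1) (vOut (i, q.2)) :
        Circuit (SubReg n p m) (OracleReg n p) K)) (ket x) =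
      (if i = j then Complex.exp ((-(2 * Real.pi / p) * (bitVal (fun b => x (arg b)) *
        (z j).val) : ℝ) * Complex.I) else 1 : ℂ) • ket x := fun i => by
    rw [act_forAll_smul fun q => act_ccp _ (by simp) (by simp) (by simp) x]
    congr 1
    by_cases hi : i = j
    · subst hi
      rw [if_pos rfl, prod_ite_exp, ← bitVal_encField, ← sum_pair]
      congr 3
      refine Finset.sum_congr rfl fun q _ => ?_
      simp only [hx.hot, hx.vOut, encVec, decide_true, Bool.true_and]
    · rw [if_neg hi]
      refine Finset.prod_eq_one fun q _ => ?_
      simp [hx.hot, hi]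
  rw [outPhases, act_forAll_smul h]
  simp

/-- Load the entry, multiply by the phase, unload with the adjoint oracle: two queries for each
column. -/
theorem act_entry [NeZero p] (hM : IsMatrixOracle M U) (hA : A ∈ Matrix.unitaryGroup (K → Bool) ℂ)
    {j : Fin n} (k : Fin n) {x : SubReg n p m → Bool} {v : Fin n → ZMod p}
    (hr : ∀ b, x (row b) = encIdx j b) (hc : ∀ b, x (col b) = false)
    (ht : ∀ b, x (tgt b) = false) (hv : ∀ q, x (vIn q) = encVec v q) :
    act U A (Circuit.conj (entryLoad k) (entryPhases k) : Circuit _ _ K) (ket x) =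
      Complex.exp ((2 * Real.pi / p * (bitVal (fun b => x (arg b)) * (M j k).val * (v k).val) : ℝ) *
        Complex.I) • ket x := by
  obtain ⟨y, hy, hy1, hy2⟩ := act_colLoad (U := U) (A := A) k hc
  obtain ⟨y', hy', hy1', hy2'⟩ := act_query (A := A) hM (j := j) (k := k) (x := y)
    (fun b => by rw [hy2 _ (by simp), hr]) hy1 (fun b => by rw [hy2 _ (by simp), ht])
  refine act_conj hM.1 hA _ _ (ψ := ket y') (by rw [entryLoad, act_append, hy, hy']) ?_
  rw [act_entryPhases, ← bitVal_encField, ← bitVal_encField]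
  have h1 : ∀ b, y' (arg b) = x (arg b) := fun b => by
    rw [hy2' _ (by simp), hy2 _ (by simp)]
  have h2 : ∀ b, y' (vIn (k, b)) = encField (v k) b := fun b => by
    rw [hy2' _ (by simp), hy2 _ (by simp), hv]
    rfl
  simp only [h1, h2, hy1']

/-- Phases of all columns and of the output add up in the exponent. Reduction modulo p is automatic
there, so the error may be an integer rather than a residue. -/
theorem act_rowPhase [NeZero p] (hM : IsMatrixOracle M U)
    (hA : A ∈ Matrix.unitaryGroup (K → Bool) ℂ) {v z : Fin n → ZMod p} {j : Fin n}
    {x : SubReg n p m → Bool} (hx : IsClean v z j x) :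
    act U A (rowPhase : Circuit _ _ K) (ket x) =
      Complex.exp ((2 * Real.pi / p * (bitVal (fun b => x (arg b)) * rowError M v z j) : ℝ) *
        Complex.I) • ket x := by
  obtain ⟨y, hy, hy1, hy2⟩ := act_rowLoad (U := U) (A := A) hx.hot hx.row
  have h : act U A (Circuit.conj rowLoad
      (forAll fun k => Circuit.conj (entryLoad k) (entryPhases k)) : Circuit _ _ K) (ket x) =
      Complex.exp ((2 * Real.pi / p * (bitVal (fun b => x (arg b)) *
        ∑ k, ((M j k).val : ℝ) * (v k).val) : ℝ) * Complex.I) • ket x := by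
    refine act_conj hM.1 hA _ _ hy ?_
    rw [act_forAll_smul fun k => act_entry hM hA k hy1 (fun b => by rw [hy2 _ (by simp), hx.col])
      (fun b => by rw [hy2 _ (by simp), hx.tgt]) (fun q => by rw [hy2 _ (by simp), hx.vIn])]
    rw [← Complex.exp_sum]
    congr 2
    rw [← Finset.sum_mul, ← Complex.ofReal_sum]
    have h1 : ∀ b, y (arg b) = x (arg b) := fun b => hy2 _ (by simp)
    simp only [h1, Finset.mul_sum]
    congr 2
    exact Finset.sum_congr rfl fun k _ => by ring
  rw [rowPhase, act_append, h, map_smul, act_outPhases hx, smul_smul, ← Complex.exp_add,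
    ← add_mul, ← Complex.ofReal_add, rowError]
  congr 4
  push_cast
  ring

end Rows

/-! ### Products of cosines -/

/-- Iterated sin 2x = 2 sin x cos x. Used twice: for the bits of the row test and for the doubling
numbers of Grover steps. -/
theorem two_pow_mul_sin_mul_prod_cos (k : ℕ) (t : ℝ) :
    2 ^ k * Real.sin t * ∏ i ∈ Finset.range k, Real.cos (2 ^ i * t) = Real.sin (2 ^ k * t) := by
  induction k with
  | zero => simp
  | succ k ih =>
    have h : (2 : ℝ) ^ (k + 1) * t = 2 * (2 ^ k * t) := by ring
    rw [Finset.prod_range_succ, h, Real.sin_two_mul, ← ih]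
    ring

theorem norm_one_add_exp (α : ℝ) :
    ‖(1 + Complex.exp (α * Complex.I)) / 2‖ = |Real.cos (α / 2)| := by
  have h : (1 + Complex.exp (α * Complex.I)) / 2 =
      Complex.exp ((α / 2 : ℝ) * Complex.I) * (Real.cos (α / 2) : ℂ) := by
    have h1 : Complex.exp (α * Complex.I) =
        Complex.exp ((α / 2 : ℝ) * Complex.I) * Complex.exp ((α / 2 : ℝ) * Complex.I) := by
      rw [← Complex.exp_add, ← add_mul, ← Complex.ofReal_add, add_halves]
    have h2 : Complex.exp ((α / 2 : ℝ) * Complex.I) * Complex.exp (-((α / 2 : ℝ) : ℂ) * Complex.I) =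
        1 := by
      rw [← Complex.exp_add]; simp
    rw [h1, Complex.ofReal_cos, Complex.cos]
    linear_combination (-1 / 2 : ℂ) * h2
  rw [h, norm_mul, Complex.norm_exp_ofReal_mul_I, one_mul, Complex.norm_real, Real.norm_eq_abs]

/-- The amplitude with which a row of error `u` looks correct. -/
def overlap (p : ℕ) (u : ℤ) : ℂ :=
  ∏ b : FieldReg p, (1 + Complex.exp ((2 * Real.pi / p * (2 ^ (b : ℕ) * u) : ℝ) * Complex.I)) / 2

theorem norm_overlap (p : ℕ) (u : ℤ) :
    ‖overlap p u‖ = ∏ b ∈ Finset.range (Nat.clog 2 p), |Real.cos (2 ^ b * (Real.pi * u / p))| := by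
  rw [overlap, norm_prod, ← Fin.prod_univ_eq_prod_range fun b : ℕ =>
    |Real.cos (2 ^ b * (Real.pi * u / p))|]
  refine Finset.prod_congr rfl fun b _ => ?_
  rw [norm_one_add_exp]
  congr 2
  ring

theorem norm_overlap_le_one (p : ℕ) (u : ℤ) : ‖overlap p u‖ ≤ 1 := by
  rw [norm_overlap]
  exact Finset.prod_le_one (fun _ _ => abs_nonneg _) fun _ _ => Real.abs_cos_le_one _

theorem overlap_eq_one {p : ℕ} [NeZero p] {u : ℤ} (hu : (p : ℤ) ∣ u) : overlap p u = 1 := by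
  obtain ⟨c, rfl⟩ := hu
  refine Finset.prod_eq_one fun b _ => ?_
  have hp : (p : ℂ) ≠ 0 := Nat.cast_ne_zero.2 (NeZero.ne p)
  have : ((2 * Real.pi / p * (2 ^ (b : ℕ) * ((p * c : ℤ) : ℝ)) : ℝ) : ℂ) * Complex.I =
      ((2 ^ (b : ℕ) * c : ℤ) : ℂ) * (2 * Real.pi * Complex.I) := by
    push_cast
    field_simp
  rw [this, Complex.exp_int_mul_two_pi_mul_I]
  norm_num

/-- Reduction modulo p changes the sine by a sign only. For a residue 1 ≤ r ≤ p/2 the bound sin x ≥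
2x/π gives 2r/p ≥ 2/p; larger residues follow by the symmetry r ↦ p − r. -/
theorem two_div_le_abs_sin {p : ℕ} [NeZero p] {u : ℤ} (hu : ¬ (p : ℤ) ∣ u) :
    2 / (p : ℝ) ≤ |Real.sin (Real.pi * u / p)| := by
  have hp : 0 < (p : ℝ) := Nat.cast_pos.2 (NeZero.pos p)
  have hp' : (0 : ℤ) < p := by exact_mod_cast NeZero.pos p
  set r := u % p with hr
  have hr0 : 0 < r := lt_of_le_of_ne (Int.emod_nonneg _ hp'.ne')
    fun h => hu (Int.dvd_of_emod_eq_zero h.symm)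
  have hrp : r < p := Int.emod_lt_of_pos _ hp'
  have h1 : Real.pi * u / p = Real.pi * r / p + (u / p : ℤ) * Real.pi := by
    have : (u : ℝ) = r + p * (u / p : ℤ) := by exact_mod_cast (Int.emod_add_mul_ediv u p).symm
    rw [this]
    field_simp
  rw [h1, Real.sin_add_int_mul_pi, abs_mul, abs_zpow, abs_neg, abs_one, one_zpow, one_mul]
  refine le_trans ?_ (le_abs_self _)
  have hr1 : (1 : ℝ) ≤ r := by exact_mod_cast hr0
  have hr2 : (r : ℝ) + 1 ≤ p := by exact_mod_cast hrp
  have key : ∀ q : ℝ, 1 ≤ q → q ≤ p / 2 → 2 / (p : ℝ) ≤ Real.sin (Real.pi * q / p) := by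
    intro q hq hqp
    refine le_trans ?_ (Real.mul_le_sin (by positivity) ?_)
    · have : 2 / Real.pi * (Real.pi * q / p) = 2 * q / p := by field_simp
      rw [this]
      gcongr
      linarith
    · rw [div_le_iff₀ hp]
      nlinarith [Real.pi_pos]
  rcases le_total (r : ℝ) (p / 2) with h | h
  · exact key r hr1 h
  · have h2 : Real.pi * r / p = Real.pi - Real.pi * (p - r) / p := by field_simp; ring
    rw [h2, Real.sin_pi_sub]
    exact key _ (by linarith) (by linarith)

/-- The product of cosines times 2^L |sin(πu/p)| is the modulus of a sine, hence at most 1, and the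
factor is at least p · 2/p = 2. -/
theorem norm_overlap_le_half {p : ℕ} [NeZero p] {u : ℤ} (hu : ¬ (p : ℤ) ∣ u) :
    ‖overlap p u‖ ≤ 1 / 2 := by
  have hp : 0 < (p : ℝ) := Nat.cast_pos.2 (NeZero.pos p)
  have h := congrArg abs (two_pow_mul_sin_mul_prod_cos (Nat.clog 2 p) (Real.pi * u / p))
  rw [abs_mul, abs_mul, Finset.abs_prod, ← norm_overlap, abs_of_pos (by positivity)] at h
  have h1 := Real.abs_sin_le_one (2 ^ Nat.clog 2 p * (Real.pi * u / p))
  rw [← h] at h1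
  have h2 : (p : ℝ) ≤ 2 ^ Nat.clog 2 p := by exact_mod_cast Nat.le_pow_clog one_lt_two p
  have h3 : 2 ≤ 2 ^ Nat.clog 2 p * |Real.sin (Real.pi * u / p)| := by
    calc (2 : ℝ) = p * (2 / p) := by field_simp
      _ ≤ _ := by gcongr; exact two_div_le_abs_sin hu
  nlinarith [norm_nonneg (overlap p u)]

theorem dvd_rowError_iff {n p : ℕ} [NeZero p] (M : Matrix (Fin n) (Fin n) (ZMod p))
    (v z : Fin n → ZMod p) (j : Fin n) : (p : ℤ) ∣ rowError M v z j ↔ z j = (M *ᵥ v) j := by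
  rw [← ZMod.intCast_zmod_eq_zero_iff_dvd, rowError]
  push_cast
  simp only [ZMod.natCast_zmod_val]
  rw [sub_eq_zero, eq_comm]
  rfl

/-! ### Preparing the search state -/

section Search

variable {n p m : ℕ} {K : Type} [Fintype K] [DecidableEq K]

/-- Clean bit strings whose flags satisfy `P`. -/
def clean (v z : Fin n → ZMod p) (j : Fin n) (P : (Fin (m + 1) → Bool) → Prop) :
    Set (SubReg n p m → Bool) := {x | IsClean v z j x ∧ P fun i => x (flg i)}

/-- Clean bit strings, with any one-hot index, whose flags satisfy `P`. -/
def cleanAll (v z : Fin n → ZMod p) (P : (Fin (m + 1) → Bool) → Prop) :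
    Set (SubReg n p m → Bool) := {x | ∃ j, x ∈ clean v z j P}

theorem clean_subset_cleanAll (v z : Fin n → ZMod p) (j : Fin n)
    (P : (Fin (m + 1) → Bool) → Prop) : clean v z j P ⊆ cleanAll v z P := fun _ hx => ⟨j, hx⟩

variable {M : Matrix (Fin n) (Fin n) (ZMod p)} {U : QOp (OracleReg n p)} {A : QOp K}

theorem preserves_cleanAll {v z : Fin n → ZMod p} {P : (Fin (m + 1) → Bool) → Prop}
    {c : Circuit (SubReg n p m) (OracleReg n p) K}
    (h : ∀ j, Preserves U A (clean v z j P) c) : Preserves U A (cleanAll v z P) c := by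
  rintro x ⟨j, hx⟩
  exact supported_mono (clean_subset_cleanAll v z j P) (h j x hx)

/-- Hadamard gates on the argument register. -/
def hadArgs : Circuit (SubReg n p m) (OracleReg n p) K := forAll fun b => had (arg b)

theorem preserves_hadArgs (v z : Fin n → ZMod p) (j : Fin n) (P : (Fin (m + 1) → Bool) → Prop) :
    Preserves U A (clean v z j P) (hadArgs : Circuit _ _ K) := by
  refine preserves_flatMap _ fun b _ x hx => ?_
  have h : ∀ c, ket (Function.update x (arg b) c) ∈ supported (clean v z j P) := fun c =>
    ket_mem_supported ⟨hx.1.update_arg b c, by simpa using hx.2⟩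
  rw [act_had]
  exact Submodule.smul_mem _ _ (Submodule.add_mem _ (h _) (Submodule.smul_mem _ _ (h _)))

/-- All target bits start at zero, so no signs appear: every string that agrees with `x` off the
targets gets the same amplitude. -/
theorem act_flatMap_had {ι W K₁ : Type} [Fintype W] [DecidableEq W] [Fintype K₁] [DecidableEq K₁]
    {U : QOp K₁} {t : ι → W} (ht : Function.Injective t) (l : List ι) (hl : l.Nodup)
    (x y : W → Bool) (hx : ∀ i ∈ l, x (t i) = false) :
    act U A (l.flatMap fun i => (had (t i) : Circuit W K₁ K)) (ket x) y =
      if ∀ w, (∀ i ∈ l, t i ≠ w) → x w = y w then (((√2)⁻¹ : ℝ) : ℂ) ^ l.length else 0 := by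
  induction l generalizing x with
  | nil =>
    rw [List.flatMap_nil, act_nil, ket_apply]
    refine if_congr ⟨fun h w _ => by rw [h], fun h => funext fun w => (h w (by simp)).symm⟩ ?_ rfl
    simp
  | cons i l ih =>
    rw [List.nodup_cons] at hl
    have hx' : ∀ c, ∀ j ∈ l, Function.update x (t i) c (t j) = false := fun c j hj => by
      rw [Function.update_of_ne, hx j (by simp [hj])]
      intro h
      exact hl.1 (ht h ▸ hj)
    have hi : ∀ j ∈ l, t j ≠ t i := fun j hj h => hl.1 (ht h ▸ hj)
    rw [List.flatMap_cons, act_append, act_had, map_smul, map_add, map_smul, Pi.smul_apply,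
      Pi.add_apply, Pi.smul_apply, ih hl.2 _ (hx' false), ih hl.2 _ (hx' true), hx i (by simp)]
    have hiff : ∀ c, (∀ w, (∀ j ∈ l, t j ≠ w) → Function.update x (t i) c w = y w) ↔
        c = y (t i) ∧ ∀ w, (∀ j ∈ i :: l, t j ≠ w) → x w = y w := by
      intro c
      constructor
      · intro h
        refine ⟨by simpa using h (t i) hi, fun w hw => ?_⟩
        rw [← h w fun j hj => hw j (by simp [hj]), Function.update_of_ne (hw i (by simp)).symm]
      · rintro ⟨h1, h2⟩ w hw
        by_cases hwi : w = t i
        · rw [hwi, Function.update_self, h1]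
        · rw [Function.update_of_ne hwi]
          refine h2 w fun j hj => ?_
          rcases List.mem_cons.1 hj with rfl | hj
          exacts [Ne.symm hwi, hw j hj]
    rw [if_congr (hiff false) rfl rfl, if_congr (hiff true) rfl rfl, List.length_cons, pow_succ']
    by_cases h : ∀ w, (∀ j ∈ i :: l, t j ≠ w) → x w = y w
    · rw [if_congr (and_iff_left h) rfl rfl, if_congr (and_iff_left h) rfl rfl, if_pos h]
      cases y (t i) <;> simp
    · rw [if_neg fun H : false = y (t i) ∧ _ => h H.2,
        if_neg fun H : true = y (t i) ∧ _ => h H.2, if_neg h]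
      simp

theorem act_hadArgs_of_agree {x y : SubReg n p m → Bool} (hx : ∀ b, x (arg b) = false)
    (hy : ∀ w, (∀ b, arg b ≠ w) → x w = y w) :
    act U A (hadArgs : Circuit _ _ K) (ket x) y = (((√2)⁻¹ : ℝ) : ℂ) ^ Nat.clog 2 p := by
  refine (act_flatMap_had (fun b b' h => by simpa using h) _ (Finset.nodup_toList _) x y
    fun b _ => hx b).trans ((if_pos ?_).trans ?_)
  · exact fun w hw => hy w fun b => hw b (by simp)
  · rw [Finset.length_toList, Finset.card_univ, Fintype.card_fin]

theorem act_hadArgs_of_not_agree {x y : SubReg n p m → Bool} (hx : ∀ b, x (arg b) = false)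
    (hy : ¬ ∀ w, (∀ b, arg b ≠ w) → x w = y w) :
    act U A (hadArgs : Circuit _ _ K) (ket x) y = 0 :=
  (act_flatMap_had (fun b b' h => by simpa using h) _ (Finset.nodup_toList _) x y
    fun b _ => hx b).trans (if_neg fun h => hy fun w hw => h w fun b _ => hw b)

/-- The rotations that distribute the one-hot index zero evenly over the first `k + 1` indices. -/
def spread [NeZero n] : ℕ → Circuit (SubReg n p m) (OracleReg n p) K
  | 0 => []
  | k + 1 => spread k ++ if h : k + 1 < n then
      givens √((n - k - 1) / (n - k)) √(1 / (n - k)) (hot 0) (hot ⟨k + 1, h⟩) else []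

theorem update_hot (v z : Fin n → ZMod p) {i j : Fin n} (hij : i ≠ j) (a : FieldReg p → Bool)
    (fl : Fin (m + 1) → Bool) :
    Function.update (Function.update (cfg v z i a fl) (hot i) false) (hot j) true =
      cfg v z j a fl := by
  funext w
  rcases w with q | q | k | b | b | b | b | k | k | ⟨⟩ <;> try rfl
  change Function.update (Function.update (cfg v z i a fl) (hot i) false) (hot j) true (hot k) = decide (k = j)
  by_cases hkj : k = j
  · subst hkj
    simp only [Function.update_self, decide_true]
  · rw [Function.update_of_ne (by simp [hkj]), decide_eq_false hkj]
    by_cases hki : k = i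
    · subst hki
      rw [Function.update_self]
    · rw [Function.update_of_ne (by simp [hki])]
      exact decide_eq_false hki

theorem sq_add_sq_spread {k : ℕ} (h : k + 1 < n) :
    √(((n : ℝ) - k - 1) / (n - k)) ^ 2 + √(1 / ((n : ℝ) - k)) ^ 2 = 1 := by
  have h' : (k : ℝ) + 1 < n := by exact_mod_cast h
  have h0 : (0 : ℝ) < n - k := by linarith
  rw [Real.sq_sqrt (div_nonneg (by linarith) h0.le), Real.sq_sqrt (by positivity)]
  field_simp
  ring

/-- On one-hot strings the wires `hot 0` and `hot k` are never both one, and both are zero exactly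
when the index is neither `0` nor `k`. So the rotation acts in the plane of these two indices. -/
theorem act_givens_cfg [NeZero n] {a s : ℝ} (has : a ^ 2 + s ^ 2 = 1) {k : Fin n} (hk : k ≠ 0)
    (v z : Fin n → ZMod p) (j : Fin n) (b : FieldReg p → Bool) (fl : Fin (m + 1) → Bool) :
    act U A (givens a s (hot 0) (hot k) : Circuit _ _ K) (ket (cfg v z j b fl)) =
      if j = 0 then (a : ℂ) • ket (cfg v z 0 b fl) + (s : ℂ) • ket (cfg v z k b fl)
      else if j = k then (a : ℂ) • ket (cfg v z k b fl) + (-s : ℂ) • ket (cfg v z 0 b fl)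
      else ket (cfg v z j b fl) := by
  have h0 : cfg v z j b fl (hot 0) = decide (0 = j) := rfl
  have hk' : cfg v z j b fl (hot k) = decide (k = j) := rfl
  rw [act_givens has (by simp [hk.symm]), h0, hk']
  by_cases hj : j = 0
  · subst hj
    simp only [hk, decide_true, decide_false, update_hot v z hk.symm]
    simp
  · by_cases hj' : j = k
    · subst hj'
      rw [Function.update_comm (by simp [hk.symm])]
      simp only [hk, hk.symm, decide_true, decide_false, update_hot v z hk]
      simp
    · simp [hj, hj', Ne.symm hj, Ne.symm hj']

theorem preserves_spread [NeZero n] (v z : Fin n → ZMod p) (P : (Fin (m + 1) → Bool) → Prop)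
    (k : ℕ) : Preserves U A (cleanAll v z P) (spread k : Circuit _ _ K) := by
  induction k with
  | zero => exact preserves_nil _
  | succ k ih =>
    refine ih.append ?_
    split_ifs with h
    · rintro x ⟨j, hx⟩
      have hmem : ∀ i, ket (cfg v z i (fun b => x (arg b)) fun i => x (flg i)) ∈
          supported (cleanAll v z P) := fun i =>
        ket_mem_supported ⟨i, isClean_cfg _ _ _ _ _, hx.2⟩
      rw [hx.1.eq_cfg, act_givens_cfg (sq_add_sq_spread h) (by simp [Fin.ext_iff])]
      split_ifs
      · exact Submodule.add_mem _ (Submodule.smul_mem _ _ (hmem _))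
          (Submodule.smul_mem _ _ (hmem _))
      · exact Submodule.add_mem _ (Submodule.smul_mem _ _ (hmem _))
          (Submodule.smul_mem _ _ (hmem _))
      · exact hmem _
    · exact preserves_nil _

/-- The weight still to be distributed stays at index zero; each rotation splits off probability 1/n
from it, leaving 1/n there after n − 1 rotations. -/
theorem act_spread [NeZero n] (v z : Fin n → ZMod p) (b : FieldReg p → Bool)
    (fl : Fin (m + 1) → Bool) (k : ℕ) (hk : k < n) :
    act U A (spread k : Circuit _ _ K) (ket (cfg v z 0 b fl)) =
      (√((n - k) / n) : ℂ) • ket (cfg v z 0 b fl) +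
        ∑ j with 0 < j.val ∧ j.val ≤ k, (√(1 / n) : ℂ) • ket (cfg v z j b fl) := by
  have hn : (0 : ℝ) < n := Nat.cast_pos.2 (NeZero.pos n)
  induction k with
  | zero =>
    have : (Finset.univ.filter fun j : Fin n => 0 < j.val ∧ j.val ≤ 0) = ∅ := by
      ext j
      simp only [Finset.mem_filter, Finset.mem_univ, true_and, Finset.notMem_empty, iff_false]
      omega
    rw [this]
    simp [spread, hn.ne']
  | succ k ih =>
    have hk' : ((k : ℝ) + 1) < n := by exact_mod_cast hk
    have hf : (Finset.univ.filter fun j : Fin n => 0 < j.val ∧ j.val ≤ k + 1) =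
        insert ⟨k + 1, hk⟩ (Finset.univ.filter fun j : Fin n => 0 < j.val ∧ j.val ≤ k) := by
      ext j
      simp only [Finset.mem_filter, Finset.mem_univ, true_and, Finset.mem_insert, Fin.ext_iff]
      omega
    have hne : (⟨k + 1, hk⟩ : Fin n) ≠ 0 := by simp [Fin.ext_iff]
    have hg := act_givens_cfg (m := m) (U := U) (A := A) (sq_add_sq_spread hk) hne v z
    rw [spread, dif_pos hk, act_append, ih (by omega), map_add, map_smul, map_sum, hg, if_pos rfl,
      hf, Finset.sum_insert (by simp), smul_add, smul_smul, smul_smul]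
    have h1 : ∀ j ∈ Finset.univ.filter fun j : Fin n => 0 < j.val ∧ j.val ≤ k,
        act U A (givens √((n - k - 1) / (n - k)) √(1 / (n - k)) (hot 0) (hot ⟨k + 1, hk⟩) :
          Circuit _ _ K) ((√(1 / n) : ℂ) • ket (cfg v z j b fl)) =
          (√(1 / n) : ℂ) • ket (cfg v z j b fl) := by
      intro j hj
      simp only [Finset.mem_filter, Finset.mem_univ, true_and] at hj
      rw [map_smul, hg, if_neg, if_neg]
      · rintro rfl
        simp at hj
      · rintro rfl
        simp at hj
    rw [Finset.sum_congr rfl h1]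
    -- What remains at index zero; `h3` is what has been moved to the new index `k + 1`.
    have h2 : (√((n - k) / n) : ℂ) * (√((n - k - 1) / (n - k)) : ℂ) =
        (√((n - (k + 1 : ℕ)) / n) : ℂ) := by
      rw [← Complex.ofReal_mul, ← Real.sqrt_mul (div_nonneg (by linarith) hn.le)]
      congr 2
      have : (n : ℝ) - k ≠ 0 := by linarith
      push_cast
      field_simp
      ring
    have h3 : (√((n - k) / n) : ℂ) * (√(1 / (n - k)) : ℂ) = (√(1 / n) : ℂ) := by
      rw [← Complex.ofReal_mul, ← Real.sqrt_mul (div_nonneg (by linarith) hn.le)]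
      congr 2
      have : (n : ℝ) - k ≠ 0 := by linarith
      field_simp
    rw [h2, h3, add_assoc]

/-- The circuit preparing the state to be searched. -/
def searchPrep [NeZero n] : Circuit (SubReg n p m) (OracleReg n p) K :=
  spread (n - 1) ++ Circuit.conj hadArgs rowPhase

variable [NeZero n] [NeZero p]

theorem preserves_conj_rowPhase (hM : IsMatrixOracle M U)
    (hA : A ∈ Matrix.unitaryGroup (K → Bool) ℂ) (v z : Fin n → ZMod p) (j : Fin n)
    (P : (Fin (m + 1) → Bool) → Prop) :
    Preserves U A (clean v z j P) (Circuit.conj hadArgs rowPhase : Circuit _ _ K) :=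
  ((preserves_hadArgs v z j P).append (preserves_of_smul fun _ hx =>
    ⟨_, act_rowPhase hM hA hx.1⟩)).append ((preserves_hadArgs v z j P).inv hM.1 hA)

theorem preserves_searchPrep (hM : IsMatrixOracle M U)
    (hA : A ∈ Matrix.unitaryGroup (K → Bool) ℂ) (v z : Fin n → ZMod p)
    (P : (Fin (m + 1) → Bool) → Prop) :
    Preserves U A (cleanAll v z P) (searchPrep : Circuit _ _ K) :=
  (preserves_spread v z P _).append
    (preserves_cleanAll fun j => preserves_conj_rowPhase hM hA v z j P)

/-- The argument qubits, as an embedding. -/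
def argWires : FieldReg p ↪ SubReg n p m := ⟨arg, fun b b' h => by simpa using h⟩

/-- This matrix entry is 2^(−L) ∑ₐ exp(2πi a u/p), and the phase is multiplicative in the bits of a,
so the sum over a is a product over bits. -/
theorem act_conj_rowPhase_apply (hM : IsMatrixOracle M U)
    (hA : A ∈ Matrix.unitaryGroup (K → Bool) ℂ) (v z : Fin n → ZMod p) (j : Fin n)
    (fl : Fin (m + 1) → Bool) :
    act U A (Circuit.conj hadArgs rowPhase : Circuit _ _ K) (ket (cfg v z j zeros fl))
      (cfg v z j zeros fl) = overlap p (rowError M v z j) := by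
  set x : SubReg n p m → Bool := cfg v z j zeros fl with hx
  have hclean : IsClean v z j x := isClean_cfg _ _ _ _ _
  have hh : act U A (hadArgs : Circuit _ _ K) (ket x) ∈
      supported (clean v z j fun _ : Fin (m + 1) → Bool => True) :=
    preserves_hadArgs v z j _ x ⟨hclean, trivial⟩
  -- The final inverse Hadamard gates go to the other side of the inner product, so the Hadamard
  -- amplitudes enter once conjugated and once not.
  rw [Circuit.conj, act_append, act_append, 
    ← star_ket_dotProduct x (act U A _ _), ← star_act_dotProduct,
    act_diag (fun y hy => act_rowPhase hM hA hy.1) hh]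
  have hr : (((√2)⁻¹ : ℝ) : ℂ) * (((√2)⁻¹ : ℝ) : ℂ) = 1 / 2 := by
    rw [← Complex.ofReal_mul, ← mul_inv, Real.mul_self_sqrt (by norm_num)]
    norm_num
  simp only [dotProduct, Pi.star_apply]
  rw [sum_eq_sum_extend argWires x (fun y => (1 / 2) ^ Nat.clog 2 p *
    Complex.exp ((2 * Real.pi / p * (bitVal (fun b => y (arg b)) * rowError M v z j) : ℝ) *
      Complex.I))]
  rotate_left
  · intro y hy
    rw [act_hadArgs_of_agree (fun b => rfl) hy, star_pow, Complex.star_def, Complex.conj_ofReal,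
      ← hr, mul_pow]
    ring
  · intro y hy
    rw [act_hadArgs_of_not_agree (fun b => rfl) hy, star_zero, zero_mul]
  have hext : ∀ (a : FieldReg p → Bool) b, Function.extend argWires a x (arg b) = a b :=
    fun a b => argWires.injective.extend_apply a x b
  simp only [hext]
  have hprod : ∀ a : FieldReg p → Bool,
      (1 / 2 : ℂ) ^ Nat.clog 2 p * Complex.exp ((2 * Real.pi / p *
        (bitVal a * rowError M v z j) : ℝ) * Complex.I) =
      ∏ b, if a b then 1 / 2 * Complex.exp ((2 * Real.pi / p *
        (2 ^ (b : ℕ) * rowError M v z j) : ℝ) * Complex.I) else (1 / 2 : ℂ) := by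
    intro a
    have h1 : ∀ b : FieldReg p, (if a b then 1 / 2 * Complex.exp ((2 * Real.pi / p *
        (2 ^ (b : ℕ) * rowError M v z j) : ℝ) * Complex.I) else (1 / 2 : ℂ)) =
        1 / 2 * if a b then Complex.exp ((2 * Real.pi / p *
        (2 ^ (b : ℕ) * rowError M v z j) : ℝ) * Complex.I) else 1 := fun b => by
      split_ifs <;> simp
    rw [Finset.prod_congr rfl fun b _ => h1 b, Finset.prod_mul_distrib, Finset.prod_const,
      Finset.card_univ, Fintype.card_fin, prod_ite_exp, bitVal, Finset.sum_mul, Finset.mul_sum]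
    congr 4
    refine Finset.sum_congr rfl fun b _ => ?_
    split_ifs <;> simp
  rw [Finset.sum_congr rfl fun a _ => hprod a, overlap]
  -- Interchanges the sum over all strings of argument bits with the product over bits.
  have := Finset.prod_univ_sum (fun _ : FieldReg p => (Finset.univ : Finset Bool))
    fun b c => if c then 1 / 2 * Complex.exp ((2 * Real.pi / p *
        (2 ^ (b : ℕ) * rowError M v z j) : ℝ) * Complex.I) else (1 / 2 : ℂ)
  rw [Fintype.piFinset_univ] at this
  rw [← this]
  refine Finset.prod_congr rfl fun b _ => ?_
  simp
  ring

theorem act_spread_uniform (v z : Fin n → ZMod p) (b : FieldReg p → Bool)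
    (fl : Fin (m + 1) → Bool) :
    act U A (spread (n - 1) : Circuit _ _ K) (ket (cfg v z 0 b fl)) =
      ∑ j, (√(1 / n) : ℂ) • ket (cfg v z j b fl) := by
  have hn := NeZero.pos n
  rw [act_spread v z b fl _ (by omega), Nat.cast_sub hn]
  have : (Finset.univ.filter fun j : Fin n => 0 < j.val ∧ j.val ≤ n - 1) = {0}ᶜ := by
    ext j
    simp only [Finset.mem_filter, Finset.mem_univ, true_and, Finset.mem_compl,
      Finset.mem_singleton, Fin.ext_iff, Fin.coe_ofNat_eq_mod,
      Nat.zero_mod]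
    omega
  rw [this, Fintype.sum_eq_add_sum_compl (0 : Fin n)
    fun j => (√(1 / n) : ℂ) • ket (cfg v z j b fl)]
  congr 5
  simp

/-- The bit strings whose argument register is zero. -/
def argZero : Set (SubReg n p m → Bool) := {x | ∀ b, x (arg b) = false}

/-- Different rows carry different one-hot strings and cannot interfere, so the probability of a
zero argument is the average over the rows. -/
theorem normSq_argZero_searchPrep (hM : IsMatrixOracle M U)
    (hA : A ∈ Matrix.unitaryGroup (K → Bool) ℂ) (v z : Fin n → ZMod p)
    (fl : Fin (m + 1) → Bool) :
    normSq (argZero.indicator (act U A (searchPrep : Circuit _ _ K) (ket (cfg v z 0 zeros fl)))) =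
      (∑ j, ‖overlap p (rowError M v z j)‖ ^ 2) / n := by
  classical
  set Φ := act U A (searchPrep : Circuit _ _ K) (ket (cfg v z 0 zeros fl)) with hΦ
  have hmem : Φ ∈ supported (cleanAll v z fun f => f = fl) :=
    preserves_searchPrep hM hA v z _ _ ⟨0, isClean_cfg _ _ _ _ _, rfl⟩
  have happ : ∀ j, Φ (cfg v z j zeros fl) = (√(1 / n) : ℂ) * overlap p (rowError M v z j) := by
    intro j
    rw [hΦ, searchPrep, act_append, act_spread_uniform, map_sum, Finset.sum_apply,
      Finset.sum_eq_single j]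
    · rw [map_smul, Pi.smul_apply, act_conj_rowPhase_apply hM hA, smul_eq_mul]
    · intro i _ hij
      rw [map_smul, Pi.smul_apply, preserves_conj_rowPhase hM hA v z i (fun _ => True)
        _ ⟨isClean_cfg _ _ _ _ _, trivial⟩ _ _, smul_zero]
      rintro ⟨h, -⟩
      have h1 := h.hot i
      have h2 : cfg v z j zeros fl (hot i) = decide (i = j) := rfl
      rw [h2, decide_eq_false hij] at h1
      simp at h1
    · simp
  rw [normSq, ← Finset.sum_subset (Finset.subset_univ
    (Finset.univ.image fun j : Fin n => cfg v z j zeros fl))]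
  · rw [Finset.sum_image fun i _ j _ h => cfg_injective_index h, Finset.sum_div]
    refine Finset.sum_congr rfl fun j _ => ?_
    rw [Set.indicator_of_mem (by intro b; rfl), happ, norm_mul, mul_pow, Complex.norm_real,
      Real.norm_eq_abs, sq_abs, Real.sq_sqrt (by positivity)]
    ring
  · intro x _ hx
    by_cases h : x ∈ argZero
    · rw [Set.indicator_of_mem h, hmem]
      · simp
      · rintro ⟨j, hc, hf⟩
        refine hx (Finset.mem_image.2 ⟨j, Finset.mem_univ _, ?_⟩)
        rw [hc.eq_cfg, hf]
        congr 1
        funext b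
        exact (h b).symm
    · rw [Set.indicator_of_notMem h]
      simp

end Search

/-! ### The verification circuit -/

theorem ite_congr_iff {P Q : Prop} {hP : Decidable P} {hQ : Decidable Q} (h : P ↔ Q) {a b : ℂ} :
    ite P a b = ite Q a b := if_congr h rfl rfl

section Verify

variable {n p m : ℕ} {K : Type} [Fintype K] [DecidableEq K]
  {M : Matrix (Fin n) (Fin n) (ZMod p)} {U : QOp (OracleReg n p)} {A : QOp K}

theorem act_zeroPhase_args (hM : IsMatrixOracle M U) (hA : A ∈ Matrix.unitaryGroup (K → Bool) ℂ)
    (θ : ℝ) {v z : Fin n → ZMod p} {j : Fin n} {x : SubReg n p m → Bool} (hx : IsClean v z j x) :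
    act U A (zeroPhase chain θ args : Circuit _ _ K) (ket x) =
      (if ∀ b, x (arg b) = false then Complex.exp (θ * Complex.I) else 1 : ℂ) • ket x := by
  rw [act_zeroPhase hM.1 hA]
  · congr 1
    exact ite_congr_iff forall_mem_args
  · rw [forall_mem_args]
    exact fun b i _ => by simp [chain]
  · rw [length_args]
    exact chain_injOn (by omega)
  · exact fun i _ => hx.chain i

theorem act_zeroPhase_flags (hM : IsMatrixOracle M U)
    (hA : A ∈ Matrix.unitaryGroup (K → Bool) ℂ) (θ : ℝ) {v z : Fin n → ZMod p} {j : Fin n}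
    {x : SubReg n p m → Bool} (hx : IsClean v z j x) :
    act U A (zeroPhase chain θ flags : Circuit _ _ K) (ket x) =
      (if ∀ i, x (flg i) = false then Complex.exp (θ * Complex.I) else 1 : ℂ) • ket x := by
  rw [act_zeroPhase hM.1 hA]
  · congr 1
    exact ite_congr_iff forall_mem_flags
  · rw [forall_mem_flags]
    exact fun b i _ => by simp [chain]
  · rw [length_flags]
    exact chain_injOn (by omega)
  · exact fun i _ => hx.chain i

theorem act_flagIf_args (hM : IsMatrixOracle M U) (hA : A ∈ Matrix.unitaryGroup (K → Bool) ℂ)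
    (i : Fin (m + 1)) {v z : Fin n → ZMod p} {j : Fin n} {x : SubReg n p m → Bool}
    (hx : IsClean v z j x) :
    act U A (flagIf chain args (flg i) : Circuit _ _ K) (ket x) =
      ket (Function.update x (flg i)
        (xor (x (flg i)) !decide (∀ b, x (arg b) = false))) := by
  rw [act_flagIf hM.1 hA]
  · simp only [forall_mem_args]
  · simp [args]
  · exact fun i _ => by simp [chain]
  · rw [forall_mem_args]
    exact fun b i _ => by simp [chain]
  · rw [length_args]
    exact chain_injOn (by omega)
  · exact fun i _ => hx.chain i

theorem act_flagIf_flags (hM : IsMatrixOracle M U) (hA : A ∈ Matrix.unitaryGroup (K → Bool) ℂ)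
    {v z : Fin n → ZMod p} {j : Fin n} {x : SubReg n p m → Bool} (hx : IsClean v z j x) :
    act U A (flagIf chain flags fin : Circuit _ _ K) (ket x) =
      ket (Function.update x fin !decide (∀ i, x (flg i) = false)) := by
  rw [act_flagIf hM.1 hA, hx.fin]
  · simp only [forall_mem_flags, Bool.false_xor]
  · simp [flags]
  · exact fun i _ => by simp [chain]
  · rw [forall_mem_flags]
    exact fun b i _ => by simp [chain]
  · rw [length_flags]
    exact chain_injOn (by have := Nat.zero_le (Nat.clog 2 p); omega)
  · exact fun i _ => hx.chain i

variable [NeZero n]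

/-- Among clean strings a single qubit, `hot 0`, decides whether the index is zero. The flags need
not be tested, because the preparation leaves them alone. -/
theorem act_ctrlPhase_args (hM : IsMatrixOracle M U) (hA : A ∈ Matrix.unitaryGroup (K → Bool) ℂ)
    (θ : ℝ) {v z : Fin n → ZMod p} {j : Fin n} {x : SubReg n p m → Bool} (hx : IsClean v z j x) :
    act U A (ctrlPhase chain θ (hot 0) args : Circuit _ _ K) (ket x) =
      (if x = cfg v z 0 zeros (fun i => x (flg i)) then Complex.exp (θ * Complex.I) else 1 : ℂ) •
        ket x := by
  rw [act_ctrlPhase hM.1 hA]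
  · congr 1
    refine ite_congr_iff ?_
    rw [forall_mem_args]
    constructor
    · rintro ⟨h1, h2⟩
      have hj : j = 0 := by
        rw [hx.hot] at h1
        exact (of_decide_eq_true h1).symm
      subst hj
      have h3 : (fun b => x (arg b)) = zeros := funext h2
      conv_lhs => rw [hx.eq_cfg, h3]
    · intro h
      rw [h]
      exact ⟨by simp [cfg], fun b => rfl⟩
  · simp [args]
  · exact fun i _ => by simp [chain]
  · rw [forall_mem_args]
    exact fun b i _ => by simp [chain]
  · rw [length_args]
    exact chain_injOn (by omega)
  · exact fun i _ => hx.chain i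

/-- For the reflection about the start of the whole search the flags must be tested too, since the
search changes them. This is the longest conjunction and fixes the number of conjunction qubits. -/
theorem act_ctrlPhase_args_flags (hM : IsMatrixOracle M U)
    (hA : A ∈ Matrix.unitaryGroup (K → Bool) ℂ) (θ : ℝ) {v z : Fin n → ZMod p} {j : Fin n}
    {x : SubReg n p m → Bool} (hx : IsClean v z j x) :
    act U A (ctrlPhase chain θ (hot 0) (args ++ flags) : Circuit _ _ K) (ket x) =
      (if x = cfg v z 0 zeros zeros then Complex.exp (θ * Complex.I) else 1 : ℂ) • ket x := by
  rw [act_ctrlPhase hM.1 hA]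
  · congr 1
    refine ite_congr_iff ?_
    rw [List.forall_mem_append, forall_mem_args, forall_mem_flags]
    constructor
    · rintro ⟨h1, h2, h3⟩
      have hj : j = 0 := by
        rw [hx.hot] at h1
        exact (of_decide_eq_true h1).symm
      subst hj
      have h4 : (fun b => x (arg b)) = zeros := funext h2
      have h5 : (fun i => x (flg i)) = zeros := funext h3
      rw [hx.eq_cfg, h4, h5]
    · intro h
      rw [h]
      exact ⟨by simp [cfg], fun b => rfl, fun b => rfl⟩
  · simp [args, flags]
  · exact fun i _ => by simp [chain]
  · rw [List.forall_mem_append, forall_mem_args, forall_mem_flags]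
    exact ⟨fun b i _ => by simp [chain], fun b i _ => by simp [chain]⟩
  · rw [List.length_append, length_args, length_flags]
    exact chain_injOn (by omega)
  · exact fun i _ => hx.chain i

/-- One Grover step. -/
def groverStep : Circuit (SubReg n p m) (OracleReg n p) K :=
  zeroPhase chain Real.pi args ++
    (Circuit.inv searchPrep ++ ctrlPhase chain Real.pi (hot 0) args ++ searchPrep)

/-- Exponential search: after preparation and after `1, 2, 4, …` Grover steps, a nonzero argument
is recorded in a new flag. -/
def search : ℕ → Circuit (SubReg n p m) (OracleReg n p) K
  | 0 => searchPrep ++ flagIf chain args (flg 0)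
  | i + 1 => search i ++ (rep groverStep (2 ^ i) ++ flagIf chain args (flg (Fin.ofNat _ (i + 1))))

/-- The search, followed by `k` levels of fixed-point amplitude amplification. -/
def amplified : ℕ → Circuit (SubReg n p m) (OracleReg n p) K
  | 0 => search m
  | k + 1 => amplified k ++ zeroPhase chain (-(Real.pi / 3)) flags ++
      ((amplified k).inv ++ ctrlPhase chain (Real.pi / 3) (hot 0) (args ++ flags) ++ amplified k)

/-- The verification circuit. -/
def verifier (k : ℕ) : Circuit (SubReg n p m) (OracleReg n p) K :=
  xGate (hot 0) ++ amplified k ++ flagIf chain flags fin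

variable [NeZero p]

/-! ### Clean subspaces and the evolution of the unflagged branch. -/

theorem preserves_groverStep (hM : IsMatrixOracle M U)
    (hA : A ∈ Matrix.unitaryGroup (K → Bool) ℂ) (v z : Fin n → ZMod p)
    (P : (Fin (m + 1) → Bool) → Prop) :
    Preserves U A (cleanAll v z P) (groverStep : Circuit _ _ K) := by
  have h := preserves_searchPrep hM hA v z P
  refine Preserves.append ?_ (((h.inv hM.1 hA).append ?_).append h)
  · exact preserves_of_smul fun x ⟨j, hx⟩ => ⟨_, act_zeroPhase_args hM hA _ hx.1⟩
  · exact preserves_of_smul fun x ⟨j, hx⟩ => ⟨_, act_ctrlPhase_args hM hA _ hx.1⟩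

theorem preserves_flagIf_args (hM : IsMatrixOracle M U)
    (hA : A ∈ Matrix.unitaryGroup (K → Bool) ℂ) (v z : Fin n → ZMod p) (i : Fin (m + 1)) :
    Preserves U A (cleanAll v z fun _ => True)
      (flagIf chain args (flg i) : Circuit _ _ K) := by
  rintro x ⟨j, hx⟩
  rw [act_flagIf_args hM hA i hx.1]
  exact ket_mem_supported ⟨j, hx.1.update_flg _ _, trivial⟩

theorem preserves_search (hM : IsMatrixOracle M U)
    (hA : A ∈ Matrix.unitaryGroup (K → Bool) ℂ) (v z : Fin n → ZMod p) (i : ℕ) :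
    Preserves U A (cleanAll v z fun _ : Fin (m + 1) → Bool => True)
      (search i : Circuit _ _ K) := by
  induction i with
  | zero => exact (preserves_searchPrep hM hA v z _).append (preserves_flagIf_args hM hA v z _)
  | succ i ih =>
    exact ih.append (((preserves_groverStep hM hA v z _).rep _).append
      (preserves_flagIf_args hM hA v z _))

theorem preserves_amplified (hM : IsMatrixOracle M U)
    (hA : A ∈ Matrix.unitaryGroup (K → Bool) ℂ) (v z : Fin n → ZMod p) (k : ℕ) :
    Preserves U A (cleanAll v z fun _ : Fin (m + 1) → Bool => True)
      (amplified k : Circuit _ _ K) := by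
  induction k with
  | zero => exact preserves_search hM hA v z m
  | succ k ih =>
    refine (ih.append ?_).append (((ih.inv hM.1 hA).append ?_).append ih)
    · exact preserves_of_smul fun x ⟨j, hx⟩ => ⟨_, act_zeroPhase_flags hM hA _ hx.1⟩
    · exact preserves_of_smul fun x ⟨j, hx⟩ => ⟨_, act_ctrlPhase_args_flags hM hA _ hx.1⟩

/-- The part of the state to be searched that looks correct. -/
def unflagged (U : QOp (OracleReg n p)) (A : QOp K) (v z : Fin n → ZMod p) :
    QState (SubReg n p m) :=
  argZero.indicator (act U A (searchPrep : Circuit _ _ K) (ket (cfg v z 0 zeros zeros)))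

theorem unflagged_mem (hM : IsMatrixOracle M U)
    (hA : A ∈ Matrix.unitaryGroup (K → Bool) ℂ) (v z : Fin n → ZMod p) :
    unflagged U A v z ∈ supported (cleanAll v z (fun f : Fin (m + 1) → Bool => f = zeros) ∩
      argZero) :=
  indicator_mem_supported _ (preserves_searchPrep hM hA v z _ _ ⟨0, isClean_cfg _ _ _ _ _, rfl⟩)

theorem act_flagIf_of_argZero (hM : IsMatrixOracle M U)
    (hA : A ∈ Matrix.unitaryGroup (K → Bool) ℂ) {v z : Fin n → ZMod p} (i : Fin (m + 1))
    {P : (Fin (m + 1) → Bool) → Prop} {x : SubReg n p m → Bool} (hx : x ∈ cleanAll v z P ∩ argZero) :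
    act U A (flagIf chain args (flg i) : Circuit _ _ K) (ket x) = (1 : ℂ) • ket x := by
  obtain ⟨⟨j, hx⟩, h⟩ := hx
  rw [act_flagIf_args hM hA i hx.1, one_smul, decide_eq_true (fun b => h b), Bool.not_true,
    Bool.xor_false, Function.update_eq_self]

theorem act_flagIf_of_not_argZero (hM : IsMatrixOracle M U)
    (hA : A ∈ Matrix.unitaryGroup (K → Bool) ℂ) {v z : Fin n → ZMod p} {i : Fin (m + 1)}
    {k : ℕ} (hk : i.val ≤ k) {x : SubReg n p m → Bool}
    (hx : x ∈ cleanAll v z (fun f => f = zeros) ∩ argZeroᶜ) :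
    act U A (flagIf chain args (flg i) : Circuit _ _ K) (ket x) ∈
      supported (cleanAll v z fun f => ∃ l : Fin (m + 1), l.val ≤ k ∧ f l = true) := by
  obtain ⟨⟨j, hx⟩, h⟩ := hx
  rw [act_flagIf_args hM hA i hx.1, decide_eq_false (p := ∀ b, x (arg b) = false) h]
  refine ket_mem_supported ⟨j, hx.1.update_flg _ _, i, hk, ?_⟩
  have : x (flg i) = false := congrFun hx.2 i
  simp [this]

/-- A flag once set is never lost, because every later stage flips only a flag of larger index,
whatever the argument register contains. -/
theorem act_flagIf_of_flagged (hM : IsMatrixOracle M U)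
    (hA : A ∈ Matrix.unitaryGroup (K → Bool) ℂ) {v z : Fin n → ZMod p} {i : Fin (m + 1)}
    {k : ℕ} (hk : k < i.val) {x : SubReg n p m → Bool}
    (hx : x ∈ cleanAll v z fun f => ∃ l : Fin (m + 1), l.val ≤ k ∧ f l = true) :
    act U A (flagIf chain args (flg i) : Circuit _ _ K) (ket x) ∈
      supported (cleanAll v z fun f => ∃ l : Fin (m + 1), l.val ≤ k + 1 ∧ f l = true) := by
  obtain ⟨j, hx, l, hl, hfl⟩ := hx
  rw [act_flagIf_args hM hA i hx]
  refine ket_mem_supported ⟨j, hx.update_flg _ _, l, by omega, ?_⟩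
  change Function.update x (flg i) _ (flg l) = true
  rw [Function.update_of_ne]
  · exact hfl
  intro h
  simp only [Sum.inr.injEq, Sum.inl.injEq] at h
  rw [h] at hl
  omega

theorem act_groverStep (hM : IsMatrixOracle M U)
    (hA : A ∈ Matrix.unitaryGroup (K → Bool) ℂ) (v z : Fin n → ZMod p) {θ : ℝ}
    (hθ : Real.cos θ ^ 2 = normSq (unflagged U A v z : QState (SubReg n p m))) (r : ℕ) :
    ∃ y : ℂ, act U A (rep groverStep r : Circuit _ _ K)
      (unflagged U A v z : QState (SubReg n p m)) =
      (Real.cos (2 * r * θ) : ℂ) • unflagged U A v z +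
        y • argZeroᶜ.indicator
          (act U A (searchPrep : Circuit _ _ K) (ket (cfg v z 0 zeros zeros))) := by
  refine act_rep_grover hM.1 hA (S := cleanAll v z fun f : Fin (m + 1) → Bool => f = zeros)
    ⟨0, isClean_cfg _ _ _ _ _, rfl⟩ (preserves_searchPrep hM hA v z _) ?_ ?_ ?_ hθ r
  · rintro x ⟨j, hx, hf⟩
    rw [act_ctrlPhase_args hM hA _ hx, Complex.exp_pi_mul_I, hf]
    rfl
  · rintro x ⟨⟨j, hx⟩, h⟩
    rw [act_zeroPhase_args hM hA _ hx.1, if_pos (show ∀ b, x (arg b) = false from h), Complex.exp_pi_mul_I]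
  · rintro x ⟨⟨j, hx⟩, h⟩
    rw [act_zeroPhase_args hM hA _ hx.1, if_neg (show ¬ ∀ b, x (arg b) = false from h)]

/-- Stage `l` multiplies the unflagged branch by cos(2 · 2^l θ) and sends the rest to a fresh flag.
Strings with a flag are orthogonal to it and never return, so the factors simply multiply. -/
theorem act_search (hM : IsMatrixOracle M U)
    (hA : A ∈ Matrix.unitaryGroup (K → Bool) ℂ) (v z : Fin n → ZMod p) {θ : ℝ}
    (hθ : Real.cos θ ^ 2 = normSq (unflagged U A v z : QState (SubReg n p m))) (i : ℕ)
    (hi : i ≤ m) :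
    ∃ ρ ∈ supported (cleanAll v z fun f => ∃ l : Fin (m + 1), l.val ≤ i ∧ f l = true),
      act U A (search i : Circuit _ _ K) (ket (cfg v z 0 zeros zeros)) =
        ((∏ l ∈ Finset.range i, Real.cos (2 ^ l * (2 * θ)) : ℝ) : ℂ) • unflagged U A v z + ρ := by
  set Φ : QState (SubReg n p m) :=
    act U A (searchPrep : Circuit _ _ K) (ket (cfg v z 0 zeros zeros)) with hΦ
  have hB := unflagged_mem (m := m) hM hA v z
  have hG : argZeroᶜ.indicator Φ ∈
      supported (cleanAll v z (fun f : Fin (m + 1) → Bool => f = zeros) ∩ argZeroᶜ) :=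
    indicator_mem_supported _ (preserves_searchPrep hM hA v z _ _ ⟨0, isClean_cfg _ _ _ _ _, rfl⟩)
  induction i with
  | zero =>
    refine ⟨act U A (flagIf chain args (flg 0) : Circuit _ _ K) (argZeroᶜ.indicator Φ),
      map_mem_of_supported _ (fun x hx => act_flagIf_of_not_argZero hM hA (by simp) hx) hG, ?_⟩
    have hΦ' : Φ = unflagged U A v z + argZeroᶜ.indicator Φ :=
      (Set.indicator_self_add_compl argZero Φ).symm
    rw [search, act_append, ← hΦ]
    conv_lhs => rw [hΦ']
    rw [map_add, act_diag (μ := fun _ => 1) (fun x hx => act_flagIf_of_argZero hM hA 0 hx) hB]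
    simp
  | succ i ih =>
    obtain ⟨ρ, hρ, h⟩ := ih (by omega)
    obtain ⟨y, hy⟩ := act_groverStep (m := m) hM hA v z hθ (2 ^ i)
    -- No wrap-around: `i + 1 ≤ m`, so the new flag really has a larger index than all flags used
    -- before.
    have hval : (Fin.ofNat (m + 1) (i + 1)).val = i + 1 := by
      rw [Fin.val_ofNat, Nat.mod_eq_of_lt (by omega)]
    obtain ⟨ρ', hρ', h'⟩ := act_round (U := U) (A := A)
      (T := cleanAll v z fun f => ∃ l : Fin (m + 1), l.val ≤ i ∧ f l = true)
      (T' := cleanAll v z fun f => ∃ l : Fin (m + 1), l.val ≤ i + 1 ∧ f l = true)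
      (F := flagIf chain args (flg (Fin.ofNat _ (i + 1))))
      (κ := ((∏ l ∈ Finset.range i, Real.cos (2 ^ l * (2 * θ)) : ℝ) : ℂ)) hB hG
      (preserves_groverStep hM hA v z _) hy (fun x hx => act_flagIf_of_argZero hM hA _ hx)
      (fun x hx => act_flagIf_of_not_argZero hM hA hval.le hx)
      (fun x hx => act_flagIf_of_flagged hM hA (by omega) hx) hρ
    refine ⟨ρ', hρ', ?_⟩
    rw [search, act_append, h, h', Finset.prod_range_succ]
    push_cast
    congr 4
    ring_nf

/-- The bit strings without a flag. -/
def flagZero : Set (SubReg n p m → Bool) := {x | ∀ i, x (flg i) = false}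

/-- The remainder `ρ` always has a flag, and the unflagged vector has none, so the projection keeps
exactly the cosine multiple. -/
theorem normSq_flagZero_search (hM : IsMatrixOracle M U)
    (hA : A ∈ Matrix.unitaryGroup (K → Bool) ℂ) (v z : Fin n → ZMod p) {θ : ℝ}
    (hθ : Real.cos θ ^ 2 = normSq (unflagged U A v z : QState (SubReg n p m))) :
    normSq (flagZero.indicator
      (act U A (search m : Circuit (SubReg n p m) _ K) (ket (cfg v z 0 zeros zeros)))) =
      Real.cos θ ^ 2 * (∏ l ∈ Finset.range m, Real.cos (2 ^ l * (2 * θ))) ^ 2 := by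
  obtain ⟨ρ, hρ, h⟩ := act_search (m := m) hM hA v z hθ m le_rfl
  have hB := unflagged_mem (m := m) hM hA v z
  have hind : flagZero.indicator (act U A (search m : Circuit (SubReg n p m) _ K)
      (ket (cfg v z 0 zeros zeros))) =
      ((∏ l ∈ Finset.range m, Real.cos (2 ^ l * (2 * θ)) : ℝ) : ℂ) • unflagged U A v z := by
    rw [h]
    funext x
    by_cases hx : x ∈ flagZero
    · rw [Set.indicator_of_mem hx, Pi.add_apply, hρ x, add_zero]
      rintro ⟨j, -, l, -, hl⟩
      change x (flg l) = true at hl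
      rw [hx l] at hl
      cases hl
    · rw [Set.indicator_of_notMem hx, Pi.smul_apply, hB x, smul_zero]
      rintro ⟨⟨j, -, hf⟩, -⟩
      exact hx fun i => congrFun hf i
  rw [hind, normSq_smul, ← hθ, Complex.norm_real, Real.norm_eq_abs, sq_abs, mul_comm]

/-- Each level applies the fixed-point step to the whole previous circuit, with the absence of flags
as the bad event. -/
theorem normSq_flagZero_amplified (hM : IsMatrixOracle M U)
    (hA : A ∈ Matrix.unitaryGroup (K → Bool) ℂ) (v z : Fin n → ZMod p) (k : ℕ) :
    normSq (flagZero.indicator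
      (act U A (amplified k : Circuit (SubReg n p m) _ K) (ket (cfg v z 0 zeros zeros)))) =
      normSq (flagZero.indicator (act U A (search m : Circuit (SubReg n p m) _ K)
        (ket (cfg v z 0 zeros zeros)))) ^ 3 ^ k := by
  induction k with
  | zero => rw [pow_zero, pow_one]; rfl
  | succ k ih =>
    rw [pow_succ, pow_mul, ← ih, amplified]
    refine normSq_indicator_fixedPoint hM.1 hA
      (S := cleanAll v z fun _ : Fin (m + 1) → Bool => True) ⟨0, isClean_cfg _ _ _ _ _, trivial⟩
      (preserves_amplified hM hA v z k) ?_ ?_ ?_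
    · rintro x ⟨j, hx⟩
      exact act_ctrlPhase_args_flags hM hA _ hx.1
    · rintro x ⟨⟨j, hx⟩, h⟩
      rw [act_zeroPhase_flags hM hA _ hx.1, if_pos (show ∀ i, x (flg i) = false from h)]
    · rintro x ⟨⟨j, hx⟩, h⟩
      rw [act_zeroPhase_flags hM hA _ hx.1, if_neg (show ¬ ∀ i, x (flg i) = false from h)]

/-- The probability that the search sets no flag. -/
def missProb (U : QOp (OracleReg n p)) (A : QOp K) (m : ℕ) (v z : Fin n → ZMod p) : ℝ :=
  normSq (flagZero.indicator
      (act U A (search m : Circuit (SubReg n p m) _ K) (ket (cfg v z 0 zeros zeros))))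

theorem missProb_nonneg (v z : Fin n → ZMod p) : 0 ≤ missProb U A m v z := normSq_nonneg _

/-! ### Miss probabilities for correct and for wrong outputs. -/

theorem normSq_unflagged (hM : IsMatrixOracle M U)
    (hA : A ∈ Matrix.unitaryGroup (K → Bool) ℂ) (v z : Fin n → ZMod p) :
    normSq (unflagged U A v z : QState (SubReg n p m)) =
      (∑ j, ‖overlap p (rowError M v z j)‖ ^ 2) / n :=
  normSq_argZero_searchPrep hM hA v z zeros

/-- All row overlaps are exactly 1, so θ = 0 and every cosine is 1: the test has one-sided error. -/
theorem missProb_correct (hM : IsMatrixOracle M U)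
    (hA : A ∈ Matrix.unitaryGroup (K → Bool) ℂ) (v : Fin n → ZMod p) :
    missProb U A m v (M *ᵥ v) = 1 := by
  have h : normSq (unflagged U A v (M *ᵥ v) : QState (SubReg n p m)) = 1 := by
    rw [normSq_unflagged hM hA,
      Finset.sum_congr rfl fun j _ => by rw [overlap_eq_one ((dvd_rowError_iff M v _ j).2 rfl)]]
    have : (n : ℝ) ≠ 0 := Nat.cast_ne_zero.2 (NeZero.ne n)
    simp [this]
  rw [missProb, normSq_flagZero_search (θ := 0) hM hA v _ (by rw [h]; simp)]
  simp

theorem missProb_wrong (hM : IsMatrixOracle M U)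
    (hA : A ∈ Matrix.unitaryGroup (K → Bool) ℂ) {v z : Fin n → ZMod p} (hz : z ≠ M *ᵥ v)
    (hm : n ≤ 4 ^ m) : missProb U A m v z ≤ 1 / 3 := by
  have hn : (0 : ℝ) < n := Nat.cast_pos.2 (NeZero.pos n)
  have hm' : (n : ℝ) ≤ 4 ^ m := by exact_mod_cast hm
  obtain ⟨j, hj⟩ := Function.ne_iff.1 hz
  -- The wrong row `j` contributes at most 1/4, every other row at most 1.
  have hsum : ∑ i, ‖overlap p (rowError M v z i)‖ ^ 2 ≤ n - 3 / 4 := by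
    rw [← Finset.add_sum_erase _ _ (Finset.mem_univ j)]
    have h1 : ‖overlap p (rowError M v z j)‖ ^ 2 ≤ 1 / 4 := by
      have := norm_overlap_le_half (mt (dvd_rowError_iff M v z j).1 hj)
      nlinarith [norm_nonneg (overlap p (rowError M v z j))]
    have h2 : ∑ i ∈ Finset.univ.erase j, ‖overlap p (rowError M v z i)‖ ^ 2 ≤ n - 1 := by
      refine (Finset.sum_le_card_nsmul _ _ 1 fun i _ =>
        pow_le_one₀ (norm_nonneg _) (norm_overlap_le_one _ _)).trans ?_
      rw [Finset.card_erase_of_mem (Finset.mem_univ _), Finset.card_univ, Fintype.card_fin,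
        nsmul_eq_mul, mul_one, Nat.cast_sub (NeZero.pos n)]
      simp
    linarith
  set c := normSq (unflagged U A v z : QState (SubReg n p m)) with hc
  have hc0 : 0 ≤ c := normSq_nonneg _
  have hcn : c * n ≤ n - 3 / 4 := by
    rw [hc, normSq_unflagged hM hA, div_mul_cancel₀ _ hn.ne']
    exact hsum
  have hc1 : c ≤ 1 := by
    by_contra h
    nlinarith
  have hθ : Real.cos (Real.arccos √c) ^ 2 = c := by
    rw [Real.cos_arccos (by linarith [Real.sqrt_nonneg c]) (Real.sqrt_le_one.2 hc1),
      Real.sq_sqrt hc0]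
  rw [missProb, normSq_flagZero_search hM hA v z hθ]
  set θ := Real.arccos √c
  have hv := two_pow_mul_sin_mul_prod_cos m (2 * θ)
  set q := ∏ l ∈ Finset.range m, Real.cos (2 ^ l * (2 * θ))
  -- The product is a single sine divided by 2^m sin 2θ. The factor cos θ in sin 2θ = 2 sin θ cos θ
  -- is the amplitude from the first flag, so the bound degenerates only as sin θ → 0.
  have h1 : (2 ^ m * Real.sin (2 * θ) * q) ^ 2 ≤ 1 := by
    rw [hv]
    exact Real.sin_sq_le_one _
  have h4 : (2 ^ m : ℝ) ^ 2 = 4 ^ m := by rw [← pow_mul, mul_comm, pow_mul]; norm_num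
  rw [Real.sin_two_mul] at h1
  have h2 : (2 ^ m * (2 * Real.sin θ * Real.cos θ) * q) ^ 2 =
      4 ^ m * (4 * (1 - c)) * (Real.cos θ ^ 2 * q ^ 2) := by
    rw [← h4, ← hθ, ← Real.sin_sq]
    ring
  rw [h2] at h1
  have h3 : 3 ≤ 4 ^ m * (4 * (1 - c)) := by
    have : (n : ℝ) * (4 * (1 - c)) ≤ 4 ^ m * (4 * (1 - c)) :=
      mul_le_mul_of_nonneg_right hm' (by linarith)
    linarith
  have h5 : 0 ≤ Real.cos θ ^ 2 * q ^ 2 := by positivity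
  nlinarith

/-- The bit strings that hold `v` and `z`. -/
def holding (v z : Fin n → ZMod p) : Set (SubReg n p m → Bool) :=
  {x | (∀ q, x (vIn q) = encVec v q) ∧ ∀ q, x (vOut q) = encVec z q}

/-- The final state of the verification circuit. -/
def verified (U : QOp (OracleReg n p)) (A : QOp K) (m k : ℕ) (v z : Fin n → ZMod p) :
    QState (SubReg n p m) :=
  act U A (verifier k : Circuit _ _ K) (tensor (ket (encVec v)) (tensor (ket (encVec z)) (ket zeros)))

/-- The first NOT gate turns the all-zero ancillas into the one-hot encoding of index zero, the
starting string of the search. -/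
theorem verified_eq (v z : Fin n → ZMod p) (k : ℕ) :
    verified U A m k v z = act U A (flagIf chain flags fin : Circuit _ _ K)
      (act U A (amplified k : Circuit _ _ K) (ket (cfg v z 0 zeros zeros))) := by
  rw [verified, tensor_ket, tensor_ket, verifier, act_append, act_append, act_xGate]
  congr 3
  funext w
  rcases w with q | q | i | b | b | b | b | i | i | ⟨⟩
  all_goals first | rfl | skip
  change Function.update (Sum.elim (encVec v) (Sum.elim (encVec z) zeros)) (hot 0) true (hot i) =
    decide (i = 0)
  by_cases hi : i = 0
  · subst hi
    simp
  · rw [Function.update_of_ne (by simp [hi]), decide_eq_false hi]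
    rfl

theorem verified_mem (hM : IsMatrixOracle M U)
    (hA : A ∈ Matrix.unitaryGroup (K → Bool) ℂ) (v z : Fin n → ZMod p) (k : ℕ) :
    verified U A m k v z ∈ supported (holding v z) := by
  rw [verified_eq]
  refine map_mem_of_supported _ ?_ (preserves_amplified hM hA v z k _
    ⟨0, isClean_cfg _ _ _ _ _, trivial⟩)
  rintro x ⟨j, hx⟩
  rw [act_flagIf_flags hM hA hx.1]
  refine ket_mem_supported ⟨fun q => ?_, fun q => ?_⟩
  · rw [Function.update_of_ne (by simp), hx.1.vIn]
  · rw [Function.update_of_ne (by simp), hx.1.vOut]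

theorem normSq_verified (hM : IsMatrixOracle M U)
    (hA : A ∈ Matrix.unitaryGroup (K → Bool) ℂ) (v z : Fin n → ZMod p) (k : ℕ) :
    normSq (verified U A m k v z) = 1 := by
  rw [verified_eq, normSq_act hM.1 hA, normSq_act hM.1 hA, normSq_ket]

/-- The last circuit fixes the branch without flags, where the final flag is zero, and sends the
other branch to final flag one; so the final flag reads zero exactly with the amplified miss
probability. -/
theorem normSq_verified_unflagged (hM : IsMatrixOracle M U)
    (hA : A ∈ Matrix.unitaryGroup (K → Bool) ℂ) (v z : Fin n → ZMod p) (k : ℕ) :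
    normSq ({x | x fin = false}.indicator (verified U A m k v z)) = missProb U A m v z ^ 3 ^ k := by
  rw [missProb, ← normSq_flagZero_amplified hM hA, verified_eq]
  set ψ := act U A (amplified k : Circuit (SubReg n p m) _ K) (ket (cfg v z 0 zeros zeros)) with hψ
  have hmem : ψ ∈ supported (cleanAll v z fun _ : Fin (m + 1) → Bool => True) :=
    preserves_amplified hM hA v z k _ ⟨0, isClean_cfg _ _ _ _ _, trivial⟩
  have hB := indicator_mem_supported flagZero hmem
  have hG := indicator_mem_supported flagZeroᶜ hmem
  have hFB : act U A (flagIf chain flags fin : Circuit _ _ K) (flagZero.indicator ψ) =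
      flagZero.indicator ψ := by
    rw [act_diag (μ := fun _ => 1) _ hB]
    · simp
    · rintro x ⟨⟨j, hx⟩, h⟩
      rw [act_flagIf_flags hM hA hx.1, decide_eq_true (fun i => h i), one_smul, Bool.not_true,
        ← hx.1.fin, Function.update_eq_self]
  have hFG : act U A (flagIf chain flags fin : Circuit _ _ K) (flagZeroᶜ.indicator ψ) ∈
      supported {x | x fin = true} := by
    refine map_mem_of_supported _ ?_ hG
    rintro x ⟨⟨j, hx⟩, h⟩
    rw [act_flagIf_flags hM hA hx.1, decide_eq_false (p := ∀ i, x (flg i) = false) h]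
    exact ket_mem_supported (by simp)
  have hsplit : act U A (flagIf chain flags fin : Circuit _ _ K) ψ = flagZero.indicator ψ +
      act U A (flagIf chain flags fin : Circuit _ _ K) (flagZeroᶜ.indicator ψ) := by
    conv_lhs => rw [← Set.indicator_self_add_compl flagZero ψ, map_add, hFB]
  rw [hsplit]
  congr 1
  funext x
  by_cases hx : x fin = false
  · rw [Set.indicator_of_mem (by exact hx), Pi.add_apply, hFG x (by simp [hx]), add_zero]
  · rw [Set.indicator_of_notMem (by exact hx), hB x]
    rintro ⟨⟨j, h⟩, -⟩
    exact hx h.1.fin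

end Verify

/-! ### Resources of the verification circuit -/

section Resources

variable {n p m : ℕ} {K : Type} [Fintype K] [DecidableEq K]

theorem gates_rowLoad_le :
    (rowLoad : Circuit (SubReg n p m) (OracleReg n p) K).gates ≤ n * Nat.clog 2 n := by
  refine (gates_forAll_le _ 1 fun q => ?_).trans (by simp)
  split_ifs
  exacts [gates_gateTwo_le _ _ _, by simp]

theorem gates_entryLoad_le (k : Fin n) :
    (entryLoad k : Circuit (SubReg n p m) (OracleReg n p) K).gates ≤ Nat.clog 2 n := by
  have h : (colLoad k : Circuit (SubReg n p m) (OracleReg n p) K).gates ≤ Nat.clog 2 n := by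
    refine (gates_forAll_le _ 1 fun q => ?_).trans (by simp)
    split_ifs
    exacts [gates_gateOne_le _ _, by simp]
  rw [entryLoad, gates_append]
  exact h

theorem gates_entryPhases_le (k : Fin n) :
    (entryPhases k : Circuit (SubReg n p m) (OracleReg n p) K).gates ≤ 5 * Nat.clog 2 p ^ 3 :=
  (gates_forAll_le _ 5 fun _ => gates_ccp_le _ _ _ _).trans
    (le_of_eq (by simp only [Fintype.card_prod, Fintype.card_fin]; ring))

theorem gates_outPhases_le :
    (outPhases : Circuit (SubReg n p m) (OracleReg n p) K).gates ≤
      n * (5 * Nat.clog 2 p ^ 2) := by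
  refine (gates_forAll_le _ (5 * Nat.clog 2 p ^ 2) fun _ => ?_).trans (by simp)
  exact (gates_forAll_le _ 5 fun _ => gates_ccp_le _ _ _ _).trans
    (le_of_eq (by simp only [Fintype.card_prod, Fintype.card_fin]; ring))

theorem gates_rowPhase_le :
    (rowPhase : Circuit (SubReg n p m) (OracleReg n p) K).gates ≤
      n * (4 * Nat.clog 2 n + 5 * Nat.clog 2 p ^ 3 + 5 * Nat.clog 2 p ^ 2) := by
  have h1 := gates_rowLoad_le (n := n) (p := p) (m := m) (K := K)
  have h2 := gates_outPhases_le (n := n) (p := p) (m := m) (K := K)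
  have h3 : (forAll fun k => Circuit.conj (entryLoad k) (entryPhases k) :
      Circuit (SubReg n p m) (OracleReg n p) K).gates ≤
      n * (2 * Nat.clog 2 n + 5 * Nat.clog 2 p ^ 3) := by
    refine (gates_forAll_le _ (2 * Nat.clog 2 n + 5 * Nat.clog 2 p ^ 3) fun k => ?_).trans (by simp)
    have := gates_entryLoad_le (p := p) (m := m) (K := K) k
    have := gates_entryPhases_le (p := p) (m := m) (K := K) k
    simp only [Circuit.conj, gates_append, gates_inv]
    omega
  simp only [rowPhase, Circuit.conj, gates_append, gates_inv] at h3 ⊢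
  calc _ ≤ n * Nat.clog 2 n + n * (2 * Nat.clog 2 n + 5 * Nat.clog 2 p ^ 3) + n * Nat.clog 2 n +
        n * (5 * Nat.clog 2 p ^ 2) := by gcongr
    _ = _ := by ring

theorem queries_rowLoad :
    (rowLoad : Circuit (SubReg n p m) (OracleReg n p) K).queries = 0 := by
  refine Nat.le_zero.1 ((queries_forAll_le _ 0 fun q => ?_).trans (by simp))
  split_ifs
  exacts [(queries_gateTwo _ _ _).le, by simp]

theorem queries_entryLoad (k : Fin n) :
    (entryLoad k : Circuit (SubReg n p m) (OracleReg n p) K).queries = 1 := by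
  have h : (colLoad k : Circuit (SubReg n p m) (OracleReg n p) K).queries = 0 := by
    refine Nat.le_zero.1 ((queries_forAll_le _ 0 fun q => ?_).trans (by simp))
    split_ifs
    exacts [(queries_gateOne _ _).le, by simp]
  rw [entryLoad, queries_append, h]
  rfl

theorem queries_rowPhase_le :
    (rowPhase : Circuit (SubReg n p m) (OracleReg n p) K).queries ≤ 2 * n := by
  have h1 (k : Fin n) : (entryPhases k : Circuit (SubReg n p m) (OracleReg n p) K).queries = 0 :=
    Nat.le_zero.1 ((queries_forAll_le _ 0 fun q => by simp).trans (by simp))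
  have h2 : (outPhases : Circuit (SubReg n p m) (OracleReg n p) K).queries = 0 :=
    Nat.le_zero.1 ((queries_forAll_le _ 0 fun q =>
      (queries_forAll_le _ 0 fun q => by simp).trans (by simp)).trans (by simp))
  have h3 : (forAll fun k => Circuit.conj (entryLoad k) (entryPhases k) :
      Circuit (SubReg n p m) (OracleReg n p) K).queries ≤ n * 2 := by
    refine (queries_forAll_le _ 2 fun k => ?_).trans (by simp)
    simp [Circuit.conj, queries_entryLoad, h1]
  simp only [rowPhase, Circuit.conj, queries_append, queries_inv, queries_rowLoad, h2] at h3 ⊢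
  omega

theorem calls_rowPhase :
    (rowPhase : Circuit (SubReg n p m) (OracleReg n p) K).calls = 0 := by
  have h1 : (rowLoad : Circuit (SubReg n p m) (OracleReg n p) K).calls = 0 :=
    calls_forAll _ fun q => by split_ifs <;> simp [cx]
  have h2 (k : Fin n) : (colLoad k : Circuit (SubReg n p m) (OracleReg n p) K).calls = 0 :=
    calls_forAll _ fun q => by split_ifs <;> simp
  have h3 (k : Fin n) : (entryLoad k : Circuit (SubReg n p m) (OracleReg n p) K).calls = 0 := by
    rw [entryLoad, calls_append, h2]
    rfl
  have h4 (k : Fin n) : (entryPhases k : Circuit (SubReg n p m) (OracleReg n p) K).calls = 0 :=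
    calls_forAll _ fun q => by simp
  have h5 : (outPhases : Circuit (SubReg n p m) (OracleReg n p) K).calls = 0 :=
    calls_forAll _ fun q => calls_forAll _ fun q => by simp
  have h6 : (forAll fun k => Circuit.conj (entryLoad k) (entryPhases k) :
      Circuit (SubReg n p m) (OracleReg n p) K).calls = 0 :=
    calls_forAll _ fun k => by simp [Circuit.conj, h3, h4]
  simp only [rowPhase, Circuit.conj, calls_append, calls_inv, h1, h5] at h6 ⊢
  omega

theorem gates_rep (c : Circuit (SubReg n p m) (OracleReg n p) K) (r : ℕ) :
    (rep c r).gates = r * c.gates := by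
  induction r with
  | zero => simp [rep]
  | succ r ih => rw [rep, gates_append, ih, add_mul, one_mul]

theorem queries_rep (c : Circuit (SubReg n p m) (OracleReg n p) K) (r : ℕ) :
    (rep c r).queries = r * c.queries := by
  induction r with
  | zero => simp [rep]
  | succ r ih => rw [rep, queries_append, ih, add_mul, one_mul]

theorem calls_rep (c : Circuit (SubReg n p m) (OracleReg n p) K) (r : ℕ) :
    (rep c r).calls = r * c.calls := by
  induction r with
  | zero => simp [rep]
  | succ r ih => rw [rep, calls_append, ih, add_mul, one_mul]

variable [NeZero n]

theorem gates_spread_le (k : ℕ) :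
    (spread k : Circuit (SubReg n p m) (OracleReg n p) K).gates ≤ k := by
  induction k with
  | zero => simp [spread]
  | succ k ih =>
    rw [spread, gates_append]
    refine add_le_add ih ?_
    split_ifs
    exacts [gates_gateTwo_le _ _ _, by simp]

theorem queries_spread (k : ℕ) :
    (spread k : Circuit (SubReg n p m) (OracleReg n p) K).queries = 0 := by
  induction k with
  | zero => simp [spread]
  | succ k ih =>
    rw [spread, queries_append, ih, zero_add]
    split_ifs
    exacts [queries_gateTwo _ _ _, by simp]

theorem calls_spread (k : ℕ) :
    (spread k : Circuit (SubReg n p m) (OracleReg n p) K).calls = 0 := by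
  induction k with
  | zero => simp [spread]
  | succ k ih =>
    rw [spread, calls_append, ih, zero_add]
    split_ifs
    exacts [calls_gateTwo _ _ _, by simp]

theorem queries_searchPrep_le :
    (searchPrep : Circuit (SubReg n p m) (OracleReg n p) K).queries ≤ 2 * n := by
  have h1 : (hadArgs : Circuit (SubReg n p m) (OracleReg n p) K).queries = 0 :=
    Nat.le_zero.1 ((queries_forAll_le _ 0 fun q => by simp).trans (by simp))
  have h2 := queries_rowPhase_le (n := n) (p := p) (m := m) (K := K)
  simp only [searchPrep, Circuit.conj, queries_append, queries_inv, queries_spread, h1]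
  omega

theorem calls_searchPrep :
    (searchPrep : Circuit (SubReg n p m) (OracleReg n p) K).calls = 0 := by
  have h1 : (hadArgs : Circuit (SubReg n p m) (OracleReg n p) K).calls = 0 :=
    calls_forAll _ fun q => by simp
  simp [searchPrep, Circuit.conj, calls_spread, h1, calls_rowPhase]

/-- A preparation costs 2n queries and a Grover step 4n. The Grover steps double from stage to
stage, so the search costs at most 2^m · 4n; each amplification level triples this. -/
theorem queries_verifier_le (k : ℕ) :
    (verifier k : Circuit (SubReg n p m) (OracleReg n p) K).queries ≤ 3 ^ k * (2 ^ m * (4 * n)) := by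
  have h1 := queries_searchPrep_le (n := n) (p := p) (m := m) (K := K)
  have h2 : (groverStep : Circuit (SubReg n p m) (OracleReg n p) K).queries ≤ 4 * n := by
    simp only [groverStep, queries_append, queries_inv, queries_zeroPhase, queries_ctrlPhase]
    omega
  have h3 (i : ℕ) : (search i : Circuit (SubReg n p m) (OracleReg n p) K).queries ≤
      2 ^ i * (4 * n) := by
    induction i with
    | zero =>
      simp only [search, queries_append, queries_flagIf]
      omega
    | succ i ih =>
      simp only [search, queries_append, queries_flagIf, queries_rep, pow_succ]
      have := Nat.mul_le_mul_left (2 ^ i) h2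
      rw [mul_right_comm]
      omega
  have h4 (k : ℕ) : (amplified k : Circuit (SubReg n p m) (OracleReg n p) K).queries ≤
      3 ^ k * (2 ^ m * (4 * n)) := by
    induction k with
    | zero => simpa [amplified] using h3 m
    | succ k ih =>
      simp only [amplified, queries_append, queries_inv, queries_zeroPhase, queries_ctrlPhase,
        pow_succ]
      rw [mul_right_comm]
      omega
  simpa [verifier] using h4 k

theorem calls_verifier (k : ℕ) :
    (verifier k : Circuit (SubReg n p m) (OracleReg n p) K).calls = 0 := by
  have h2 : (groverStep : Circuit (SubReg n p m) (OracleReg n p) K).calls = 0 := by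
    simp [groverStep, calls_searchPrep]
  have h3 (i : ℕ) : (search i : Circuit (SubReg n p m) (OracleReg n p) K).calls = 0 := by
    induction i with
    | zero => simp [search, calls_searchPrep]
    | succ i ih => simp [search, calls_rep, h2, ih]
  have h4 (k : ℕ) : (amplified k : Circuit (SubReg n p m) (OracleReg n p) K).calls = 0 := by
    induction k with
    | zero => exact h3 m
    | succ k ih => simp [amplified, ih]
  simp [verifier, h4]

theorem gates_verifier_le (hp : 2 ≤ p) (k : ℕ) :
    (verifier k : Circuit (SubReg n p m) (OracleReg n p) K).gates ≤
      3 ^ k * (2 ^ m * (300 * (n * (Nat.clog 2 n + 1) * Nat.clog 2 p ^ 3))) := by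
  set L := Nat.clog 2 p with hL
  set N := Nat.clog 2 n with hN
  have hn : 1 ≤ n := NeZero.pos n
  have hL1 : 1 ≤ L := Nat.clog_pos one_lt_two hp
  set X := n * (N + 1) * L ^ 3 with hX
  have hL3 : 1 ≤ L ^ 3 := Nat.one_le_pow _ _ hL1
  have hX1 : n * L ^ 3 ≤ X := by
    rw [hX]
    exact Nat.mul_le_mul_right _ (Nat.le_mul_of_pos_right _ (by omega))
  have hX2 : n * N ≤ X := by
    rw [hX]
    calc n * N ≤ n * (N + 1) * 1 := by rw [mul_one]; gcongr; omega
      _ ≤ _ := by gcongr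
  have hX3 : n * L ^ 2 ≤ X := le_trans (by gcongr <;> omega) hX1
  have hX4 : n ≤ X := le_trans (by nlinarith) hX1
  have hX5 : L ≤ X := by
    refine le_trans ?_ hX1
    calc L = 1 * L ^ 1 := by ring
      _ ≤ n * L ^ 3 := by gcongr <;> omega
  -- 14 from the row phase, 2 from the two layers of Hadamard gates, 1 from the rotations.
  have hV : (searchPrep : Circuit (SubReg n p m) (OracleReg n p) K).gates ≤ 17 * X := by
    have h1 : (hadArgs : Circuit (SubReg n p m) (OracleReg n p) K).gates ≤ L := by
      refine (gates_forAll_le _ 1 fun q => gates_had_le _).trans (by simp [hL])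
    have h2 := gates_rowPhase_le (n := n) (p := p) (m := m) (K := K)
    have h3 := gates_spread_le (n := n) (p := p) (m := m) (K := K) (n - 1)
    rw [← hL, ← hN] at h2
    have h4 : n * (4 * N + 5 * L ^ 3 + 5 * L ^ 2) =
      4 * (n * N) + 5 * (n * L ^ 3) + 5 * (n * L ^ 2) := by ring
    simp only [searchPrep, Circuit.conj, gates_append, gates_inv]
    omega
  have hF (i : Fin (m + 1)) :
      (flagIf chain args (flg i) : Circuit (SubReg n p m) (OracleReg n p) K).gates ≤ 44 * X := by
    have := gates_flagIf_le (K₁ := OracleReg n p) (K₂ := K) chain args (flg i : SubReg n p m)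
    rw [length_args] at this
    omega
  have hQ : (groverStep : Circuit (SubReg n p m) (OracleReg n p) K).gates ≤ 96 * X := by
    have h1 := gates_zeroPhase_le (K₁ := OracleReg n p) (K₂ := K)
      (chain : ℕ → SubReg n p m) Real.pi args
    have h2 := gates_ctrlPhase_le (K₁ := OracleReg n p) (K₂ := K)
      (chain : ℕ → SubReg n p m) Real.pi (hot 0) args
    rw [length_args] at h1 h2
    simp only [groverStep, gates_append, gates_inv]
    omega
  -- 140 = 96 + 44 lets the cost of a new stage, at most (2^i · 96 + 44)X, fit under the doubling of
  -- the bound.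
  have hS (i : ℕ) : (search i : Circuit (SubReg n p m) (OracleReg n p) K).gates ≤
      2 ^ i * (140 * X) := by
    induction i with
    | zero =>
      have := hF 0
      simp only [search, gates_append]
      omega
    | succ i ih =>
      have h1 := hF (Fin.ofNat _ (i + 1))
      have h2 := Nat.mul_le_mul_left (2 ^ i) hQ
      have h3 : X ≤ 2 ^ i * X := Nat.le_mul_of_pos_left _ (by positivity)
      have h4 : 2 ^ (i + 1) * (140 * X) = 280 * (2 ^ i * X) := by ring
      have h5 : 2 ^ i * (140 * X) = 140 * (2 ^ i * X) := by ring
      have h6 : 2 ^ i * (96 * X) = 96 * (2 ^ i * X) := by ring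
      simp only [search, gates_append, gates_rep]
      omega
  set Y := 2 ^ m * X with hY
  have hm : m + 1 ≤ 2 ^ m := Nat.lt_two_pow_self
  have hmY : m + 1 ≤ Y := hm.trans (Nat.le_mul_of_pos_right _ (by omega))
  have hXY : X ≤ Y := Nat.le_mul_of_pos_left _ (by positivity)
  -- The extra summand `100 * Y` strengthens the induction: a level triples the count and adds at
  -- most `80 * Y`, which the tripled summand absorbs. At the end it also pays for the last flag.
  have hA (k : ℕ) : (amplified k : Circuit (SubReg n p m) (OracleReg n p) K).gates + 100 * Y ≤
      3 ^ k * (240 * Y) := by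
    induction k with
    | zero =>
      have h1 := hS m
      have h2 : 2 ^ m * (140 * X) = 140 * Y := by rw [hY]; ring
      simp only [amplified, pow_zero, one_mul]
      omega
    | succ k ih =>
      have h1 := gates_zeroPhase_le (K₁ := OracleReg n p) (K₂ := K)
        (chain : ℕ → SubReg n p m) (-(Real.pi / 3)) flags
      have h2 := gates_ctrlPhase_le (K₁ := OracleReg n p) (K₂ := K)
        (chain : ℕ → SubReg n p m) (Real.pi / 3) (hot 0) (args ++ flags)
      rw [length_flags] at h1
      rw [List.length_append, length_args, length_flags] at h2
      have h3 : 3 ^ (k + 1) * (240 * Y) = 3 * (3 ^ k * (240 * Y)) := by ring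
      simp only [amplified, gates_append, gates_inv]
      omega
  have h1 := gates_flagIf_le (K₁ := OracleReg n p) (K₂ := K) chain flags (fin : SubReg n p m)
  have h2 := gates_xGate_le (K₁ := OracleReg n p) (K₂ := K) (hot 0 : SubReg n p m)
  have h3 := hA k
  have h4 : 3 ^ k * (2 ^ m * (300 * X)) = 3 ^ k * (240 * Y) + 60 * (3 ^ k * Y) := by rw [hY]; ring
  rw [length_flags] at h1
  simp only [verifier, gates_append]
  omega

end Resources

/-! ### Relabelling of qubits -/

section Relabel

variable {W W' K₁ K₂ : Type} [Fintype W] [DecidableEq W] [Fintype W'] [DecidableEq W']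
  [Fintype K₁] [DecidableEq K₁] [Fintype K₂] [DecidableEq K₂]

/-- The step, on the wires given by an embedding. -/
def Instr.map (e : W ↪ W') : Instr W K₁ K₂ → Instr W' K₁ K₂
  | .gate1 e' G => .gate1 (e'.trans e) G
  | .gate2 e' G => .gate2 (e'.trans e) G
  | .query adj e' => .query adj (e'.trans e)
  | .call adj e' => .call adj (e'.trans e)

/-- The circuit, on the wires given by an embedding. -/
def Circuit.relabel (e : W ↪ W') (c : Circuit W K₁ K₂) : Circuit W' K₁ K₂ :=
  List.map (Instr.map e) c

theorem op_map (U : QOp K₁) (A : QOp K₂) (e : W ↪ W') (i : Instr W K₁ K₂) :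
    (i.map e).op U A = onWires e (i.op U A) := by
  cases i <;> simp [Instr.map, Instr.op, onWires_trans]

theorem eval_relabel (U : QOp K₁) (A : QOp K₂) (e : W ↪ W') (c : Circuit W K₁ K₂) :
    (c.relabel e).eval U A = onWires e (c.eval U A) := by
  induction c with
  | nil => exact (onWires_one e).symm
  | cons i c ih =>
    rw [Circuit.relabel] at ih ⊢
    rw [List.map_cons, Circuit.eval, ih, op_map, Circuit.eval, onWires_mul]

theorem countP_relabel (e : W ↪ W') (c : Circuit W K₁ K₂) {P : Instr W K₁ K₂ → Bool}
    {P' : Instr W' K₁ K₂ → Bool} (h : ∀ i, P' (i.map e) = P i) :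
    List.countP P' (c.relabel e) = List.countP P c := by
  rw [Circuit.relabel, List.countP_map]
  exact List.countP_congr fun i _ => by simp [h]

theorem gates_relabel (e : W ↪ W') (c : Circuit W K₁ K₂) : (c.relabel e).gates = c.gates :=
  countP_relabel e c (by rintro (_ | _ | _ | _) <;> rfl)

theorem queries_relabel (e : W ↪ W') (c : Circuit W K₁ K₂) : (c.relabel e).queries = c.queries :=
  countP_relabel e c (by rintro (_ | _ | _ | _) <;> rfl)

theorem calls_relabel (e : W ↪ W') (c : Circuit W K₁ K₂) : (c.relabel e).calls = c.calls :=
  countP_relabel e c (by rintro (_ | _ | _ | _) <;> rfl)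

/-- An operator on some qubits acts on a product state through the factor of these qubits. -/
theorem onWires_mulVec_mul {T : Type} (e : W ↪ W') (g : T → W') (hg : ∀ t w, e w ≠ g t)
    (G : QOp W) (φ : QState W) (w : QState T) :
    (onWires e G *ᵥ fun x => φ (x ∘ e) * w (x ∘ g)) = fun x => (G *ᵥ φ) (x ∘ e) * w (x ∘ g) := by
  funext x
  rw [onWires_mulVec]
  have h : ∀ y : W → Bool, Function.extend e y x ∘ g = x ∘ g := fun y => by
    funext t
    exact Function.extend_apply' _ _ _ fun ⟨w, hw⟩ => hg t w hw
  simp only [extend_comp_self, h, ← mul_assoc, ← Finset.sum_mul]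
  rfl

end Relabel

/-! ### Bounds on the parameters -/

theorem four_pow_clog_le {n : ℕ} (hn : 1 ≤ n) : 4 ^ Nat.clog 4 n ≤ 4 * n := by
  rcases hn.eq_or_lt with rfl | hn
  · simp
  · have h := Nat.pow_pred_clog_lt_self (b := 4) (by norm_num) hn
    obtain ⟨m, hm⟩ := Nat.exists_eq_succ_of_ne_zero (Nat.clog_pos (b := 4) (by norm_num) hn).ne'
    rw [hm] at h ⊢
    rw [Nat.pred_succ] at h
    rw [pow_succ]
    omega

theorem two_pow_clog_le {n : ℕ} (hn : 1 ≤ n) : (2 : ℝ) ^ Nat.clog 4 n ≤ 2 * √n := by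
  refine le_of_sq_le_sq ?_ (by positivity)
  rw [mul_pow, Real.sq_sqrt (Nat.cast_nonneg n), ← pow_mul, mul_comm, pow_mul]
  have : (4 : ℝ) ^ Nat.clog 4 n ≤ 4 * n := by exact_mod_cast four_pow_clog_le hn
  norm_num
  exact this

theorem three_pow_clog_le {t : ℕ} : (3 : ℝ) ^ Nat.clog 3 t ≤ max (1 : ℝ) (3 * t) := by
  rcases le_or_gt t 1 with ht | ht
  · rw [Nat.clog_of_right_le_one ht]
    simp
  · refine le_trans ?_ (le_max_right _ _)
    have h := Nat.pow_pred_clog_lt_self (b := 3) (by norm_num) ht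
    obtain ⟨m, hm⟩ := Nat.exists_eq_succ_of_ne_zero (Nat.clog_pos (b := 3) (by norm_num) ht).ne'
    rw [hm, Nat.pred_succ] at h
    rw [hm, pow_succ]
    have : (3 : ℝ) ^ m ≤ t := by exact_mod_cast h.le
    linarith

theorem log_two_div {ε : ℝ} (h : 0 < ε) : Real.log (2 / ε) = Real.log 2 + Real.log (1 / ε) := by
  rw [Real.log_div two_ne_zero h.ne', Real.log_div one_ne_zero h.ne', Real.log_one]
  ring

/-- The power of three exceeds max(1, 3t) at most for t < ln(1/ε) + 1 in a harmless way: it is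
bounded by that maximum, and 8 ln 2 > 3 absorbs the additive constants. This is why 2/ε appears
instead of 1/ε. -/
theorem three_pow_clog_ceil_le {ε : ℝ} (h0 : 0 < ε) (h1 : ε < 1) :
    (3 : ℝ) ^ Nat.clog 3 ⌈Real.log (1 / ε)⌉₊ ≤ 8 * Real.log (2 / ε) := by
  have hl : 0 ≤ Real.log (1 / ε) := Real.log_nonneg (by rw [le_div_iff₀ h0]; linarith)
  have h2 := Real.log_two_gt_d9
  have h3 := (Nat.ceil_lt_add_one hl).le
  refine three_pow_clog_le.trans ?_
  rw [log_two_div h0]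
  exact max_le (by linarith) (by linarith)

/-- As e < 3, the base is at most e^(−1), and the exponent is at least ln(1/ε). -/
theorem pow_three_pow_clog_le {ε x : ℝ} (h0 : 0 < ε) (hx0 : 0 ≤ x) (hx : x ≤ 1 / 3) :
    x ^ 3 ^ Nat.clog 3 ⌈Real.log (1 / ε)⌉₊ ≤ ε := by
  set K := 3 ^ Nat.clog 3 ⌈Real.log (1 / ε)⌉₊
  have hK : Real.log (1 / ε) ≤ K :=
    (Nat.le_ceil _).trans (Nat.cast_le.2 (Nat.le_pow_clog (by norm_num) _))
  have hx' : x ≤ Real.exp (-1) := by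
    refine hx.trans ?_
    rw [Real.exp_neg, one_div]
    exact inv_anti₀ (Real.exp_pos _) (Real.exp_one_lt_d9.le.trans (by norm_num))
  calc x ^ K ≤ Real.exp (-1) ^ K := pow_le_pow_left₀ hx0 hx' _
    _ = Real.exp (-K) := by rw [← Real.exp_nat_mul]; ring_nf
    _ ≤ Real.exp (-Real.log (1 / ε)) := Real.exp_le_exp.2 (neg_le_neg hK)
    _ = ε := by rw [one_div, Real.log_inv, neg_neg, Real.exp_log h0]

theorem clog_mul_log_two_le {x : ℕ} (hx : 1 ≤ x) :
    Nat.clog 2 x * Real.log 2 ≤ Real.log x + Real.log 2 := by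
  have h2 : 0 < Real.log 2 := Real.log_pos one_lt_two
  rcases hx.eq_or_lt with rfl | hx
  · simpa using h2.le
  · have h := Nat.pow_pred_clog_lt_self one_lt_two hx
    obtain ⟨m, hm⟩ := Nat.exists_eq_succ_of_ne_zero (Nat.clog_pos one_lt_two hx).ne'
    rw [hm, Nat.pred_succ] at h
    have h' : Real.log ((2 : ℝ) ^ m) ≤ Real.log x :=
      Real.log_le_log (by positivity) (by exact_mod_cast h.le)
    rw [Real.log_pow] at h'
    rw [hm]
    push_cast
    linarith

/-- From ⌈log₂ p⌉ ln 2 ≤ ln p + ln 2 ≤ 2 ln p and 2/ln 2 < 3. -/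
theorem clog_le_log {p : ℕ} (hp : 2 ≤ p) : (Nat.clog 2 p : ℝ) ≤ 3 * Real.log p := by
  have h := clog_mul_log_two_le (one_le_two.trans hp)
  have h2 := Real.log_two_gt_d9
  have h3 : Real.log 2 ≤ Real.log p := Real.log_le_log two_pos (by exact_mod_cast hp)
  have h4 : (0 : ℝ) ≤ Nat.clog 2 p := Nat.cast_nonneg _
  nlinarith

theorem clog_add_one_le_log {n : ℕ} (hn : 1 ≤ n) :
    (Nat.clog 2 n : ℝ) + 1 ≤ 5 * Real.log (n + 1) := by
  have h := clog_mul_log_two_le hn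
  have hn' : (1 : ℝ) ≤ n := by exact_mod_cast hn
  have h2 := Real.log_two_gt_d9
  have h3 : Real.log 2 ≤ Real.log (n + 1) := Real.log_le_log two_pos (by linarith)
  have h4 : (0 : ℝ) ≤ Nat.clog 2 n := Nat.cast_nonneg _
  have h5 : Real.log n ≤ Real.log (n + 1) := Real.log_le_log (by linarith) (by linarith)
  nlinarith

theorem mul_sqrt_eq_rpow {n : ℕ} (hn : 1 ≤ n) : (n : ℝ) * √n = (n : ℝ) ^ (3 / 2 : ℝ) := by
  have hn' : (0 : ℝ) < n := by exact_mod_cast hn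
  rw [Real.sqrt_eq_rpow, show (3 / 2 : ℝ) = 1 + 1 / 2 by norm_num, Real.rpow_add hn', Real.rpow_one]

/-- Linear in n because of the one-hot index; the amplification level does not enter, so the bound
is independent of ε. -/
theorem card_anc_le {n p : ℕ} (hn : 1 ≤ n) (hp : 2 ≤ p) :
    (Fintype.card (Anc n p (Nat.clog 4 n)) : ℝ) ≤ 40 * (n * Real.log p) := by
  have h1 : Nat.clog 2 n ≤ n := Nat.clog_le_of_le_pow Nat.lt_two_pow_self.le
  have h2 : Nat.clog 4 n ≤ n := Nat.clog_le_of_le_pow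
    (Nat.lt_two_pow_self.le.trans (Nat.pow_le_pow_left (by norm_num) n))
  have h3 : Fintype.card (Anc n p (Nat.clog 4 n)) ≤ 10 * n + 3 * Nat.clog 2 p := by
    simp only [Anc, Fintype.card_sum, Fintype.card_fin, Fintype.card_unit]
    omega
  have h4 := clog_le_log hp
  have h5 : (Fintype.card (Anc n p (Nat.clog 4 n)) : ℝ) ≤ 10 * n + 3 * Nat.clog 2 p := by
    exact_mod_cast h3
  have h6 : Real.log 2 ≤ Real.log p := Real.log_le_log two_pos (by exact_mod_cast hp)
  have h7 := Real.log_two_gt_d9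
  have hn' : (1 : ℝ) ≤ n := by exact_mod_cast hn
  nlinarith

/-! ### Product states and measurement statistics -/

section Product

variable {X Y : Type} [Fintype X] [DecidableEq X] [Fintype Y] [DecidableEq Y]

theorem tensor_smul (a : ℂ) (ψ : QState X) (φ : QState Y) :
    tensor (a • ψ) φ = a • tensor ψ φ := by
  funext x
  simp [tensor, mul_assoc]

theorem tensor_sum {ι : Type} (s : Finset ι) (ψ : ι → QState X) (φ : QState Y) :
    tensor (∑ i ∈ s, ψ i) φ = ∑ i ∈ s, tensor (ψ i) φ := by
  funext x
  simp [tensor, Finset.sum_apply, Finset.sum_mul]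

theorem onWires_inl_mulVec_tensor (G : QOp X) (ψ : QState X) (φ : QState Y) :
    onWires ⟨Sum.inl, Sum.inl_injective⟩ G *ᵥ tensor ψ φ = tensor (G *ᵥ ψ) φ :=
  onWires_mulVec_mul (W' := X ⊕ Y) ⟨Sum.inl, Sum.inl_injective⟩ Sum.inr
    (fun _ _ => Sum.inl_ne_inr) G ψ φ

theorem normSq_tensor (ψ : QState X) (φ : QState Y) :
    normSq (tensor ψ φ) = normSq ψ * normSq φ := by
  rw [normSq, normSq, normSq, Finset.sum_mul_sum, ← Fintype.sum_prod_type']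
  refine Fintype.sum_equiv (Equiv.sumArrowEquivProdArrow X Y Bool) _ _ fun x => ?_
  rw [tensor, norm_mul, mul_pow]
  rfl

theorem prob_eq_normSq (ψ : QState X) (S : Set (X → Bool)) : prob ψ S = normSq (S.indicator ψ) := by
  refine Finset.sum_congr rfl fun x _ => ?_
  by_cases h : x ∈ S <;> simp [h]

theorem prob_biUnion (ψ : QState X) {ι : Type} [Fintype ι] (P : ι → Prop) [DecidablePred P]
    (S : ι → Set (X → Bool)) (h : ∀ i j x, x ∈ S i → x ∈ S j → i = j) :
    prob ψ (⋃ i ∈ {i | P i}, S i) = ∑ i with P i, prob ψ (S i) := by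
  simp only [prob]
  rw [Finset.sum_comm]
  refine Finset.sum_congr rfl fun x _ => ?_
  by_cases hx : ∃ i, P i ∧ x ∈ S i
  · obtain ⟨i, hi, hxi⟩ := hx
    rw [Set.indicator_of_mem (Set.mem_biUnion (s := {i | P i}) hi hxi),
      Finset.sum_eq_single_of_mem i (by simpa using hi), Set.indicator_of_mem hxi]
    exact fun j _ hj => Set.indicator_of_notMem (fun hxj => hj (h j i x hxj hxi)) _
  · rw [Set.indicator_of_notMem (by simpa using hx), Finset.sum_eq_zero]
    exact fun i hi => Set.indicator_of_notMem (fun hxi => hx ⟨i, by simpa using hi, hxi⟩) _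

theorem prob_false_add_prob_true (ψ : QState X) (f : X) :
    prob ψ {x | x f = false} + prob ψ {x | x f = true} = normSq ψ := by
  rw [prob, prob, normSq, ← Finset.sum_add_distrib]
  refine Finset.sum_congr rfl fun x _ => ?_
  cases h : x f <;> simp [Set.indicator, h]

end Product

theorem encVec_inj {n p : ℕ} [NeZero p] {v w : Fin n → ZMod p} : encVec v = encVec w ↔ v = w :=
  encVec_injective.eq_iff

/-- Measuring the output register and the flag of a superposition over outputs. -/
theorem prob_outputFlag {n p s a : ℕ} [NeZero p] (v : Fin n → ZMod p)
    (β : (Fin n → ZMod p) → ℂ) (w : (Fin n → ZMod p) → QState (Fin s))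
    (χ : (Fin n → ZMod p) → QState (Fin a)) (z : Fin n → ZMod p) (f : Fin a) (b : Bool)
    (hw : IsNormalised (w z)) :
    prob (∑ y, β y • tensor (algState v y (w y)) (χ y)) (outputFlag z f b) =
      ‖β z‖ ^ 2 * prob (χ z) {x | x f = b} := by
  -- Output registers holding different vectors are orthogonal, so the event selects the single
  -- summand `z`.
  have h : (outputFlag z f b).indicator (∑ y, β y • tensor (algState v y (w y)) (χ y)) =
      β z • tensor (algState v z (w z)) ({x | x f = b}.indicator (χ z)) := by
    funext x
    have hk : ∀ y, y ≠ z → encVec z = x ∘ Sum.inl ∘ Sum.inr ∘ Sum.inl →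
        tensor (algState v y (w y)) (χ y) x = 0 := fun y hy h => by
      have : ket (encVec y) (encVec z) = 0 := by
        rw [ket_apply, if_neg]
        exact fun h => hy (encVec_inj.1 h).symm
      simp only [tensor, algState]
      change _ * (ket (encVec y) (x ∘ Sum.inl ∘ Sum.inr ∘ Sum.inl) * _) * _ = _
      rw [← h, this]
      simp
    by_cases hx : x ∈ outputFlag z f b
    · rw [Set.indicator_of_mem hx, Finset.sum_apply, Finset.sum_eq_single z]
      · simp only [Pi.smul_apply, tensor]
        rw [Set.indicator_of_mem (by exact hx.2)]
      · intro y _ hy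
        rw [Pi.smul_apply, hk y hy hx.1.symm, smul_zero]
      · simp
    · rw [Set.indicator_of_notMem hx, Pi.smul_apply, tensor]
      by_cases h1 : x (Sum.inr f) = b
      · have h2 : ket (encVec z) (x ∘ Sum.inl ∘ Sum.inr ∘ Sum.inl) = 0 := by
          rw [ket_apply, if_neg]
          exact fun h => hx ⟨h, h1⟩
        simp only [tensor, algState]
        change _ = β z • (_ * (ket (encVec z) (x ∘ Sum.inl ∘ Sum.inr ∘ Sum.inl) * _) * _)
        simp [h2]
      · rw [Set.indicator_of_notMem (by exact h1)]
        simp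
  rw [prob_eq_normSq, h, normSq_smul, normSq_tensor, algState, normSq_tensor, normSq_tensor,
    normSq_ket, normSq_ket, prob_eq_normSq, show normSq (w z) = 1 from hw]
  ring

/-! ### The verified algorithm -/

section VerifiedAlgorithm

variable {n p s m a : ℕ}

/-- The qubits of the verification circuit within those of the verified algorithm. -/
def subWires (ea : Anc n p m ≃ Fin a) : SubReg n p m ↪ VerReg n p s a where
  toFun := Sum.elim (fun q => .inl (.inl q))
    (Sum.elim (fun q => .inl (.inr (.inl q))) fun w => .inr (ea w))
  inj' := by
    rintro (q | q | q) (q' | q' | q') h <;> simp_all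

/-- The noisy algorithm, followed by the verification circuit. -/
def verifiedAlg (ea : Anc n p m ≃ Fin a) [NeZero n] (k : ℕ) :
    Circuit (VerReg n p s a) (OracleReg n p) (AlgReg n p s) :=
  .call false ⟨Sum.inl, Sum.inl_injective⟩ :: (verifier k).relabel (subWires ea)

/-- The ancilla state attached to the output `z`. -/
def ancState [NeZero n] (ea : Anc n p m ≃ Fin a) (U : QOp (OracleReg n p))
    (A : QOp (AlgReg n p s)) (k : ℕ) (v z : Fin n → ZMod p) : QState (Fin a) :=
  fun x => verified U A m k v z (Sum.elim (encVec v) (Sum.elim (encVec z) (x ∘ ea)))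

/-- Regroups the factors so that the workspace stands apart from the qubits on which the verifier
acts. -/
theorem tensor_algState (ea : Anc n p m ≃ Fin a) (v z : Fin n → ZMod p) (w : QState (Fin s))
    (χ : QState (Fin a)) :
    tensor (algState v z w) χ = fun x : VerReg n p s a → Bool =>
      tensor (ket (encVec v)) (tensor (ket (encVec z)) fun y => χ (y ∘ ea.symm))
        (x ∘ subWires ea) * w (x ∘ fun i => .inl (.inr (.inr i))) := by
  funext x
  have h : ((((x ∘ subWires ea) ∘ Sum.inr) ∘ Sum.inr) ∘ ea.symm) = x ∘ Sum.inr := by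
    funext i
    exact congrArg (fun j => x (Sum.inr j)) (ea.apply_symm_apply i)
  simp only [tensor, algState, h]
  change ket (encVec v) (x ∘ fun q => .inl (.inl q)) *
      (ket (encVec z) (x ∘ fun q => .inl (.inr (.inl q))) * w (x ∘ fun i => .inl (.inr (.inr i)))) *
      χ (x ∘ Sum.inr) =
    ket (encVec v) (x ∘ fun q => .inl (.inl q)) *
      (ket (encVec z) (x ∘ fun q => .inl (.inr (.inl q))) * χ (x ∘ Sum.inr)) *
      w (x ∘ fun i => .inl (.inr (.inr i)))
  ring

/-- A state in which `v` and `z` are fixed basis strings is a product state; the remaining factor is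
what becomes the ancilla state. -/
theorem eq_tensor_of_mem_holding {v z : Fin n → ZMod p} {ψ : QState (SubReg n p m)}
    (h : ψ ∈ supported (holding v z)) :
    ψ = tensor (ket (encVec v)) (tensor (ket (encVec z)) fun y =>
      ψ (Sum.elim (encVec v) (Sum.elim (encVec z) y))) := by
  funext x
  simp only [tensor, ket_apply]
  by_cases hx : x ∈ holding v z
  · have h1 : x ∘ Sum.inl = encVec v := funext hx.1
    have h2 : (x ∘ Sum.inr) ∘ Sum.inl = encVec z := funext hx.2
    rw [if_pos h1, if_pos h2, one_mul, one_mul, ← h1, ← h2, Sum.elim_comp_inl_inr,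
      Sum.elim_comp_inl_inr]
  · rw [h x hx]
    by_cases h1 : x ∘ Sum.inl = encVec v
    · rw [if_neg (c := (x ∘ Sum.inr) ∘ Sum.inl = encVec z)]
      · simp
      · exact fun h2 => hx ⟨congrFun h1, congrFun h2⟩
    · simp [h1]

variable [NeZero n] [NeZero p] {M : Matrix (Fin n) (Fin n) (ZMod p)} {U : QOp (OracleReg n p)}
  {A : QOp (AlgReg n p s)}

theorem normSq_of_mem_holding {v z : Fin n → ZMod p} {ψ : QState (SubReg n p m)}
    (h : ψ ∈ supported (holding v z)) (ea : Anc n p m ≃ Fin a) :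
    normSq ψ = normSq fun x : Fin a → Bool =>
      ψ (Sum.elim (encVec v) (Sum.elim (encVec z) (x ∘ ea))) := by
  conv_lhs => rw [eq_tensor_of_mem_holding h]
  rw [normSq_tensor, normSq_tensor, normSq_ket, normSq_ket, one_mul, one_mul]
  refine Fintype.sum_equiv (Equiv.arrowCongr ea (Equiv.refl Bool)) _ _ fun y => ?_
  have h : (Equiv.arrowCongr ea (Equiv.refl Bool) y) ∘ ea = y := by
    funext i
    simp
  simp only [h]

theorem normSq_ancState (hM : IsMatrixOracle M U)
    (hA : A ∈ Matrix.unitaryGroup (AlgReg n p s → Bool) ℂ) (ea : Anc n p m ≃ Fin a) (k : ℕ)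
    (v z : Fin n → ZMod p) : normSq (ancState ea U A k v z) = 1 := by
  rw [← normSq_verified hM hA v z k, normSq_of_mem_holding (verified_mem hM hA v z k) ea]
  rfl

theorem prob_ancState_false (hM : IsMatrixOracle M U)
    (hA : A ∈ Matrix.unitaryGroup (AlgReg n p s → Bool) ℂ) (ea : Anc n p m ≃ Fin a) (k : ℕ)
    (v z : Fin n → ZMod p) {f : Fin a}
    (hf : ea.symm f = .inr (.inr (.inr (.inr (.inr (.inr (.inr ()))))))) :
    prob (ancState ea U A k v z) {x | x f = false} = missProb U A m v z ^ 3 ^ k := by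
  rw [← normSq_verified_unflagged hM hA v z k, prob_eq_normSq,
    normSq_of_mem_holding (supported_mono Set.inter_subset_left (indicator_mem_supported
      {x : SubReg n p m → Bool | x fin = false} (verified_mem hM hA v z k))) ea]
  congr 1
  funext x
  obtain rfl : f = ea _ := (Equiv.symm_apply_eq ea).1 hf
  rfl

/-- The verifier acts on each summand separately and leaves its algorithm part unchanged, so
linearity attaches `ancState` term by term. -/
theorem eval_verifiedAlg (hM : IsMatrixOracle M U)
    (hA : A ∈ Matrix.unitaryGroup (AlgReg n p s → Bool) ℂ) (ea : Anc n p m ≃ Fin a) (k : ℕ)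
    {v : Fin n → ZMod p} {ι : Type} [Fintype ι] (β : ι → ℂ) (z : ι → Fin n → ZMod p)
    (w : ι → QState (Fin s))
    (h : A *ᵥ algInput v = ∑ i, β i • algState v (z i) (w i)) :
    (verifiedAlg ea k).eval U A *ᵥ tensor (algInput v) (ket zeros) =
      ∑ i, β i • tensor (algState v (z i) (w i)) (ancState ea U A k v (z i)) := by
  have hz (z : Fin n → ZMod p) (w : QState (Fin s)) :
      onWires (subWires ea) ((verifier k).eval U A) *ᵥ tensor (algState v z w) (ket zeros) =
        tensor (algState v z w) (ancState ea U A k v z) := by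
    have h0 : (fun y : Anc n p m → Bool => ket (zeros : Fin a → Bool) (y ∘ ea.symm)) = ket zeros := by
      funext y
      rw [ket_apply, ket_apply]
      refine if_congr ⟨fun h => ?_, fun h => ?_⟩ rfl rfl
      · funext i
        simpa [zeros] using congrFun h (ea i)
      · rw [h]
        rfl
    rw [tensor_algState ea, tensor_algState ea, h0, onWires_mulVec_mul]
    · have h1 := eq_tensor_of_mem_holding (verified_mem (m := m) hM hA v z k)
      have h2 : (fun y : Anc n p m → Bool => ancState ea U A k v z (y ∘ ea.symm)) = fun y =>
          verified U A m k v z (Sum.elim (encVec v) (Sum.elim (encVec z) y)) := by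
        funext y
        simp [ancState, Function.comp_assoc]
      rw [h2, ← h1]
      rfl
    · rintro i (q | q | q) <;> exact fun h => by cases h
  rw [verifiedAlg, Circuit.eval, eval_relabel, ← Matrix.mulVec_mulVec, Instr.op]
  simp only [Bool.false_eq_true, if_false]
  rw [onWires_inl_mulVec_tensor, h, tensor_sum, Matrix.mulVec_sum]
  simp only [tensor_smul, Matrix.mulVec_smul, hz]

end VerifiedAlgorithm

/-! ### Cost and correctness of the complete circuit. -/

theorem queries_verifiedAlg_le {n p s a : ℕ} [NeZero n] (ea : Anc n p (Nat.clog 4 n) ≃ Fin a)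
    {ε : ℝ} (h0 : 0 < ε) (h1 : ε < 1) :
    ((verifiedAlg (s := s) ea (Nat.clog 3 ⌈Real.log (1 / ε)⌉₊)).queries : ℝ) ≤
      64 * ((n : ℝ) ^ (3 / 2 : ℝ) * Real.log (2 / ε)) := by
  set k := Nat.clog 3 ⌈Real.log (1 / ε)⌉₊ with hk
  have hn : 1 ≤ n := NeZero.pos n
  have h : (verifiedAlg (s := s) ea k).queries ≤ 3 ^ k * (2 ^ Nat.clog 4 n * (4 * n)) := by
    rw [verifiedAlg, Circuit.queries, List.countP_cons_of_neg (by simp [Instr.isQuery])]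
    exact (queries_relabel _ _).trans_le (queries_verifier_le k)
  have h' : ((verifiedAlg (s := s) ea k).queries : ℝ) ≤ 3 ^ k * (2 ^ Nat.clog 4 n * (4 * n)) := by
    exact_mod_cast h
  refine h'.trans ?_
  have h2 := three_pow_clog_ceil_le h0 h1
  rw [← hk] at h2
  have h3 := two_pow_clog_le hn
  have h6 : 0 ≤ Real.log (2 / ε) := Real.log_nonneg (by rw [le_div_iff₀ h0]; linarith)
  calc (3 : ℝ) ^ k * (2 ^ Nat.clog 4 n * (4 * n))
      ≤ (8 * Real.log (2 / ε)) * ((2 * √n) * (4 * n)) := by gcongr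
    _ = _ := by rw [← mul_sqrt_eq_rpow hn]; ring

theorem gates_verifiedAlg_le {n p s a : ℕ} [NeZero n] (hp : 2 ≤ p)
    (ea : Anc n p (Nat.clog 4 n) ≃ Fin a) {ε : ℝ} (h0 : 0 < ε) (h1 : ε < 1) :
    ((verifiedAlg (s := s) ea (Nat.clog 3 ⌈Real.log (1 / ε)⌉₊)).gates : ℝ) ≤
      648000 * ((n : ℝ) ^ (3 / 2 : ℝ) * Real.log (2 / ε)) * Real.log ((n : ℝ) + 1) *
        Real.log p ^ 3 := by
  set k := Nat.clog 3 ⌈Real.log (1 / ε)⌉₊ with hk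
  have hn : 1 ≤ n := NeZero.pos n
  have h : (verifiedAlg (s := s) ea k).gates ≤
      3 ^ k * (2 ^ Nat.clog 4 n * (300 * (n * (Nat.clog 2 n + 1) * Nat.clog 2 p ^ 3))) := by
    rw [verifiedAlg, Circuit.gates, List.countP_cons_of_neg (by simp [Instr.isGate])]
    exact (gates_relabel _ _).trans_le (gates_verifier_le hp k)
  have h' : ((verifiedAlg (s := s) ea k).gates : ℝ) ≤
      3 ^ k * (2 ^ Nat.clog 4 n * (300 * (n * (Nat.clog 2 n + 1) * Nat.clog 2 p ^ 3))) := by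
    exact_mod_cast h
  refine h'.trans ?_
  have h2 := three_pow_clog_ceil_le h0 h1
  rw [← hk] at h2
  have h3 := two_pow_clog_le hn
  have h4 := clog_add_one_le_log hn
  have h5 := clog_le_log hp
  have h6 : 0 ≤ Real.log (2 / ε) := Real.log_nonneg (by rw [le_div_iff₀ h0]; linarith)
  have h7 : 0 ≤ Real.log ((n : ℝ) + 1) := Real.log_nonneg (by simp)
  calc (3 : ℝ) ^ k * (2 ^ Nat.clog 4 n * (300 * (n * (Nat.clog 2 n + 1) * Nat.clog 2 p ^ 3)))
      ≤ (8 * Real.log (2 / ε)) *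
        ((2 * √n) * (300 * (n * (5 * Real.log (n + 1)) * (3 * Real.log p) ^ 3))) := by gcongr
    _ = _ := by rw [← mul_sqrt_eq_rpow hn]; ring

theorem calls_verifiedAlg {n p s m a : ℕ} [NeZero n] (ea : Anc n p m ≃ Fin a) (k : ℕ) :
    (verifiedAlg (s := s) ea k).calls = 1 := by
  rw [verifiedAlg, Circuit.calls, List.countP_cons_of_pos (by rfl)]
  exact congrArg (· + 1) ((calls_relabel _ _).trans (calls_verifier k))

/-- Merges the correct and the wrong branches into one sum over all outputs, the form to which
linearity and the measurement formula apply. -/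
theorem smul_add_smul_sum_eq {ι S V : Type} [Fintype ι] [DecidableEq ι] [AddCommGroup V] [Module ℂ V]
    (F : ι → S → V) (i₀ : ι) (a b : ℂ) (γ : ι → ℂ) (w₀ : S) (w : ι → S) :
    a • F i₀ w₀ + b • ∑ i with i ≠ i₀, γ i • F i (w i) =
      ∑ i, (if i = i₀ then a else b * γ i) • F i (if i = i₀ then w₀ else w i) := by
  rw [← Finset.sum_filter_add_sum_filter_not Finset.univ (· = i₀), Finset.filter_eq' Finset.univ i₀,
    if_pos (Finset.mem_univ _), Finset.sum_singleton, if_pos rfl, if_pos rfl, Finset.smul_sum]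
  congr 1
  refine Finset.sum_congr rfl fun i hi => ?_
  rw [if_neg (Finset.mem_filter.1 hi).2, if_neg (Finset.mem_filter.1 hi).2, smul_smul]

/-- The ancilla states depend on `z` only through the test, so the original amplitudes are kept; the
probabilities then add up because the events of different outputs are disjoint. -/
theorem verifiedAlg_correct {n p s m a : ℕ} [NeZero n] [NeZero p] (ea : Anc n p m ≃ Fin a) {f : Fin a}
    (hf : ea.symm f = .inr (.inr (.inr (.inr (.inr (.inr (.inr ()))))))) (hm : n ≤ 4 ^ m) {k : ℕ}
    {ε : ℝ} (hk : ∀ x : ℝ, 0 ≤ x → x ≤ 1 / 3 → x ^ 3 ^ k ≤ ε)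
    {M : Matrix (Fin n) (Fin n) (ZMod p)} {U : QOp (OracleReg n p)} (hM : IsMatrixOracle M U)
    {A : QOp (AlgReg n p s)} (hA : A ∈ Matrix.unitaryGroup (AlgReg n p s → Bool) ℂ)
    {v : Fin n → ZMod p} {βs βf : ℂ} {w₀ : QState (Fin s)} {γ : (Fin n → ZMod p) → ℂ}
    {w : (Fin n → ZMod p) → QState (Fin s)} (h : IsNoisyOutput M A v βs βf w₀ γ w) :
    (∃ χ : (Fin n → ZMod p) → QState (Fin a),
      (verifiedAlg ea k).eval U A *ᵥ tensor (algInput v) (ket zeros) =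
        βs • tensor (algState v (M *ᵥ v) w₀) (χ (M *ᵥ v)) +
        βf • ∑ z with z ≠ M *ᵥ v, γ z • tensor (algState v z (w z)) (χ z) ∧
      (∀ z, IsNormalised (χ z)) ∧
      prob (χ (M *ᵥ v)) {x | x f = false} = 1 ∧
      ∀ z, z ≠ M *ᵥ v → 1 - ε ≤ prob (χ z) {x | x f = true}) ∧
    prob ((verifiedAlg ea k).eval U A *ᵥ tensor (algInput v) (ket zeros))
      (outputFlag (M *ᵥ v) f false) = ‖βs‖ ^ 2 ∧
    (1 - ε) * ‖βf‖ ^ 2 ≤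
      prob ((verifiedAlg ea k).eval U A *ᵥ tensor (algInput v) (ket zeros))
        (⋃ z ∈ {z : Fin n → ZMod p | z ≠ M *ᵥ v}, outputFlag z f true) := by
  have hright : prob (ancState ea U A k v (M *ᵥ v)) {x | x f = false} = 1 := by
    rw [prob_ancState_false hM hA ea k _ _ hf, missProb_correct hM hA, one_pow]
  have hwrong (z : Fin n → ZMod p) (hz : z ≠ M *ᵥ v) :
      1 - ε ≤ prob (ancState ea U A k v z) {x | x f = true} := by
    have h1 := prob_false_add_prob_true (ancState ea U A k v z) f
    rw [normSq_ancState hM hA, prob_ancState_false hM hA ea k _ _ hf] at h1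
    have h2 := hk _ (missProb_nonneg (U := U) (A := A) v z) (missProb_wrong hM hA hz hm)
    linarith
  have hin := h.output
  rw [smul_add_smul_sum_eq (algState v)] at hin
  have hout := eval_verifiedAlg hM hA ea k _ _ _ hin
  refine ⟨⟨ancState ea U A k v, ?_, normSq_ancState hM hA ea k v, hright, hwrong⟩, ?_, ?_⟩
  · rw [hout, ← smul_add_smul_sum_eq fun z w => tensor (algState v z w) (ancState ea U A k v z)]
  · rw [hout, prob_outputFlag v _ (fun z => if z = M *ᵥ v then w₀ else w z), if_pos rfl, hright, mul_one]
    rw [if_pos rfl]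
    exact h.right_normalised
  · rw [hout, prob_biUnion _ _ _ fun z z' x hx hx' => encVec_inj.1 (hx.1.symm.trans hx'.1)]
    calc (1 - ε) * ‖βf‖ ^ 2 = ∑ z with z ≠ M *ᵥ v, ‖βf * γ z‖ ^ 2 * (1 - ε) := by
          simp only [norm_mul, mul_pow]
          rw [← Finset.sum_mul, ← Finset.mul_sum, h.wrong_weights]
          ring
      _ ≤ _ := Finset.sum_le_sum fun z hz => ?_
    have hz' : z ≠ M *ᵥ v := (Finset.mem_filter.1 hz).2
    rw [prob_outputFlag v _ (fun z => if z = M *ᵥ v then w₀ else w z), if_neg hz']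
    · exact mul_le_mul_of_nonneg_left (hwrong z hz') (by positivity)
    · rw [if_neg hz']
      exact h.wrong_normalised z hz'

end MvVerify

end

theorem lemma5p2 :
    ∃ (C : ℝ) (d : ℕ), ∀ (p : ℕ) [Fact p.Prime] (n : ℕ), 1 ≤ n →
      ∀ ε : ℝ, 0 < ε → ε < 1 → ∀ s : ℕ,
      -- a circuit with `a` ancillas, one of which, `f`, is the flag (0: correct, 1: incorrect)
      ∃ (a : ℕ) (f : Fin a)
        (c : MvVerify.Circuit (MvVerify.VerReg n p s a) (MvVerify.OracleReg n p)
          (MvVerify.AlgReg n p s)),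
        -- resources
        (c.queries : ℝ) ≤ C * ((n : ℝ) ^ (3 / 2 : ℝ) * Real.log (2 / ε)) ∧
        (c.calls : ℝ) ≤ C ∧
        (c.gates : ℝ) ≤ C * ((n : ℝ) ^ (3 / 2 : ℝ) * Real.log (2 / ε)) *
          Real.log ((n : ℝ) + 1) * Real.log (p : ℝ) ^ d ∧
        (a : ℝ) ≤ C * ((n : ℝ) * Real.log (p : ℝ)) ∧
        -- correctness, for every matrix, every oracle for it, and every noisy algorithm
        ∀ (M : Matrix (Fin n) (Fin n) (ZMod p)) (U : MvVerify.QOp (MvVerify.OracleReg n p)),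
          MvVerify.IsMatrixOracle M U →
        ∀ A : MvVerify.QOp (MvVerify.AlgReg n p s),
          A ∈ Matrix.unitaryGroup (MvVerify.AlgReg n p s → Bool) ℂ →
        ∀ (βs βf : (Fin n → ZMod p) → ℂ) (w₀ : (Fin n → ZMod p) → MvVerify.QState (Fin s))
          (γ : (Fin n → ZMod p) → (Fin n → ZMod p) → ℂ)
          (w : (Fin n → ZMod p) → (Fin n → ZMod p) → MvVerify.QState (Fin s)),
          (∀ v, MvVerify.IsNoisyOutput M A v (βs v) (βf v) (w₀ v) (γ v) (w v)) →
        ∀ v : Fin n → ZMod p,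
          -- the superposition of the given algorithm is kept, and to each output `z` a
          -- normalised ancilla state `χ z` is attached
          (∃ χ : (Fin n → ZMod p) → MvVerify.QState (Fin a),
            c.eval U A *ᵥ MvVerify.tensor (MvVerify.algInput v) (MvVerify.ket MvVerify.zeros) =
              βs v • MvVerify.tensor (MvVerify.algState v (M *ᵥ v) (w₀ v)) (χ (M *ᵥ v)) +
              βf v • ∑ z with z ≠ M *ᵥ v,
                γ v z • MvVerify.tensor (MvVerify.algState v z (w v z)) (χ z) ∧
            (∀ z, MvVerify.IsNormalised (χ z)) ∧
            MvVerify.prob (χ (M *ᵥ v)) {x | x f = false} = 1 ∧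
            ∀ z, z ≠ M *ᵥ v → 1 - ε ≤ MvVerify.prob (χ z) {x | x f = true}) ∧
          -- measurement statistics of output register and flag
          MvVerify.prob
              (c.eval U A *ᵥ MvVerify.tensor (MvVerify.algInput v) (MvVerify.ket MvVerify.zeros))
              (MvVerify.outputFlag (M *ᵥ v) f false) = ‖βs v‖ ^ 2 ∧
          (1 - ε) * ‖βf v‖ ^ 2 ≤
            MvVerify.prob
              (c.eval U A *ᵥ MvVerify.tensor (MvVerify.algInput v) (MvVerify.ket MvVerify.zeros))
              (⋃ z ∈ {z : Fin n → ZMod p | z ≠ M *ᵥ v}, MvVerify.outputFlag z f true) := by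
  -- The gate count dominates: 648000 = 8 · 2 · 300 · 5 · 3³, from 3^k, 2^m, the gate bound, ⌈log₂
  -- n⌉ + 1 and ⌈log₂ p⌉³. The cube also gives `d = 3`; the other bounds need only 64, 1 and 40.
  refine ⟨648000, 3, fun p _ n hn ε h0 h1 s => ?_⟩
  have hp : 2 ≤ p := (Fact.out : p.Prime).two_le
  have : NeZero n := ⟨by omega⟩
  have hlog : 0 ≤ Real.log (2 / ε) := Real.log_nonneg (by rw [le_div_iff₀ h0]; linarith)
  have hlogp : 0 ≤ Real.log p := Real.log_natCast_nonneg p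
  let ea := Fintype.equivFin (MvVerify.Anc n p (Nat.clog 4 n))
  -- The number of stages `Nat.clog 4 n` is the least m with 4^m ≥ n, so 2^m = O(√n). The
  -- amplification level is the least k with 3^k ≥ ⌈ln(1/ε)⌉.
  refine ⟨_, ea (.inr (.inr (.inr (.inr (.inr (.inr (.inr ()))))))),
    MvVerify.verifiedAlg ea (Nat.clog 3 ⌈Real.log (1 / ε)⌉₊), ?_, ?_, ?_, ?_, ?_⟩
  · refine (MvVerify.queries_verifiedAlg_le ea h0 h1).trans ?_
    gcongr
    norm_num
  · rw [MvVerify.calls_verifiedAlg]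
    norm_num
  · exact MvVerify.gates_verifiedAlg_le hp ea h0 h1
  · refine (MvVerify.card_anc_le hn hp).trans ?_
    gcongr
    norm_num
  · intro M U hM A hA βs βf w₀ γ w h v
    exact MvVerify.verifiedAlg_correct ea (ea.symm_apply_apply _) (Nat.le_pow_clog (by norm_num) n)
      (fun x hx0 hx => MvVerify.pow_three_pow_clog_le h0 hx0 hx) hM hA (h v)
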